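/- Let $(M,L)$ be a Finsler spacetime of dimension $n+1\ge 2$: $M$ is a connected smooth manifold of dimension $n+1$ without boundary, $L\colon TM\to\mathbb R$ is smooth on $TM\setminus\{0\}$, satisfies $L(cv)=c^2L(v)$ for $c>0$, and for every $v\neq 0$ the matrix $g_{\alpha\beta}(v)=\partial^2L/\partial v^\alpha\partial v^\beta(v)$ is non-degenerate of signature $(-,+,\dots,+)$; and $M$ carries a smooth vector field $X$ with $L(X)<0$ (the time orientation). Write $g_v(a,b)=\sum a^\alpha b^\beta g_{\alpha\beta}(v)$ and $F(v)=\sqrt{-2L(v)}$. Let $\Omega_x\subset T_xM$ be the set of future-directed timelike vectors, i.e. of those $v$ with $L(v)<0$ lying in the connected component of $\overline{\{L<0\}}\setminus\{0\}$ (closure in $T_xM$) that contains $X(x)$, and put $\Omega=\bigcup_x\Omega_x$, $\overline\Omega\setminus\{0\}=\bigcup_x(\overline{\Omega}_x\setminus\{0\})$. Let $\psi\colon\overline\Omega\setminus\{0\}\to\mathbb R$ be smooth with $\psi(cv)=\psi(v)$ for $c>0$, and write $\psi_\eta(t)=\psi(\dot\eta(t))$ for a curve $\eta$. Let $\widetilde\Gamma^\alpha_{\beta\gamma}(v)=\frac12\sum_\delta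 g^{\alpha\delta}(v)\big(\partial_{x^\beta}g_{\delta\gamma}+\partial_{x^\gamma}g_{\beta\delta}-\partial_{x^\delta}g_{\beta\gamma}\big)(v)$, $G^\alpha(v)=\frac12\sum\widetilde\Gamma^\alpha_{\beta\gamma}(v)v^\beta v^\gamma$, $N^\alpha_\beta=\partial G^\alpha/\partial v^\beta$, and $$R^\alpha_\beta(v)=2\frac{\partial G^\alpha}{\partial x^\beta}-\sum_\gamma\Big(\frac{\partial N^\alpha_\beta}{\partial x^\gamma}v^\gamma-2\frac{\partial N^\alpha_\beta}{\partial v^\gamma}G^\gamma\Big)-\sum_\gamma N^\alpha_\gamma N^\gamma_\beta .$$ These define the curvature endomorphism $R_v(w)=\sum R^\alpha_\beta(v)w^\beta\,\partial/\partial x^\alpha$ and $\mathrm{Ric}(v)=\operatorname{trace}R_v$. A (future-directed) timelike geodesic is a smooth curve $\eta\colon(a,b)\to M$, $-\infty\le a<b\le+\infty$, with $\dot\eta\in\Omega$ and $\ddot\eta^\alpha+2G^\alpha(\dot\eta)=0$. It is inextendible if $\eta(t)$ converges neither as $t\to a$ nor as $t\to b$. Let $D$ be the covariant derivative along $\eta$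 with reference vector $\dot\eta$, $(DY)^\alpha=\dot Y^\alpha+\sum\Gamma^\alpha_{\beta\gamma}(\dot\eta)\dot\eta^\beta Y^\gamma$, with the Chern connection coefficients $\Gamma^\alpha_{\beta\gamma}=\widetilde\Gamma^\alpha_{\beta\gamma}-\frac12\sum_{\delta,\mu}g^{\alpha\delta}\big(\partial_{v^\mu}g_{\delta\gamma}N^\mu_\beta+\partial_{v^\mu}g_{\beta\delta}N^\mu_\gamma-\partial_{v^\mu}g_{\beta\gamma}N^\mu_\delta\big)$. A Jacobi field along $\eta$ is a solution $Y$ of $DDY+R_{\dot\eta}(Y)=0$; $\eta$ contains a pair of conjugate points if some nontrivial Jacobi field along $\eta$ vanishes at two distinct times in $(a,b)$. For $v\in\Omega$ let $\eta$ be the geodesic with $\dot\eta(0)=v$, and set $\mathrm{Ric}_N(v)=\mathrm{Ric}(v)+\psi_\eta''(0)-\psi_\eta'(0)^2/(N-n)$ for $N\in\mathbb R\setminus\{n\}$, $\mathrm{Ric}_\infty(v)=\mathrm{Ric}(v)+\psi_\eta''(0)$, and $\mathrm{Ric}_n(v)=\mathrm{Ric}(v)+\psi_\eta''(0)$ if $\psi_\eta'(0)=0$,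 $\mathrm{Ric}_n(v)=-\infty$ otherwise. For $\epsilon\in\mathbb R$, an $\epsilon$-proper time of a timelike geodesic $\eta$ is an antiderivative $\tau_\epsilon$ of $e^{\frac{2(\epsilon-1)}{n}\psi_\eta}$ with respect to proper time, i.e. $\frac{d\tau_\epsilon}{dt}=e^{\frac{2(\epsilon-1)}{n}\psi_\eta(t)}F(\dot\eta(t))$. The geodesic $\eta$ is $\epsilon$-complete if it is inextendible, $\tau_\epsilon\to+\infty$ as $t\to b$ and $\tau_\epsilon\to-\infty$ as $t\to a$; otherwise it is $\epsilon$-incomplete. **Theorem.** Let $N\in(-\infty,0)\cup[n,+\infty]$. Assume 1. (timelike genericity) along every inextendible future-directed timelike geodesic $\eta$ there is a time $t_1$ such that $R_{\dot\eta(t_1)}$ is not identically zero on the $g_{\dot\eta(t_1)}$-orthogonal complement of $\dot\eta(t_1)$; 2. (timelike $N$-convergence) $\mathrm{Ric}_N(v)\ge0$ for all $v\in\Omega$. Then every future-directed timelike geodesic of $M$ either contains a pair of conjugate points or is $\epsilon$-incomplete for every $\epsilon\in\mathbb R$ in the timelike $\epsilon$-range, i.e. every $\epsilon$ with $|\epsilon|<\sqrt{N/(N-n)}$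 (read as $|\epsilon|<1$ if $N=+\infty$, and as no restriction if $N=n$). -/

import Mathlib

open scoped Manifold ContDiff Topology

noncomputable section

namespace LorentzFinsler

/-! ### Local coordinates

`M` is a manifold of dimension `n + 1` modelled on `ℝ^(n+1)`. Each point `p` of `M` labels a chart
`extChartAt (𝓡 (n + 1)) p`, whose coordinates are written `x = (x^α)`, and the induced fibrewise
linear coordinates on tangent vectors are written `v = (v^α)`. -/

/-- The coordinate space, with indices `α = 0, 1, …, n`. -/
abbrev CoordSpace (n : ℕ) : Type := EuclideanSpace ℝ (Fin (n + 1))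

/-- The coordinate vector `∂/∂x^α`. -/
def coordBasis {n : ℕ} (α : Fin (n + 1)) : CoordSpace n := EuclideanSpace.single α 1

/-- `∂f/∂x^β` of a function `f(x, v)` of the coordinates. -/
def dX {n : ℕ} (β : Fin (n + 1)) (f : CoordSpace n → CoordSpace n → ℝ)
    (x v : CoordSpace n) : ℝ :=
  fderiv ℝ (fun y => f y v) x (coordBasis β)

/-- `∂f/∂v^β` of a function `f(x, v)` of the coordinates. -/
def dV {n : ℕ} (β : Fin (n + 1)) (f : CoordSpace n → CoordSpace n → ℝ)
    (x v : CoordSpace n) : ℝ :=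
  fderiv ℝ (fun w => f x w) v (coordBasis β)

section Coordinates

variable {n : ℕ} {M : Type*} [TopologicalSpace M] [ChartedSpace (CoordSpace n) M]
  [IsManifold (𝓡 (n + 1)) ∞ M]

/-- The coordinates `(w^α)` of `w ∈ T_qM` in the chart labelled by `p`
(for `q` in the domain of that chart, this is the differential of the chart at `q`). -/
def toCoord (p q : M) (w : TangentSpace (𝓡 (n + 1)) q) : CoordSpace n :=
  (trivializationAt (CoordSpace n) (TangentSpace (𝓡 (n + 1)) : M → Type _) p
    ).continuousLinearMapAt ℝ q w

/-- The vector `∑ u^α ∂/∂x^α ∈ T_qM` with coordinates `u` in the chart labelled by `p`. -/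
def ofCoord (p q : M) (u : CoordSpace n) : TangentSpace (𝓡 (n + 1)) q :=
  (trivializationAt (CoordSpace n) (TangentSpace (𝓡 (n + 1)) : M → Type _) p).symmL ℝ q u

variable (L : TangentBundle (𝓡 (n + 1)) M → ℝ) (p : M)

/-- `L` as a function `L(x, v)` of the coordinates of the chart labelled by `p`. -/
def localL (x v : CoordSpace n) : ℝ :=
  let q : M := (extChartAt (𝓡 (n + 1)) p).symm x
  L ⟨q, ofCoord p q v⟩

/-- `g_{αβ}(v) = ∂²L / ∂v^α ∂v^β (v)`. -/
def gLow (α β : Fin (n + 1)) (x v : CoordSpace n) : ℝ :=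
  dV α (dV β (localL L p)) x v

/-- The matrix `(g_{αβ}(v))`. -/
def gMatrix (x v : CoordSpace n) : Matrix (Fin (n + 1)) (Fin (n + 1)) ℝ :=
  Matrix.of fun α β => gLow L p α β x v

/-- The entries `g^{αβ}(v)` of the inverse matrix of `(g_{αβ}(v))`. -/
def gUp (α β : Fin (n + 1)) (x v : CoordSpace n) : ℝ :=
  (gMatrix L p x v)⁻¹ α β

/-- `Γ̃^α_{βγ}(v) =
  ½ ∑_δ g^{αδ} (∂g_{δγ}/∂x^β + ∂g_{βδ}/∂x^γ - ∂g_{βγ}/∂x^δ)(v)`. -/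
def christoffelTilde (α β γ : Fin (n + 1)) (x v : CoordSpace n) : ℝ :=
  (1 / 2) * ∑ δ, gUp L p α δ x v *
    (dX β (gLow L p δ γ) x v + dX γ (gLow L p β δ) x v - dX δ (gLow L p β γ) x v)

/-- The coefficients `G^α(v) = ½ ∑_{β,γ} Γ̃^α_{βγ}(v) v^β v^γ` of the geodesic spray. -/
def sprayCoeff (α : Fin (n + 1)) (x v : CoordSpace n) : ℝ :=
  (1 / 2) * ∑ β, ∑ γ, christoffelTilde L p α β γ x v * v β * v γ

/-- The coefficients `N^α_β(v) = ∂G^α/∂v^β (v)` of the nonlinear connection (for `v ≠ 0`). -/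
def nonlinConn (α β : Fin (n + 1)) (x v : CoordSpace n) : ℝ :=
  dV β (sprayCoeff L p α) x v

/-- The coefficients `Γ^α_{βγ}(v)` of the Chern connection: `Γ̃^α_{βγ}` minus
`½ ∑_{δ,μ} g^{αδ} (∂g_{δγ}/∂v^μ N^μ_β + ∂g_{βδ}/∂v^μ N^μ_γ - ∂g_{βγ}/∂v^μ N^μ_δ)`. -/
def christoffel (α β γ : Fin (n + 1)) (x v : CoordSpace n) : ℝ :=
  christoffelTilde L p α β γ x v
    - (1 / 2) * ∑ δ, ∑ μ, gUp L p α δ x v *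
      (dV μ (gLow L p δ γ) x v * nonlinConn L p μ β x v
        + dV μ (gLow L p β δ) x v * nonlinConn L p μ γ x v
        - dV μ (gLow L p β γ) x v * nonlinConn L p μ δ x v)

/-- The curvature coefficients `R^α_β(v) = 2 ∂G^α/∂x^β
  - ∑_γ (∂N^α_β/∂x^γ v^γ - 2 ∂N^α_β/∂v^γ G^γ) - ∑_γ N^α_γ N^γ_β`. -/
def curvCoeff (α β : Fin (n + 1)) (x v : CoordSpace n) : ℝ :=
  2 * dX β (sprayCoeff L p α) x v
    - ∑ γ, (dX γ (nonlinConn L p α β) x v * v γ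
        - 2 * dV γ (nonlinConn L p α β) x v * sprayCoeff L p γ x v)
    - ∑ γ, nonlinConn L p α γ x v * nonlinConn L p γ β x v

end Coordinates

/-- A real matrix is symmetric and non-degenerate of signature `(-, +, …, +)`. -/
def HasLorentzSignature {n : ℕ} (A : Matrix (Fin (n + 1)) (Fin (n + 1)) ℝ) : Prop :=
  A.IsSymm ∧ ∃ P : Matrix (Fin (n + 1)) (Fin (n + 1)) ℝ, IsUnit P.det ∧
    P.transpose * A * P = Matrix.diagonal fun α => if α = 0 then -1 else 1

/-! ### Finsler spacetimes and weights -/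

/-- A Finsler spacetime: a Lorentz-Finsler structure `L : TM → ℝ` on `M`
together with a time orientation, given by a smooth timelike vector field `X`. -/
structure FinslerSpacetime (n : ℕ) (M : Type*) [TopologicalSpace M]
    [ChartedSpace (CoordSpace n) M] [IsManifold (𝓡 (n + 1)) ∞ M] where
  /-- the Lorentz-Finsler structure -/
  L : TangentBundle (𝓡 (n + 1)) M → ℝ
  smooth : ContMDiffOn (𝓡 (n + 1)).tangent 𝓘(ℝ, ℝ) ∞ L {v | v.2 ≠ 0}
  homogeneous : ∀ (x : M) (v : TangentSpace (𝓡 (n + 1)) x) (c : ℝ), 0 < c →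
    L ⟨x, c • v⟩ = c ^ 2 * L ⟨x, v⟩
  signature : ∀ (p : M) (x v : CoordSpace n), x ∈ (extChartAt (𝓡 (n + 1)) p).target → v ≠ 0 →
    HasLorentzSignature (gMatrix L p x v)
  /-- the time orientation -/
  X : (x : M) → TangentSpace (𝓡 (n + 1)) x
  smooth_X : ContMDiff (𝓡 (n + 1)) (𝓡 (n + 1)).tangent ∞
    (fun x => (⟨x, X x⟩ : TangentBundle (𝓡 (n + 1)) M))
  timelike_X : ∀ x, L ⟨x, X x⟩ < 0

namespace FinslerSpacetime

variable {n : ℕ} {M : Type*} [TopologicalSpace M] [ChartedSpace (CoordSpace n) M]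
  [IsManifold (𝓡 (n + 1)) ∞ M] (S : FinslerSpacetime n M)

/-- The set `Ω'_x` of timelike vectors at `x`. -/
def timelikeAt (x : M) : Set (TangentSpace (𝓡 (n + 1)) x) := {v | S.L ⟨x, v⟩ < 0}

/-- The set `Ω_x` of future-directed timelike vectors at `x`: those lying in the connected
component of `closure Ω'_x \ {0}` that contains `X x`. -/
def futureAt (x : M) : Set (TangentSpace (𝓡 (n + 1)) x) :=
  S.timelikeAt x ∩ connectedComponentIn (closure (S.timelikeAt x) \ {0}) (S.X x)

/-- The set `Ω ⊆ TM` of future-directed timelike vectors. -/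
def future : Set (TangentBundle (𝓡 (n + 1)) M) := {v | v.2 ∈ S.futureAt v.1}

/-- The set `closure Ω \ {0} ⊆ TM` of future-directed causal vectors (the closure is fibrewise). -/
def futureCausal : Set (TangentBundle (𝓡 (n + 1)) M) :=
  {v | v.2 ∈ closure (S.futureAt v.1) \ {0}}

/-- `F(v) = √(-2 L(v))`. -/
def F (v : TangentBundle (𝓡 (n + 1)) M) : ℝ := Real.sqrt (-2 * S.L v)

/-- `ψ` is a weight function: smooth and positively `0`-homogeneous on the future-directed causal
vectors (its values elsewhere play no role). -/
structure IsWeight (ψ : TangentBundle (𝓡 (n + 1)) M → ℝ) : Prop where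
  smooth : ContMDiffOn (𝓡 (n + 1)).tangent 𝓘(ℝ, ℝ) ∞ ψ S.futureCausal
  homogeneous : ∀ v ∈ S.futureCausal, ∀ c : ℝ, 0 < c → ψ ⟨v.1, c • v.2⟩ = ψ v

/-! ### Metric and curvature on tangent spaces

The following notions do not depend on the coordinates; they are computed at each point `x` in the
chart labelled by `x` itself. -/

/-- The Lorentzian inner product `g_v(a, b) = ∑ a^α b^β g_{αβ}(v)` on `T_xM`, for `v ∈ T_xM`. -/
def g (x : M) (v a b : TangentSpace (𝓡 (n + 1)) x) : ℝ :=
  ∑ α, ∑ β, toCoord x x a α * toCoord x x b β *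
    gLow S.L x α β (extChartAt (𝓡 (n + 1)) x x) (toCoord x x v)

/-- The curvature endomorphism `R_v(w) = ∑ R^α_β(v) w^β ∂/∂x^α` of `T_xM`, for `v ∈ T_xM`. -/
def R (x : M) (v w : TangentSpace (𝓡 (n + 1)) x) : TangentSpace (𝓡 (n + 1)) x :=
  ofCoord x x (WithLp.toLp 2 fun α =>
    ∑ β, curvCoeff S.L x α β (extChartAt (𝓡 (n + 1)) x x) (toCoord x x v) * toCoord x x w β)

/-- The Ricci curvature `Ric(v) = trace R_v`. -/
def Ric (v : TangentBundle (𝓡 (n + 1)) M) : ℝ :=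
  ∑ α, curvCoeff S.L v.1 α α (extChartAt (𝓡 (n + 1)) v.1 v.1) (toCoord v.1 v.1 v.2)

end FinslerSpacetime

/-! ### Curves -/

/-- The open interval `(a, b)` of `ℝ` with possibly infinite endpoints. -/
def interval (a b : EReal) : Set ℝ := {t | a < (t : EReal) ∧ (t : EReal) < b}

/-- The filter `t → b`, `t < b` on `ℝ`. -/
def toRightEnd (b : EReal) : Filter ℝ := Filter.comap (fun t : ℝ => (t : EReal)) (𝓝[<] b)

/-- The filter `t → a`, `t > a` on `ℝ`. -/
def toLeftEnd (a : EReal) : Filter ℝ := Filter.comap (fun t : ℝ => (t : EReal)) (𝓝[>] a)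

/-- A curve on `(a, b)` is inextendible if it converges neither as `t → b` nor as `t → a`. -/
def IsInextendible {M : Type*} [TopologicalSpace M] (η : ℝ → M) (a b : EReal) : Prop :=
  (¬ ∃ q, Filter.Tendsto η (toRightEnd b) (𝓝 q)) ∧ ¬ ∃ q, Filter.Tendsto η (toLeftEnd a) (𝓝 q)

section Curves

variable {n : ℕ} {M : Type*} [TopologicalSpace M] [ChartedSpace (CoordSpace n) M]
  [IsManifold (𝓡 (n + 1)) ∞ M]

/-- The tangent vector `η̇(t) ∈ T_{η(t)}M`. -/
def velocity (η : ℝ → M) (t : ℝ) : TangentSpace (𝓡 (n + 1)) (η t) :=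
  mfderiv 𝓘(ℝ, ℝ) (𝓡 (n + 1)) η t (1 : ℝ)

/-- The tangent vector `η̇(t)` as a point of `TM`. -/
def lift (η : ℝ → M) (t : ℝ) : TangentBundle (𝓡 (n + 1)) M := ⟨η t, velocity η t⟩

/-- The curve `η` in the coordinates of the chart labelled by `p`. -/
def coordCurve (p : M) (η : ℝ → M) (t : ℝ) : CoordSpace n := extChartAt (𝓡 (n + 1)) p (η t)

/-- The components `Y^α` of a vector field `Y` along `η` in the chart labelled by `p`. -/
def coordField (p : M) (η : ℝ → M) (Y : (t : ℝ) → TangentSpace (𝓡 (n + 1)) (η t)) (t : ℝ) :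
    CoordSpace n :=
  toCoord p (η t) (Y t)

end Curves

namespace FinslerSpacetime

variable {n : ℕ} {M : Type*} [TopologicalSpace M] [ChartedSpace (CoordSpace n) M]
  [IsManifold (𝓡 (n + 1)) ∞ M] (S : FinslerSpacetime n M)

/-- `η : (a, b) → M` is a future-directed timelike geodesic: a smooth curve whose tangent vectors
are future-directed timelike and which satisfies, in every chart labelled by a point `p`,
`η̈^α + ∑_{β,γ} Γ̃^α_{βγ}(η̇) η̇^β η̇^γ = 0`. -/
structure IsTimelikeGeodesic (η : ℝ → M) (a b : EReal) : Prop where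
  smooth : ContMDiffOn 𝓘(ℝ, ℝ) (𝓡 (n + 1)) ∞ η (interval a b)
  timelike : ∀ t ∈ interval a b, lift η t ∈ S.future
  geodesic : ∀ t ∈ interval a b, ∀ p : M, η t ∈ (extChartAt (𝓡 (n + 1)) p).source →
    ∀ α, deriv (deriv (coordCurve p η)) t α
      + ∑ β, ∑ γ, christoffelTilde S.L p α β γ (coordCurve p η t) (deriv (coordCurve p η) t)
          * deriv (coordCurve p η) t β * deriv (coordCurve p η) t γ = 0

/-- The covariant derivative along `η`, with reference vector `η̇`,
`D Y = ∑_α (Ẏ^α + ∑_{β,γ} Γ^α_{βγ}(η̇) η̇^β Y^γ) ∂/∂x^α`.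
It does not depend on the coordinates; at time `t` it is computed in the chart labelled by
`η t`. -/
def covDeriv (η : ℝ → M) (Y : (t : ℝ) → TangentSpace (𝓡 (n + 1)) (η t)) (t : ℝ) :
    TangentSpace (𝓡 (n + 1)) (η t) :=
  ofCoord (η t) (η t) (WithLp.toLp 2 fun α =>
    deriv (coordField (η t) η Y) t α
      + ∑ β, ∑ γ, christoffel S.L (η t) α β γ
          (coordCurve (η t) η t) (deriv (coordCurve (η t) η) t)
          * deriv (coordCurve (η t) η) t β * coordField (η t) η Y t γ)

/-- `Y` is a Jacobi field along `η : (a, b) → M`: a (twice continuously differentiable) solution of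
`D D Y + R_{η̇}(Y) = 0`. -/
structure IsJacobiField (η : ℝ → M) (a b : EReal)
    (Y : (t : ℝ) → TangentSpace (𝓡 (n + 1)) (η t)) : Prop where
  smooth : ContMDiffOn 𝓘(ℝ, ℝ) (𝓡 (n + 1)).tangent 2
    (fun t => (⟨η t, Y t⟩ : TangentBundle (𝓡 (n + 1)) M)) (interval a b)
  jacobi : ∀ t ∈ interval a b,
    S.covDeriv η (S.covDeriv η Y) t + S.R (η t) (velocity η t) (Y t) = 0

/-- `η : (a, b) → M` contains a pair of conjugate points: some nontrivial Jacobi field along `η`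
vanishes at two different times. -/
def HasConjugatePair (η : ℝ → M) (a b : EReal) : Prop :=
  ∃ t₁ ∈ interval a b, ∃ t₂ ∈ interval a b, t₁ < t₂ ∧
    ∃ Y : (t : ℝ) → TangentSpace (𝓡 (n + 1)) (η t), S.IsJacobiField η a b Y ∧
      (∃ t ∈ interval a b, Y t ≠ 0) ∧ Y t₁ = 0 ∧ Y t₂ = 0

/-- The timelike genericity condition: along every inextendible future-directed timelike geodesic
`η` there is a time `t₁` at which the restriction of `R_{η̇(t₁)}` to the `g_{η̇}`-orthogonal
complement of `η̇(t₁)` is not zero. -/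
def TimelikeGeneric : Prop :=
  ∀ (a b : EReal) (η : ℝ → M), a < b → S.IsTimelikeGeodesic η a b → IsInextendible η a b →
    ∃ t₁ ∈ interval a b, ∃ w : TangentSpace (𝓡 (n + 1)) (η t₁),
      S.g (η t₁) (velocity η t₁) (velocity η t₁) w = 0 ∧ S.R (η t₁) (velocity η t₁) w ≠ 0

/-! ### Weighted notions -/

variable (ψ : TangentBundle (𝓡 (n + 1)) M → ℝ)

/-- The weighted Ricci curvature `Ric_N(η̇(t))` of the tangent vector of a geodesic `η`, where
`ψ_η(t) = ψ(η̇(t))`: it is `Ric(η̇) + ψ_η'' - (ψ_η')² / (N - n)` for real `N ≠ n`,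
`Ric(η̇) + ψ_η''` for `N = +∞`, and for `N = n` it is
`Ric(η̇) + ψ_η''` if `ψ_η' = 0` and `-∞` otherwise. It is not used for `N = -∞`. -/
def weightedRic (N : EReal) (η : ℝ → M) (t : ℝ) : EReal :=
  let ψη : ℝ → ℝ := fun s => ψ (lift η s)
  open Classical in
  if N = ⊤ then ((S.Ric (lift η t) + deriv (deriv ψη) t : ℝ) : EReal)
  else if N = (n : EReal) then
    if deriv ψη t = 0 then ((S.Ric (lift η t) + deriv (deriv ψη) t : ℝ) : EReal) else ⊥
  else ((S.Ric (lift η t) + deriv (deriv ψη) t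
    - (deriv ψη t) ^ 2 / (N.toReal - (n : ℝ)) : ℝ) : EReal)

/-- The timelike `N`-convergence condition `Ric_N(v) ≥ 0` for all future-directed timelike vectors
`v`. Here `Ric_N(v)` is `weightedRic` at time `0` of the geodesic `η : (-δ, δ) → M` with
`η̇(0) = v`, which exists for small `δ` and is unique. -/
def TimelikeConvergence (N : EReal) : Prop :=
  ∀ v ∈ S.future, ∀ (δ : ℝ) (η : ℝ → M), 0 < δ →
    S.IsTimelikeGeodesic η ((-δ : ℝ) : EReal) (δ : EReal) → lift η 0 = v →
      0 ≤ S.weightedRic ψ N η 0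

/-- `τ` is an `ε`-proper time of `η : (a, b) → M`: an antiderivative of
`exp (2 (ε - 1) / n * ψ_η)` with respect to proper time. Proper time has derivative `F(η̇)` with
respect to the parameter of `η`, and this factor is `1` if `η` has unit speed. -/
def IsEpsProperTime (ε : ℝ) (η : ℝ → M) (a b : EReal) (τ : ℝ → ℝ) : Prop :=
  ∀ t ∈ interval a b,
    HasDerivAt τ (Real.exp (2 * (ε - 1) / n * ψ (lift η t)) * S.F (lift η t)) t

/-- The geodesic `η : (a, b) → M` is `ε`-complete: it is inextendible, future `ε`-complete
(`τ_ε → +∞` as `t → b`) and past `ε`-complete (`τ_ε → -∞` as `t → a`). The `ε`-proper time is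
unique up to an additive constant. -/
def IsEpsComplete (ε : ℝ) (η : ℝ → M) (a b : EReal) : Prop :=
  IsInextendible η a b ∧
    (∃ τ, S.IsEpsProperTime ψ ε η a b τ ∧ Filter.Tendsto τ (toRightEnd b) Filter.atTop) ∧
    (∃ τ, S.IsEpsProperTime ψ ε η a b τ ∧ Filter.Tendsto τ (toLeftEnd a) Filter.atBot)

end FinslerSpacetime

/-- The timelike `ε`-range for the parameter `N ∈ (-∞, 0] ∪ [n, +∞]`: `ε = 0` if `N = 0`, and
`|ε| < √(N / (N - n))` if `N ≠ 0`, where the bound is `1` for `N = +∞` and void for `N = n`. -/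
def InTimelikeEpsRange (n : ℕ) (N : EReal) (ε : ℝ) : Prop :=
  open Classical in
  if N = 0 then ε = 0
  else if N = ⊤ then |ε| < 1
  else if N = (n : EReal) then True
  else |ε| < Real.sqrt (N.toReal / (N.toReal - (n : ℝ)))

end LorentzFinsler

end

/-! The theorem is a Lorentz-Finsler singularity theorem of Hawking-Penrose type for a single
geodesic. An `ε`-complete timelike geodesic `η` is shown to contain conjugate points, by reduction
to a matrix Riccati equation.

**The Jacobi equation in a parallel frame.** Along `η` there is a parallel frame which is
orthonormal for `g_{η̇}` and whose first vector is a multiple of `η̇` (`exists_isLorentzFrame`). It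
is obtained by solving the linear equation of parallel transport chart by chart
(`BundleODE.exists_sol`). On the orthogonal complement of `η̇` the Jacobi equation becomes `y'' + K
y = 0` in `ℝⁿ`, with `K` symmetric and of trace `Ric(η̇)` (`inner_spatialCurv`,
`traceL_spatialCurv`), and a solution with two zeros is a Jacobi field with two zeros
(`isJacobiField_of_isJacobiVec`).

**Local geometry without the Chern connection.** The facts about curvature used here are derived
along geodesics, from the second derivatives of `L`. Differentiation of the Euler-Lagrange equations
gives, for the metric `g`, the nonlinear connection `N` and the curvature `R` along a geodesic,

* `g' = g N + Nᵗ g`, so that `g` is parallel (`IsSprayCurve.hasDerivAt_g`);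
* `L_{vx} - g N` is symmetric (`IsSprayCurve.star_symmHess`);
* `(L_{vx} - g N)' = g R - Nᵗ g N + L_{xx}` (`IsSprayCurve.hasDerivAt_symmHess`).

The last identity shows that `g R` is symmetric. Since the second derivatives of `L` transform by
the chain rule, these identities also give the transformation laws of `N` and of `R` under a change
of charts (`IsTransition.jac_mul_nonlinConn`, `IsTransition.jac_mul_curv`), which are needed because
a geodesic need not stay in one chart.

**Absence of conjugate points.** If no nontrivial solution of `y'' + K y = 0` has two zeros, the
Riccati equation `U' + U² + K = 0` has a symmetric solution on the whole interval, the limit of the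
solutions that blow up at a time `s` as `s` tends to the right end
(`IsDisconjugate.exists_isRiccatiAt`).

**The weighted Raychaudhuri inequality.** For such `U` put `h = exp (2 (1 - ε) ψ / n) (tr U - ψ')`.
The bound on `Ric_N`, the inequality `(tr U)² ≤ n tr U²` and the condition on `ε` give `dh/dτ ≤ -k
h²` with `k > 0` in the `ε`-proper time `τ`. Since `τ` ranges over all of `ℝ`, `h` vanishes; then
equality holds throughout, and `U` and `K` vanish (`eq_zero_of_isRiccatiAt`). As `R_{η̇}`
annihilates `η̇`, it vanishes along `η`, against genericity. -/

/-! ### Linear differential equations along an interval -/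

section LinearODE

open Set Metric
open scoped NNReal

variable {F : Type*} [NormedAddCommGroup F] [NormedSpace ℝ F]

/-- A linear differential equation has an invertible operator solution near each time: the solution
with value `1` at `t₀`, on a shorter interval on which it stays invertible. -/
theorem exists_local_fundamental_solution [CompleteSpace F] {B : ℝ → F →L[ℝ] F} {U : Set ℝ}
    (hU : IsOpen U) (hB : ContinuousOn B U) {t₀ : ℝ} (ht₀ : t₀ ∈ U) :
    ∃ Z : ℝ → F →L[ℝ] F, ∃ δ > 0, Ioo (t₀ - δ) (t₀ + δ) ⊆ U ∧
      ∀ t ∈ Ioo (t₀ - δ) (t₀ + δ), IsUnit (Z t) ∧ HasDerivAt Z (B t * Z t) t := by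
  have hcont : ContinuousAt B t₀ := hB.continuousAt (hU.mem_nhds ht₀)
  obtain ⟨C, hC0, hC⟩ : ∃ C : ℝ≥0, 0 < C ∧ ∀ᶠ t in 𝓝 t₀, ‖B t‖ ≤ C := by
    refine ⟨⟨‖B t₀‖ + 1, by positivity⟩, ?_, ?_⟩
    · exact NNReal.coe_pos.1 (by positivity : (0 : ℝ) < ‖B t₀‖ + 1)
    · filter_upwards [hcont.norm.eventually (gt_mem_nhds (lt_add_one _))] with t ht using ht.le
  obtain ⟨δ₁, hδ₁, hball⟩ := Metric.eventually_nhds_iff_ball.1 (hC.and (hU.mem_nhds ht₀))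
  set a : ℝ≥0 := ‖(1 : F →L[ℝ] F)‖₊ + 1 with ha
  have ha0 : 0 < a := by positivity
  -- On the closed ball of radius `a` around `1` the field is bounded by `C * (2 * a)`, which
  -- fixes the length of the time interval.
  set δ : ℝ := min (δ₁ / 2) (1 / (2 * C)) with hδdef
  have hC0' : (0 : ℝ) < C := hC0
  have hδ : 0 < δ := by positivity
  have hsub : Icc (t₀ - δ) (t₀ + δ) ⊆ ball t₀ δ₁ := by
    intro t ht
    rw [mem_ball, Real.dist_eq, abs_lt]
    have := min_le_left (δ₁ / 2) (1 / (2 * C : ℝ))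
    constructor <;> linarith [ht.1, ht.2]
  have hpl : IsPicardLindelof (fun t (Z : F →L[ℝ] F) => B t * Z) (tmin := t₀ - δ) (tmax := t₀ + δ)
      ⟨t₀, by constructor <;> linarith⟩ 1 a 0 (C * (2 * a)) C := by
    refine ⟨fun t ht => ?_, fun Z _ => ?_, fun t ht Z hZ => ?_, ?_⟩
    · refine LipschitzOnWith.of_dist_le_mul fun Z _ Z' _ => ?_
      rw [dist_eq_norm, dist_eq_norm, ← mul_sub]
      exact (norm_mul_le _ _).trans
        (mul_le_mul_of_nonneg_right (hball t (hsub ht)).1 (norm_nonneg _))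
    · exact (hB.mono fun t ht => (hball t (hsub ht)).2).mul continuousOn_const
    · refine (norm_mul_le _ _).trans ?_
      push_cast
      refine mul_le_mul (hball t (hsub ht)).1 ?_ (norm_nonneg _) C.2
      have h1 : ‖Z - 1‖ ≤ a := by simpa [dist_eq_norm] using hZ
      have h2 : ‖(1 : F →L[ℝ] F)‖ ≤ a := by
        rw [ha]; push_cast; linarith [coe_nnnorm (1 : F →L[ℝ] F)]
      calc ‖Z‖ = ‖(Z - 1) + 1‖ := by simp
        _ ≤ ‖Z - 1‖ + ‖(1 : F →L[ℝ] F)‖ := norm_add_le _ _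
        _ ≤ 2 * a := by linarith
    · have h1 : δ ≤ 1 / (2 * C) := min_le_right _ _
      have h2 : max (t₀ + δ - t₀) (t₀ - (t₀ - δ)) = δ := by simp
      push_cast
      rw [h2]
      calc (C : ℝ) * (2 * a) * δ ≤ C * (2 * a) * (1 / (2 * C)) := by gcongr
        _ = a - 0 := by field_simp; ring
  obtain ⟨Z, hZ0, hZ⟩ := hpl.exists_eq_forall_mem_Icc_hasDerivWithinAt₀
  have hZd : ∀ t ∈ Ioo (t₀ - δ) (t₀ + δ), HasDerivAt Z (B t * Z t) t := fun t ht =>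
    (hZ t (Ioo_subset_Icc_self ht)).hasDerivAt (Icc_mem_nhds ht.1 ht.2)
  have hunit : ∀ᶠ t in 𝓝 t₀, IsUnit (Z t) := by
    have hc : ContinuousAt Z t₀ := (hZd t₀ ⟨by linarith, by linarith⟩).continuousAt
    refine hc.eventually (Units.isOpen.mem_nhds ?_)
    change IsUnit (Z t₀)
    have : Z t₀ = 1 := hZ0
    rw [this]; exact isUnit_one
  obtain ⟨δ₂, hδ₂, hun⟩ := Metric.eventually_nhds_iff_ball.1 hunit
  refine ⟨Z, min δ δ₂, by positivity, ?_, ?_⟩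
  · intro t ht
    have := min_le_left δ δ₂
    exact (hball t (hsub ⟨by linarith [ht.1], by linarith [ht.2]⟩)).2
  · intro t ht
    have h1 := min_le_left δ δ₂
    have h2 := min_le_right δ δ₂
    refine ⟨hun t ?_, hZd t ⟨by linarith [ht.1], by linarith [ht.2]⟩⟩
    rw [mem_ball, Real.dist_eq, abs_lt]
    constructor <;> linarith [ht.1, ht.2]

variable (F) in
/-- A linear first-order differential equation for the sections of a vector bundle with fibre `F`
over a set `I` of times. Over the open set `J i` the bundle is trivialised by `T i`, and there the
equation for a section `x` reads `(T i x)' = B i (T i x)`. The fields `compat` and `cover` say that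
these local equations agree on overlaps, and that they are given everywhere on `I`. -/
structure BundleODE (ι : Type*) (I : Set ℝ) where
  /-- the domains of the trivialisations -/
  J : ι → Set ℝ
  /-- the trivialisations -/
  T : ι → ℝ → F →L[ℝ] F
  /-- the coefficients -/
  B : ι → ℝ → F →L[ℝ] F
  isOpen_J : ∀ i, IsOpen (J i)
  isUnit_T : ∀ i, ∀ t ∈ J i, IsUnit (T i t)
  continuousOn_B : ∀ i, ContinuousOn (B i) (J i)
  compat : ∀ i j t, t ∈ J i → t ∈ J j → ∀ X : ℝ → F →L[ℝ] F,
    HasDerivAt (fun s => T i s * X s) (B i t * (T i t * X t)) t →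
      HasDerivAt (fun s => T j s * X s) (B j t * (T j t * X t)) t
  cover : ∀ t ∈ I, ∃ i, t ∈ J i

namespace BundleODE

variable {ι : Type*} {I : Set ℝ} (D : BundleODE F ι I)

/-- `X` is an invertible operator solution of the equation at time `t`. -/
def IsSolAt (X : ℝ → F →L[ℝ] F) (t : ℝ) : Prop :=
  IsUnit (X t) ∧ ∀ i, t ∈ D.J i →
    HasDerivAt (fun s => D.T i s * X s) (D.B i t * (D.T i t * X t)) t

theorem IsSolAt.mul_const {D : BundleODE F ι I} {X : ℝ → F →L[ℝ] F} {t : ℝ} (h : D.IsSolAt X t)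
    {A : F →L[ℝ] F} (hA : IsUnit A) : D.IsSolAt (fun s => X s * A) t := by
  refine ⟨h.1.mul hA, fun i hi => ?_⟩
  simpa only [mul_assoc] using (h.2 i hi).mul_const A

/-- Solutions on adjacent intervals are matched at the common endpoint by a constant factor on the
right. The factor does not affect the equation, which is linear with coefficients acting from the
left. -/
theorem exists_sol_glue {c m d : ℝ} (hcm : c ≤ m) (hmd : m ≤ d)
    (h₁ : ∃ X, ∀ t ∈ Icc c m, D.IsSolAt X t) (h₂ : ∃ X, ∀ t ∈ Icc m d, D.IsSolAt X t) :
    ∃ X, ∀ t ∈ Icc c d, D.IsSolAt X t := by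
  obtain ⟨X₁, h₁⟩ := h₁
  obtain ⟨X₂, h₂⟩ := h₂
  have hu₁ : IsUnit (X₁ m) := (h₁ m ⟨hcm, le_rfl⟩).1
  have hu₂ : IsUnit (X₂ m) := (h₂ m ⟨le_rfl, hmd⟩).1
  set Y : ℝ → F →L[ℝ] F := fun s => X₂ s * (Ring.inverse (X₂ m) * X₁ m) with hY
  have hYsol : ∀ t ∈ Icc m d, D.IsSolAt Y t := fun t ht =>
    (h₂ t ht).mul_const (hu₂.ringInverse.mul hu₁)
  have hYm : Y m = X₁ m := Ring.mul_inverse_cancel_left _ _ hu₂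
  set X : ℝ → F →L[ℝ] F := fun s => if s ≤ m then X₁ s else Y s with hX
  have hXl : ∀ s ≤ m, X s = X₁ s := fun s hs => if_pos hs
  have hXr : ∀ s, m ≤ s → X s = Y s := fun s hs => by
    rcases hs.eq_or_lt with rfl | hs
    · rw [hXl _ le_rfl, hYm]
    · exact if_neg hs.not_ge
  refine ⟨X, fun t ht => ?_⟩
  rcases lt_trichotomy t m with htm | rfl | htm
  · have h := h₁ t ⟨ht.1, htm.le⟩
    refine ⟨by rw [hXl t htm.le]; exact h.1, fun i hi => ?_⟩
    rw [hXl t htm.le]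
    refine (h.2 i hi).congr_of_eventuallyEq ?_
    filter_upwards [gt_mem_nhds htm] with s hs
    rw [hXl s hs.le]
  · refine ⟨by rw [hXl t le_rfl]; exact hu₁, fun i hi => ?_⟩
    rw [← hasDerivWithinAt_univ, ← Iic_union_Ici (a := t)]
    refine HasDerivWithinAt.union ?_ ?_
    · rw [hXl t le_rfl]
      refine ((h₁ t ⟨hcm, le_rfl⟩).2 i hi).hasDerivWithinAt.congr (fun s hs => ?_) ?_
      · rw [hXl s hs]
      · rw [hXl t le_rfl]
    · rw [hXr t le_rfl]
      refine ((hYsol t ⟨le_rfl, hmd⟩).2 i hi).hasDerivWithinAt.congr (fun s hs => ?_) ?_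
      · rw [hXr s hs]
      · rw [hXr t le_rfl]
  · have h := hYsol t ⟨htm.le, ht.2⟩
    refine ⟨by rw [hXr t htm.le]; exact h.1, fun i hi => ?_⟩
    rw [hXr t htm.le]
    refine (h.2 i hi).congr_of_eventuallyEq ?_
    filter_upwards [lt_mem_nhds htm] with s hs
    rw [hXr s hs.le]

variable [CompleteSpace F]

theorem exists_local_sol {t₀ : ℝ} (ht₀ : t₀ ∈ I) :
    ∃ X : ℝ → F →L[ℝ] F, ∃ δ > 0, ∀ t ∈ Ioo (t₀ - δ) (t₀ + δ), D.IsSolAt X t := by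
  obtain ⟨i, hi⟩ := D.cover t₀ ht₀
  obtain ⟨Z, δ, hδ, hsub, hZ⟩ :=
    exists_local_fundamental_solution (D.isOpen_J i) (D.continuousOn_B i) hi
  refine ⟨fun s => Ring.inverse (D.T i s) * Z s, δ, hδ, fun t ht => ⟨?_, fun j hj => ?_⟩⟩
  · exact (D.isUnit_T i t (hsub ht)).ringInverse.mul (hZ t ht).1
  · refine D.compat i j t (hsub ht) hj _ ?_
    have heq : (fun s => D.T i s * (Ring.inverse (D.T i s) * Z s)) =ᶠ[𝓝 t] Z := by
      filter_upwards [(D.isOpen_J i).mem_nhds (hsub ht)] with s hs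
      exact Ring.mul_inverse_cancel_left _ _ (D.isUnit_T i s hs)
    have h2 := (hZ t ht).2.congr_of_eventuallyEq heq
    rwa [Ring.mul_inverse_cancel_left _ _ (D.isUnit_T i t (hsub ht))]

/-- A compact interval is a finite chain of intervals on which local solutions exist, and these are
glued one after the other. -/
theorem exists_sol_Icc {c d : ℝ} (hcd : c ≤ d) (hI : Icc c d ⊆ I) :
    ∃ X, ∀ t ∈ Icc c d, D.IsSolAt X t := by
  choose X δ hδ hX using fun t : Icc c d => D.exists_local_sol (hI t.2)
  obtain ⟨u, hu0, humono, ⟨m, hm⟩, hsub⟩ := exists_monotone_Icc_subset_open_cover_Icc hcd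
    (c := fun t : Icc c d => (fun s : Icc c d => (s : ℝ)) ⁻¹' Ioo (t - δ t) (t + δ t))
    (fun t => isOpen_Ioo.preimage continuous_subtype_val)
    (fun t _ => mem_iUnion.2 ⟨t, by simp [hδ t]⟩)
  have key : ∀ k, ∃ X, ∀ t ∈ Icc c (u k : ℝ), D.IsSolAt X t := by
    intro k
    have hstep : ∀ k, ∃ X, ∀ t ∈ Icc (u k : ℝ) (u (k + 1) : ℝ), D.IsSolAt X t := by
      intro k
      obtain ⟨i, hi⟩ := hsub k
      refine ⟨X i, fun t ht => hX i t ?_⟩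
      have htc : t ∈ Icc c d := ⟨(u k).2.1.trans ht.1, ht.2.trans (u (k + 1)).2.2⟩
      exact hi (show (⟨t, htc⟩ : Icc c d) ∈ Icc (u k) (u (k + 1)) from ht)
    induction k with
    | zero =>
      obtain ⟨X, hX⟩ := hstep 0
      refine ⟨X, fun t ht => hX t ?_⟩
      have h0 : (u 0 : ℝ) = c := by rw [hu0]
      have h1 : (u 0 : ℝ) ≤ u (0 + 1) := humono (Nat.le_succ 0)
      exact ⟨by rw [h0]; exact ht.1, ht.2.trans h1⟩
    | succ k ih => exact D.exists_sol_glue (u k).2.1 (humono (Nat.le_succ k)) ih (hstep k)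
  have := key m
  rwa [hm m le_rfl] at this

/-- Two invertible solutions that agree at one time agree everywhere, since `X⁻¹ Y` is constant. -/
theorem sol_unique {c d : ℝ} (hI : Icc c d ⊆ I) {X Y : ℝ → F →L[ℝ] F}
    (hX : ∀ t ∈ Icc c d, D.IsSolAt X t) (hY : ∀ t ∈ Icc c d, D.IsSolAt Y t) {t₀ t : ℝ}
    (ht₀ : t₀ ∈ Icc c d) (ht : t ∈ Icc c d) (h : X t₀ = Y t₀) : X t = Y t := by
  have hder : ∀ t ∈ Icc c d, HasDerivAt (fun s => Ring.inverse (X s) * Y s) 0 t := by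
    intro t ht
    obtain ⟨i, hi⟩ := D.cover t (hI ht)
    set P : ℝ → F →L[ℝ] F := fun s => D.T i s * X s with hP
    set Q : ℝ → F →L[ℝ] F := fun s => D.T i s * Y s with hQ
    have hPd := (hX t ht).2 i hi
    have hQd := (hY t ht).2 i hi
    have hPu : IsUnit (P t) := (D.isUnit_T i t hi).mul (hX t ht).1
    have heq : (fun s => Ring.inverse (X s) * Y s) =ᶠ[𝓝 t] fun s => Ring.inverse (P s) * Q s := by
      have hPe : ∀ᶠ s in 𝓝 t, IsUnit (P s) :=
        hPd.continuousAt.eventually (Units.isOpen.mem_nhds hPu)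
      filter_upwards [hPe, (D.isOpen_J i).mem_nhds hi] with s hs hsJ
      have hT := D.isUnit_T i s hsJ
      have hXs : IsUnit (X s) := by
        have : X s = Ring.inverse (D.T i s) * P s := (Ring.inverse_mul_cancel_left _ _ hT).symm
        rw [this]; exact hT.ringInverse.mul hs
      have hYs : Q s = D.T i s * Y s := rfl
      have h1 : Ring.inverse (P s) * (P s * (Ring.inverse (X s) * Y s)) =
        Ring.inverse (X s) * Y s := Ring.inverse_mul_cancel_left _ _ hs
      rw [← h1, hYs]
      congr 1
      rw [hP, mul_assoc, Ring.mul_inverse_cancel_left _ _ hXs]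
    refine HasDerivAt.congr_of_eventuallyEq ?_ heq
    obtain ⟨w, hw⟩ := hPu
    have hinv := (hasFDerivAt_ringInverse (𝕜 := ℝ) w)
    rw [hw] at hinv
    have h1 := (hinv.comp_hasDerivAt t hPd).mul hQd
    refine h1.congr_deriv ?_
    have hwP : (↑w⁻¹ : F →L[ℝ] F) * P t = 1 := by rw [← hw]; simp
    have hPw : P t * (↑w⁻¹ : F →L[ℝ] F) = 1 := by rw [← hw]; simp
    have hinvP : Ring.inverse (P t) = ↑w⁻¹ := by rw [← hw]; exact Ring.inverse_unit w
    change -(↑w⁻¹ * (D.B i t * P t) * ↑w⁻¹) * Q t + Ring.inverse (P t) * (D.B i t * Q t) = 0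
    rw [hinvP, mul_assoc (↑w⁻¹ : F →L[ℝ] F), mul_assoc (D.B i t), hPw]
    noncomm_ring
  have hconst := constant_of_has_deriv_right_zero
    (f := fun s => Ring.inverse (X s) * Y s) (a := c) (b := d)
    (fun s hs => (hder s hs).continuousAt.continuousWithinAt)
    (fun s hs => (hder s (Ico_subset_Icc_self hs)).hasDerivWithinAt)
  have h1 := hconst t ht
  have h2 := hconst t₀ ht₀
  beta_reduce at h1 h2
  rw [← h, Ring.inverse_mul_cancel _ (hX t₀ ht₀).1] at h2
  rw [← h2] at h1
  rw [← mul_one (X t), ← h1, Ring.mul_inverse_cancel_left _ _ (hX t ht).1]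

/-- A linear equation over an open interval has a fundamental solution on the whole interval. -/
theorem exists_sol (hIo : IsOpen I) (hI : I.OrdConnected) {t₀ : ℝ} (ht₀ : t₀ ∈ I)
    {A : F →L[ℝ] F} (hA : IsUnit A) :
    ∃ X : ℝ → F →L[ℝ] F, X t₀ = A ∧ ∀ t ∈ I, D.IsSolAt X t := by
  -- For every compact interval around `t₀` choose a solution with value `A` at `t₀`. The chosen
  -- solutions agree on overlaps, and the value at `t` is read off on the interval spanned by `t₀`
  -- and `t`.
  have hex : ∀ c d : ℝ, ∃ X : ℝ → F →L[ℝ] F, c ∈ I → d ∈ I → t₀ ∈ Icc c d →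
      X t₀ = A ∧ ∀ t ∈ Icc c d, D.IsSolAt X t := by
    intro c d
    by_cases h : c ∈ I ∧ d ∈ I ∧ t₀ ∈ Icc c d
    · obtain ⟨hc, hd, ht⟩ := h
      obtain ⟨X, hX⟩ := D.exists_sol_Icc (ht.1.trans ht.2) (hI.out hc hd)
      refine ⟨fun s => X s * (Ring.inverse (X t₀) * A), fun _ _ _ =>
        ⟨Ring.mul_inverse_cancel_left _ _ (hX t₀ ht).1, fun t ht' => (hX t ht').mul_const
          ((hX t₀ ht).1.ringInverse.mul hA)⟩⟩
    · exact ⟨0, fun h1 h2 h3 => absurd ⟨h1, h2, h3⟩ h⟩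
  choose Z hZ using hex
  refine ⟨fun t => Z (min t t₀) (max t t₀) t, ?_, ?_⟩
  · simpa using (hZ t₀ t₀ ht₀ ht₀ (by simp)).1
  intro t ht
  -- a compact interval around `t` and `t₀` with `t` in its interior
  obtain ⟨δ, hδ, hball⟩ := Metric.isOpen_iff.1 hIo t ht
  have hmem : ∀ s, |s - t| < δ → s ∈ I := fun s hs => hball (by rwa [mem_ball, Real.dist_eq])
  set c := min (t - δ / 2) t₀ with hc
  set d := max (t + δ / 2) t₀ with hd
  have hcI : c ∈ I := by
    rcases min_choice (t - δ / 2) t₀ with h | h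
    · rw [hc, h]; exact hmem _ (by rw [abs_lt]; constructor <;> linarith)
    · rw [hc, h]; exact ht₀
  have hdI : d ∈ I := by
    rcases max_choice (t + δ / 2) t₀ with h | h
    · rw [hd, h]; exact hmem _ (by rw [abs_lt]; constructor <;> linarith)
    · rw [hd, h]; exact ht₀
  have ht₀cd : t₀ ∈ Icc c d := ⟨min_le_right _ _, le_max_right _ _⟩
  have hcd := hZ c d hcI hdI ht₀cd
  have hct : c ≤ t - δ / 2 := min_le_left _ _
  have htd : t + δ / 2 ≤ d := le_max_left _ _
  have hloc : ∀ s ∈ Icc c d, Z (min s t₀) (max s t₀) s = Z c d s := by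
    intro s hs
    have hsI : s ∈ I := hI.out hcI hdI hs
    have h1 : min s t₀ ∈ I := by
      rcases min_choice s t₀ with h | h <;> rw [h] <;> assumption
    have h2 : max s t₀ ∈ I := by
      rcases max_choice s t₀ with h | h <;> rw [h] <;> assumption
    have h3 : t₀ ∈ Icc (min s t₀) (max s t₀) := ⟨min_le_right _ _, le_max_right _ _⟩
    have h4 := hZ _ _ h1 h2 h3
    have hsub : Icc (min s t₀) (max s t₀) ⊆ Icc c d :=
      Icc_subset_Icc (le_min hs.1 ht₀cd.1) (max_le hs.2 ht₀cd.2)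
    exact D.sol_unique (hI.out h1 h2) h4.2 (fun t ht => hcd.2 t (hsub ht)) h3
      ⟨min_le_left _ _, le_max_left _ _⟩ (h4.1.trans hcd.1.symm)
  have hnear : (fun s => Z (min s t₀) (max s t₀) s) =ᶠ[𝓝 t] Z c d := by
    filter_upwards [Icc_mem_nhds (by linarith : c < t) (by linarith : t < d)] with s hs
    exact hloc s hs
  have htcd : t ∈ Icc c d := ⟨by linarith, by linarith⟩
  refine ⟨by beta_reduce; rw [hloc t htcd]; exact (hcd.2 t htcd).1, fun i hi => ?_⟩
  have h5 := (hcd.2 t htcd).2 i hi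
  beta_reduce
  rw [hloc t htcd]
  refine h5.congr_of_eventuallyEq ?_
  filter_upwards [hnear] with s hs
  rw [hs]

end BundleODE

/-- Fundamental solution of an ordinary linear equation over an open interval. -/
theorem exists_fundamental_solution [CompleteSpace F] {I : Set ℝ} (hIo : IsOpen I)
    (hI : I.OrdConnected) {B : ℝ → F →L[ℝ] F} (hB : ContinuousOn B I) {t₀ : ℝ} (ht₀ : t₀ ∈ I) :
    ∃ X : ℝ → F →L[ℝ] F, X t₀ = 1 ∧ ∀ t ∈ I, HasDerivAt X (B t * X t) t := by
  let D : BundleODE F Unit I :=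
    { J := fun _ => I
      T := fun _ _ => 1
      B := fun _ => B
      isOpen_J := fun _ => hIo
      isUnit_T := fun _ _ _ => isUnit_one
      continuousOn_B := fun _ => hB
      compat := fun _ _ _ _ _ _ h => h
      cover := fun t ht => ⟨(), ht⟩ }
  obtain ⟨X, hX0, hX⟩ := D.exists_sol hIo hI ht₀ isUnit_one
  refine ⟨X, hX0, fun t ht => ?_⟩
  simpa [D] using (hX t ht).2 () ht

end LinearODE

/-! ### Disconjugate Jacobi equations and global Riccati solutions -/

section Riccati

open Set

variable {E : Type*} [NormedAddCommGroup E] [InnerProductSpace ℝ E]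

/-- `A` is an operator solution of `A'' + K A = 0` on `I`, with derivative `A'`. -/
def IsJacobiOp (K : ℝ → E →L[ℝ] E) (I : Set ℝ) (A A' : ℝ → E →L[ℝ] E) : Prop :=
  ∀ t ∈ I, HasDerivAt A (A' t) t ∧ HasDerivAt A' (-(K t * A t)) t

/-- `y` is a vector solution of `y'' + K y = 0` on `I`, with derivative `y'`. -/
def IsJacobiVec (K : ℝ → E →L[ℝ] E) (I : Set ℝ) (y y' : ℝ → E) : Prop :=
  ∀ t ∈ I, HasDerivAt y (y' t) t ∧ HasDerivAt y' (-(K t (y t))) t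

/-- No nontrivial solution of `y'' + K y = 0` on `I` has two zeros. -/
def IsDisconjugate (K : ℝ → E →L[ℝ] E) (I : Set ℝ) : Prop :=
  ∀ y y' : ℝ → E, IsJacobiVec K I y y' → ∀ t₁ ∈ I, ∀ t₂ ∈ I, t₁ < t₂ → y t₁ = 0 → y t₂ = 0 →
    ∀ t ∈ I, y t = 0

/-- `U` is a symmetric solution of the Riccati equation `U' + U² + K = 0` at time `t`. -/
def IsRiccatiAt (K U : ℝ → E →L[ℝ] E) (t : ℝ) : Prop :=
  (∀ x y, inner ℝ (U t x) y = inner ℝ x (U t y)) ∧ HasDerivAt U (-(U t * U t) - K t) t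

variable {K : ℝ → E →L[ℝ] E} {I : Set ℝ}

theorem IsJacobiOp.apply {A A' : ℝ → E →L[ℝ] E} (h : IsJacobiOp K I A A') (c : E) :
    IsJacobiVec K I (fun t => A t c) (fun t => A' t c) := fun t ht =>
  ⟨by simpa using (h t ht).1.clm_apply (hasDerivAt_const t c),
    by simpa using (h t ht).2.clm_apply (hasDerivAt_const t c)⟩

theorem IsJacobiOp.mul_const {A A' : ℝ → E →L[ℝ] E} (h : IsJacobiOp K I A A') (W : E →L[ℝ] E) :
    IsJacobiOp K I (fun t => A t * W) (fun t => A' t * W) := fun t ht =>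
  ⟨(h t ht).1.mul_const W, by simpa [mul_assoc] using (h t ht).2.mul_const W⟩

theorem IsJacobiOp.add {A A' B B' : ℝ → E →L[ℝ] E} (h : IsJacobiOp K I A A')
    (h' : IsJacobiOp K I B B') :
    IsJacobiOp K I (fun t => A t + B t) (fun t => A' t + B' t) := fun t ht =>
  ⟨(h t ht).1.add (h' t ht).1, by
    refine ((h t ht).2.add (h' t ht).2).congr_deriv ?_
    noncomm_ring⟩

/-- The initial value problem for the operator Jacobi equation, by reduction to a first-order system
on `E × E`. -/
theorem exists_isJacobiOp [CompleteSpace E] (hIo : IsOpen I) (hI : I.OrdConnected)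
    (hK : ContinuousOn K I) {t₀ : ℝ} (ht₀ : t₀ ∈ I) (P Q : E →L[ℝ] E) :
    ∃ A A', IsJacobiOp K I A A' ∧ A t₀ = P ∧ A' t₀ = Q := by
  let B : ℝ → (E × E) →L[ℝ] (E × E) := fun t =>
    (ContinuousLinearMap.snd ℝ E E).prod (-(K t).comp (ContinuousLinearMap.fst ℝ E E))
  have hB : ContinuousOn B I := by
    have h1 : ContinuousOn (fun t => -(K t).comp (ContinuousLinearMap.fst ℝ E E)) I :=
      (hK.clm_comp continuousOn_const).neg
    exact (ContinuousLinearMap.prodₗᵢ ℝ).continuous.comp_continuousOn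
      ((continuousOn_const (c := ContinuousLinearMap.snd ℝ E E)).prodMk h1)
  obtain ⟨X, hX0, hX⟩ := exists_fundamental_solution hIo hI hB ht₀
  refine ⟨fun t => (ContinuousLinearMap.fst ℝ E E).comp ((X t).comp (P.prod Q)),
    fun t => (ContinuousLinearMap.snd ℝ E E).comp ((X t).comp (P.prod Q)), fun t ht => ⟨?_, ?_⟩,
    ?_, ?_⟩
  · have := (hasDerivAt_const t (ContinuousLinearMap.fst ℝ E E)).clm_comp
      ((hX t ht).clm_comp (hasDerivAt_const t (P.prod Q)))
    refine this.congr_deriv ?_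
    ext x; simp [B]
  · have := (hasDerivAt_const t (ContinuousLinearMap.snd ℝ E E)).clm_comp
      ((hX t ht).clm_comp (hasDerivAt_const t (P.prod Q)))
    refine this.congr_deriv ?_
    ext x; simp [B]
  · ext x; simp [hX0]
  · ext x; simp [hX0]

/-- The Wronskian of an operator solution is constant when `K` is symmetric, hence vanishes
everywhere if it vanishes at one time. -/
theorem IsJacobiOp.wronskian_eq_zero {A A' : ℝ → E →L[ℝ] E} (hI : I.OrdConnected)
    (hKs : ∀ t ∈ I, ∀ x y, inner ℝ (K t x) y = inner ℝ x (K t y))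
    (h : IsJacobiOp K I A A') {s : ℝ} (hs : s ∈ I)
    (h0 : ∀ c d, inner ℝ (A' s c) (A s d) = inner ℝ (A s c) (A' s d)) {t : ℝ} (ht : t ∈ I)
    (c d : E) : inner ℝ (A' t c) (A t d) = inner ℝ (A t c) (A' t d) := by
  have hd : ∀ t ∈ I, HasDerivAt
      (fun u => inner ℝ (A' u c) (A u d) - inner ℝ (A u c) (A' u d)) 0 t := by
    intro t ht
    have h1 := (h.apply c t ht)
    have h2 := (h.apply d t ht)
    refine ((h1.2.inner ℝ h2.1).sub (h1.1.inner ℝ h2.2)).congr_deriv ?_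
    simp only [inner_neg_left, inner_neg_right, hKs t ht]
    ring
  have hconst := hI.convex.is_const_of_fderivWithin_eq_zero (𝕜 := ℝ)
    (f := fun u => inner ℝ (A' u c) (A u d) - inner ℝ (A u c) (A' u d))
    (fun t ht => (hd t ht).differentiableAt.differentiableWithinAt) (fun t ht => by
      by_cases hu : UniqueDiffWithinAt ℝ I t
      · rw [(hd t ht).hasFDerivAt.hasFDerivWithinAt.fderivWithin hu]; ext; simp
      · exact fderivWithin_zero_of_not_uniqueDiffWithinAt hu) ht hs
  beta_reduce at hconst
  rw [h0 c d, sub_self] at hconst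
  exact sub_eq_zero.1 hconst

/-- An operator solution `A` of the Jacobi equation yields the solution `U = A' A⁻¹` of the Riccati
equation wherever `A` is invertible. The symmetry of `U` is the vanishing of the Wronskian. -/
theorem IsJacobiOp.isRiccatiAt [CompleteSpace E] {A A' : ℝ → E →L[ℝ] E} (h : IsJacobiOp K I A A')
    {t : ℝ} (ht : t ∈ I)
    (hw : ∀ c d, inner ℝ (A' t c) (A t d) = inner ℝ (A t c) (A' t d)) (hu : IsUnit (A t)) :
    IsRiccatiAt K (fun s => A' s * Ring.inverse (A s)) t := by
  constructor
  · intro x y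
    have hx : A t (Ring.inverse (A t) x) = x :=
      congrArg (fun f : E →L[ℝ] E => f x) (Ring.mul_inverse_cancel _ hu)
    have hy : A t (Ring.inverse (A t) y) = y :=
      congrArg (fun f : E →L[ℝ] E => f y) (Ring.mul_inverse_cancel _ hu)
    have := hw (Ring.inverse (A t) x) (Ring.inverse (A t) y)
    rwa [hx, hy] at this
  · obtain ⟨w, hw⟩ := hu
    have hinv := (hasFDerivAt_ringInverse (𝕜 := ℝ) w)
    rw [hw] at hinv
    refine ((h t ht).2.mul (hinv.comp_hasDerivAt t (h t ht).1)).congr_deriv ?_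
    change -(K t * A t) * Ring.inverse (A t) + A' t * (-(↑w⁻¹ * A' t * ↑w⁻¹)) = _
    have hinv : Ring.inverse (A t) = ↑w⁻¹ := by rw [← hw]; exact Ring.inverse_unit w
    have hAw : A t * (↑w⁻¹ : E →L[ℝ] E) = 1 := by rw [← hw]; simp
    beta_reduce
    rw [hinv, neg_mul, mul_assoc (K t), hAw]
    noncomm_ring

/-- Comparison of a Jacobi field vanishing at `s` with a Riccati solution on `[t, s]`: the function
`⟨y' - U y, y⟩` has derivative `‖y' - U y‖²` and vanishes at `s`. -/
theorem IsJacobiVec.inner_le_of_isRiccatiAt {y y' : ℝ → E} (hy : IsJacobiVec K I y y')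
    {U : ℝ → E →L[ℝ] E} {t s : ℝ} (hts : t ≤ s) (hsub : Icc t s ⊆ I)
    (hU : ∀ u ∈ Icc t s, IsRiccatiAt K U u) (hs : y s = 0) :
    inner ℝ (y' t) (y t) ≤ inner ℝ (U t (y t)) (y t) := by
  have hd : ∀ u ∈ Icc t s, HasDerivAt (fun u => inner ℝ (y' u - U u (y u)) (y u))
      (‖y' u - U u (y u)‖ ^ 2) u := by
    intro u hu
    have h1 := hy u (hsub hu)
    have h2 := hU u hu
    refine ((h1.2.sub (h2.2.clm_apply h1.1)).inner ℝ h1.1).congr_deriv ?_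
    change inner ℝ (y' u - U u (y u)) (y' u) + _ = _
    rw [← real_inner_self_eq_norm_sq]
    have h3 : inner ℝ (U u (U u (y u))) (y u) = inner ℝ (U u (y u)) (U u (y u)) := h2.1 _ _
    have h4 : inner ℝ (U u (y' u)) (y u) = inner ℝ (y' u) (U u (y u)) := h2.1 _ _
    simp only [inner_sub_left, inner_sub_right, inner_add_left, inner_neg_left,
      sub_apply, neg_apply, mul_apply_eq_comp, h3, h4,
      real_inner_comm (y' u) (U u (y u))]
    ring
  have hmono : MonotoneOn (fun u => inner ℝ (y' u - U u (y u)) (y u)) (Icc t s) := by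
    refine monotoneOn_of_deriv_nonneg (convex_Icc t s)
      (fun u hu => (hd u hu).continuousAt.continuousWithinAt)
      (fun u hu => (hd u (interior_subset hu)).differentiableAt.differentiableWithinAt)
      (fun u hu => ?_)
    rw [(hd u (interior_subset hu)).deriv]
    positivity
  have := hmono ⟨le_rfl, hts⟩ ⟨hts, le_rfl⟩ hts
  simp only [hs, inner_zero_right, inner_sub_left] at this
  linarith

/-- The norm of a symmetric operator is bounded by its quadratic form. -/
theorem norm_le_of_abs_inner_le {U : E →L[ℝ] E} {C : ℝ} (hC : 0 ≤ C)
    (hs : ∀ x y, inner ℝ (U x) y = inner ℝ x (U y))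
    (h : ∀ x, |inner ℝ (U x) x| ≤ C * ‖x‖ ^ 2) : ‖U‖ ≤ C := by
  refine U.opNorm_le_bound hC fun x => ?_
  by_cases hUx : U x = 0
  · rw [hUx, norm_zero]; positivity
  have hx : x ≠ 0 := fun h0 => hUx (by rw [h0, map_zero])
  have hxn : 0 < ‖x‖ := norm_pos_iff.2 hx
  have hUn : 0 < ‖U x‖ := norm_pos_iff.2 hUx
  -- polarisation with a vector `y` in the direction of `U x` and of the length of `x`
  set y : E := (‖x‖ / ‖U x‖) • U x with hy
  have hyn : ‖y‖ = ‖x‖ := by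
    rw [hy, norm_smul, Real.norm_of_nonneg (by positivity)]; field_simp
  have h1 := (abs_le.1 (h (x + y))).2
  have h2 := (abs_le.1 (h (x - y))).1
  have h3 := parallelogram_law_with_norm ℝ x y
  have h4 : inner ℝ (U y) x = inner ℝ (U x) y := by rw [hs, real_inner_comm]
  have h5 : inner ℝ (U x) y = ‖x‖ * ‖U x‖ := by
    rw [hy, inner_smul_right, real_inner_self_eq_norm_sq]; field_simp
  simp only [map_add, map_sub, inner_add_left, inner_add_right, inner_sub_left, inner_sub_right]
    at h1 h2
  rw [hyn] at h3
  rw [h4, h5] at h1 h2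
  have h6 : 4 * (‖x‖ * ‖U x‖) ≤ 4 * (C * ‖x‖ ^ 2) := by nlinarith
  have h7 : ‖x‖ * ‖U x‖ ≤ ‖x‖ * (C * ‖x‖) := by nlinarith
  exact le_of_mul_le_mul_left h7 hxn

/-- A lower bound on the logarithmic derivative of `‖y‖`: the function `exp (2 C u) ‖y u‖²` is
nondecreasing. -/
theorem norm_sq_growth {y y' : ℝ → E} {p q C : ℝ} (hpq : p ≤ q)
    (hy : ∀ u ∈ Icc p q, HasDerivAt y (y' u) u)
    (h : ∀ u ∈ Icc p q, -C * ‖y u‖ ^ 2 ≤ inner ℝ (y' u) (y u)) :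
    Real.exp (2 * C * p) * ‖y p‖ ^ 2 ≤ Real.exp (2 * C * q) * ‖y q‖ ^ 2 := by
  have hd : ∀ u ∈ Icc p q, HasDerivAt (fun u => Real.exp (2 * C * u) * ‖y u‖ ^ 2)
      (Real.exp (2 * C * u) * (2 * C) * ‖y u‖ ^ 2 +
        Real.exp (2 * C * u) * (2 * inner ℝ (y u) (y' u))) u := by
    intro u hu
    have h1 : HasDerivAt (fun u => 2 * C * u) (2 * C) u := by
      simpa using (hasDerivAt_id u).const_mul (2 * C)
    exact h1.exp.mul (hy u hu).norm_sq
  have hmono : MonotoneOn (fun u => Real.exp (2 * C * u) * ‖y u‖ ^ 2) (Icc p q) := by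
    refine monotoneOn_of_deriv_nonneg (convex_Icc p q)
      (fun u hu => (hd u hu).continuousAt.continuousWithinAt)
      (fun u hu => (hd u (interior_subset hu)).differentiableAt.differentiableWithinAt)
      (fun u hu => ?_)
    rw [(hd u (interior_subset hu)).deriv, real_inner_comm]
    have := h u (interior_subset hu)
    have he := Real.exp_pos (2 * C * u)
    have : 0 ≤ Real.exp (2 * C * u) * (2 * (C * ‖y u‖ ^ 2 + inner ℝ (y' u) (y u))) := by
      apply mul_nonneg he.le; linarith
    linarith
  exact hmono ⟨le_rfl, hpq⟩ ⟨hpq, le_rfl⟩ hpq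

/-- The time reversal of `norm_sq_growth`. -/
theorem norm_sq_growth_left {y y' : ℝ → E} {p q C : ℝ} (hpq : p ≤ q)
    (hy : ∀ u ∈ Icc p q, HasDerivAt y (y' u) u)
    (h : ∀ u ∈ Icc p q, inner ℝ (y' u) (y u) ≤ C * ‖y u‖ ^ 2) :
    Real.exp (-(2 * C * q)) * ‖y q‖ ^ 2 ≤ Real.exp (-(2 * C * p)) * ‖y p‖ ^ 2 := by
  have := norm_sq_growth (y := fun u => y (-u)) (y' := fun u => -y' (-u)) (p := -q) (q := -p)
    (C := C) (by linarith)
    (fun u hu => by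
      have h1 := (hy (-u) ⟨by linarith [hu.2], by linarith [hu.1]⟩).scomp u (hasDerivAt_neg u)
      simpa [Function.comp_def] using h1)
    (fun u hu => by
      have := h (-u) ⟨by linarith [hu.2], by linarith [hu.1]⟩
      rw [inner_neg_left]; linarith)
  simpa using this

variable [FiniteDimensional ℝ E]

/-- A Jacobi equation without conjugate points has a symmetric Riccati solution on the whole
interval: it is the limit of the Riccati solutions that blow up at `s`, as `s` tends to the right
end of the interval. -/
theorem IsDisconjugate.exists_isRiccatiAt (hIo : IsOpen I) (hI : I.OrdConnected)
    (hne : I.Nonempty) (hK : ContinuousOn K I)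
    (hKs : ∀ t ∈ I, ∀ x y, inner ℝ (K t x) y = inner ℝ x (K t y))
    (hdis : IsDisconjugate K I) (hseq : ∃ s : ℕ → ℝ, (∀ k, s k ∈ I) ∧
      ∀ t ∈ I, ∀ᶠ k in Filter.atTop, t < s k) :
    ∃ U, ∀ t ∈ I, IsRiccatiAt K U t := by
  have : CompleteSpace E := FiniteDimensional.complete ℝ E
  obtain ⟨t₀, ht₀⟩ := hne
  obtain ⟨P, P', hP, hP0, hP0'⟩ := exists_isJacobiOp hIo hI hK ht₀ 1 0
  obtain ⟨Q, Q', hQ, hQ0, hQ0'⟩ := exists_isJacobiOp hIo hI hK ht₀ 0 1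
  have hunit : ∀ X : E →L[ℝ] E, (∀ c, X c = 0 → c = 0) → IsUnit X := by
    intro X hX
    have hinj : Function.Injective (X : E →ₗ[ℝ] E) := by
      rw [← LinearMap.ker_eq_bot, LinearMap.ker_eq_bot']; exact hX
    let e := (LinearEquiv.ofInjectiveEndo (X : E →ₗ[ℝ] E) hinj).toContinuousLinearEquiv
    have he : (e : E →L[ℝ] E) = X := by ext x; rfl
    rw [← he]
    exact ⟨ContinuousLinearEquiv.toUnit e, rfl⟩
  have hdis' : ∀ y y' : ℝ → E, IsJacobiVec K I y y' → ∀ t₁ ∈ I, ∀ t₂ ∈ I, t₁ ≠ t₂ → y t₁ = 0 →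
      y t₂ = 0 → ∀ t ∈ I, y t = 0 := by
    intro y y' hy t₁ h₁ t₂ h₂ hne z₁ z₂
    rcases lt_or_gt_of_ne hne with h | h
    · exact hdis y y' hy t₁ h₁ t₂ h₂ h z₁ z₂
    · exact hdis y y' hy t₂ h₂ t₁ h₁ h z₂ z₁
  have hQu : ∀ s ∈ I, s ≠ t₀ → IsUnit (Q s) := by
    intro s hs hst
    refine hunit _ fun c hc => ?_
    have hz := hdis' _ _ (hQ.apply c) s hs t₀ ht₀ hst hc (by simp [hQ0])
    have h1 := (hQ.apply c t₀ ht₀).1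
    have h2 : (fun t => Q t c) =ᶠ[𝓝 t₀] fun _ => 0 := by
      filter_upwards [hIo.mem_nhds ht₀] with t ht using hz t ht
    have h3 := (h1.congr_of_eventuallyEq h2.symm).unique (hasDerivAt_const t₀ (0 : E))
    simpa [hQ0'] using h3
  -- the solution with value `1` at `t₀` and value `0` at `s`
  let W : ℝ → E →L[ℝ] E := fun s => -(Ring.inverse (Q s) * P s)
  let A : ℝ → ℝ → E →L[ℝ] E := fun s t => P t + Q t * W s
  let A' : ℝ → ℝ → E →L[ℝ] E := fun s t => P' t + Q' t * W s
  have hA : ∀ V : E →L[ℝ] E, IsJacobiOp K I (fun t => P t + Q t * V) (fun t => P' t + Q' t * V) :=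
    fun V => hP.add (hQ.mul_const V)
  have hA0 : ∀ V : E →L[ℝ] E, P t₀ + Q t₀ * V = 1 := fun V => by simp [hP0, hQ0]
  have hA0' : ∀ V : E →L[ℝ] E, P' t₀ + Q' t₀ * V = V := fun V => by simp [hP0', hQ0']
  have hAs : ∀ s ∈ I, s ≠ t₀ → A s s = 0 := fun s hs hst => by
    simp only [A, W, mul_neg, Ring.mul_inverse_cancel_left _ _ (hQu s hs hst), add_neg_cancel]
  have hAu : ∀ s ∈ I, s ≠ t₀ → ∀ t ∈ I, t ≠ s → IsUnit (A s t) := by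
    intro s hs hst t ht hts
    refine hunit _ fun c hc => ?_
    have hz := hdis' _ _ ((hA (W s)).apply c) t ht s hs hts hc (by
      change A s s c = 0
      rw [hAs s hs hst]; rfl) t₀ ht₀
    beta_reduce at hz
    rwa [hA0] at hz
  have hWr : ∀ s ∈ I, s ≠ t₀ → ∀ t ∈ I, ∀ c d,
      inner ℝ (A' s t c) (A s t d) = inner ℝ (A s t c) (A' s t d) := fun s hs hst t ht c d =>
    (hA (W s)).wronskian_eq_zero hI hKs hs (fun c d => by
      have h0 : P s + Q s * W s = 0 := hAs s hs hst
      simp [h0]) ht c d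
  let U : ℝ → ℝ → E →L[ℝ] E := fun s t => A' s t * Ring.inverse (A s t)
  have hUric : ∀ s ∈ I, s ≠ t₀ → ∀ t ∈ I, t ≠ s → IsRiccatiAt K (U s) t := fun s hs hst t ht hts =>
    (hA (W s)).isRiccatiAt ht (hWr s hs hst t ht) (hAu s hs hst t ht hts)
  have hU0 : ∀ s, U s t₀ = W s := fun s => by
    change (P' t₀ + Q' t₀ * W s) * Ring.inverse (P t₀ + Q t₀ * W s) = W s
    rw [hA0, hA0', Ring.inverse_one, mul_one]
  have hUA : ∀ s ∈ I, s ≠ t₀ → ∀ t ∈ I, t ≠ s → ∀ c, A' s t c = U s t (A s t c) := by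
    intro s hs hst t ht hts c
    have : U s t * A s t = A' s t := by
      simp only [U, mul_assoc, Ring.inverse_mul_cancel _ (hAu s hs hst t ht hts), mul_one]
    rw [← this]; rfl
  -- comparison: `U s ≤ V` for every Riccati solution `V` which exists on `[t, s]`
  have hcomp : ∀ s ∈ I, s ≠ t₀ → ∀ t ∈ I, t < s → ∀ V : ℝ → E →L[ℝ] E,
      (∀ u ∈ Icc t s, IsRiccatiAt K V u) → ∀ x, inner ℝ (U s t x) x ≤ inner ℝ (V t x) x := by
    intro s hs hst t ht hts V hV x
    have hx : A s t (Ring.inverse (A s t) x) = x :=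
      congrArg (fun f : E →L[ℝ] E => f x) (Ring.mul_inverse_cancel _ (hAu s hs hst t ht hts.ne))
    have h1 := ((hA (W s)).apply (Ring.inverse (A s t) x)).inner_le_of_isRiccatiAt hts.le
      (hI.out ht hs) hV (by
        change A s s _ = 0
        rw [hAs s hs hst]; rfl)
    change inner ℝ (A' s t _) (A s t _) ≤ inner ℝ (V t (A s t _)) (A s t _) at h1
    rwa [hUA s hs hst t ht hts.ne, hx] at h1
  have hlt : ∀ t ∈ I, ∃ r ∈ I, r < t ∧ r < t₀ := by
    intro t ht
    have hm : min t t₀ ∈ I := by rcases min_choice t t₀ with h | h <;> rw [h] <;> assumption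
    obtain ⟨r, hr, hrI⟩ := ((frequently_lt_nhds (min t t₀)).and_eventually
      (hIo.mem_nhds hm)).exists
    exact ⟨r, hrI, hr.trans_le (min_le_left _ _), hr.trans_le (min_le_right _ _)⟩
  have hgt : ∀ t ∈ I, ∃ r ∈ I, t < r ∧ t₀ < r := by
    intro t ht
    have hm : max t t₀ ∈ I := by rcases max_choice t t₀ with h | h <;> rw [h] <;> assumption
    obtain ⟨r, hr, hrI⟩ := ((frequently_gt_nhds (max t t₀)).and_eventually
      (hIo.mem_nhds hm)).exists
    exact ⟨r, hrI, (le_max_left _ _).trans_lt hr, (le_max_right _ _).trans_lt hr⟩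
  have hcs : ∀ (V : E →L[ℝ] E) (x : E), |inner ℝ (V x) x| ≤ ‖V‖ * ‖x‖ ^ 2 := fun V x =>
    (abs_real_inner_le_norm _ _).trans (by
      have := V.le_opNorm x
      nlinarith [norm_nonneg x])
  have hbdd : ∀ V : ℝ → E →L[ℝ] E, ∀ c d : ℝ, (∀ u ∈ Icc c d, IsRiccatiAt K V u) →
      ∃ C, ∀ u ∈ Icc c d, ‖V u‖ ≤ C := fun V c d hV =>
    isCompact_Icc.exists_bound_of_continuousOn fun u hu =>
      (hV u hu).2.continuousAt.continuousWithinAt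
  obtain ⟨s, hsI, hslim⟩ := hseq
  -- Lower bounds for the solutions `A (s k)`, uniform in `k`. They come from bounds on their
  -- logarithmic derivatives `U (s k)`: to the right of `t₀` by comparison with a Riccati solution
  -- that blows up later than `t`, to the left by comparison with one that blows up before `t`.
  have hlow : ∀ t ∈ I, ∃ c > 0, ∀ᶠ k in Filter.atTop, ∀ x, c * ‖x‖ ^ 2 ≤ ‖A (s k) t x‖ ^ 2 := by
    intro t ht
    rcases le_total t₀ t with h0 | h0
    · obtain ⟨r, hr, htr, hr0⟩ := hgt t ht
      have hsubI : Icc t₀ t ⊆ I := hI.out ht₀ ht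
      obtain ⟨C, hC⟩ := hbdd (U r) t₀ t fun u hu =>
        hUric r hr hr0.ne' u (hsubI hu) (hu.2.trans_lt htr).ne
      refine ⟨Real.exp (2 * C * t₀) / Real.exp (2 * C * t), by positivity, ?_⟩
      filter_upwards [hslim r hr] with k hk x
      have hk0 : s k ≠ t₀ := (hr0.trans hk).ne'
      have h1 := norm_sq_growth (y := fun u => A (s k) u x) (y' := fun u => A' (s k) u x)
        (C := C) h0 (fun u hu => ((hA (W (s k))).apply x u (hsubI hu)).1) (fun u hu => by
          have hur : u < r := hu.2.trans_lt htr
          rw [hUA (s k) (hsI k) hk0 u (hsubI hu) (hur.trans hk).ne]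
          have h2 := hcomp r hr hr0.ne' u (hsubI hu) hur (U (s k)) (fun w hw =>
            hUric (s k) (hsI k) hk0 w (hI.out (hsubI hu) hr hw) (hw.2.trans_lt hk).ne)
            (A (s k) u x)
          have h3 := (abs_le.1 (hcs (U r u) (A (s k) u x))).1
          have h4 := mul_le_mul_of_nonneg_right (hC u hu) (sq_nonneg ‖A (s k) u x‖)
          linarith)
      have h0' : A (s k) t₀ = 1 := hA0 _
      simp only [h0', one_apply_eq_self] at h1
      rw [div_mul_eq_mul_div, div_le_iff₀ (Real.exp_pos _)]
      linarith
    · obtain ⟨r, hr, hrt, hr0⟩ := hlt t ht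
      have hsubI : Icc t t₀ ⊆ I := hI.out ht ht₀
      obtain ⟨C, hC⟩ := hbdd (U r) t t₀ fun u hu =>
        hUric r hr hr0.ne u (hsubI hu) (hrt.trans_le hu.1).ne'
      refine ⟨Real.exp (-(2 * C * t₀)) / Real.exp (-(2 * C * t)), by positivity, ?_⟩
      filter_upwards [hslim t₀ ht₀] with k hk x
      have h1 := norm_sq_growth_left (y := fun u => A (s k) u x) (y' := fun u => A' (s k) u x)
        (C := C) h0 (fun u hu => ((hA (W (s k))).apply x u (hsubI hu)).1) (fun u hu => by
          have hus : u < s k := hu.2.trans_lt hk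
          rw [hUA (s k) (hsI k) hk.ne' u (hsubI hu) hus.ne]
          have h2 := hcomp (s k) (hsI k) hk.ne' u (hsubI hu) hus (U r) (fun w hw =>
            hUric r hr hr0.ne w (hI.out (hsubI hu) (hsI k) hw) (hrt.trans_le
              (hu.1.trans hw.1)).ne') (A (s k) u x)
          have h3 := (abs_le.1 (hcs (U r u) (A (s k) u x))).2
          have h4 := mul_le_mul_of_nonneg_right (hC u hu) (sq_nonneg ‖A (s k) u x‖)
          linarith)
      have h0' : A (s k) t₀ = 1 := hA0 _
      simp only [h0', one_apply_eq_self] at h1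
      rw [div_mul_eq_mul_div, div_le_iff₀ (Real.exp_pos _)]
      linarith
  -- The initial values `W (s k)` lie between those of the Riccati solutions that blow up at `r₁ <
  -- t₀` and at `r₂ > t₀`, so a subsequence converges.
  obtain ⟨r₁, hr₁, hr₁0, -⟩ := hlt t₀ ht₀
  obtain ⟨r₂, hr₂, hr₂0, -⟩ := hgt t₀ ht₀
  have hWsymm : ∀ s ∈ I, t₀ < s → ∀ x y, inner ℝ (W s x) y = inner ℝ x (W s y) := by
    intro s hs hst x y
    have := (hUric s hs hst.ne' t₀ ht₀ hst.ne).1 x y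
    rwa [hU0] at this
  obtain ⟨k₀, hk₀⟩ := Filter.eventually_atTop.1 (hslim r₂ hr₂)
  have hWb : ∀ k, W (s (k + k₀)) ∈ Metric.closedBall (0 : E →L[ℝ] E) (‖U r₁ t₀‖ + ‖U r₂ t₀‖) := by
    intro k
    have hk : r₂ < s (k + k₀) := hk₀ _ (Nat.le_add_left _ _)
    have hk0 := hr₂0.trans hk
    rw [mem_closedBall_zero_iff]
    refine norm_le_of_abs_inner_le (by positivity) (hWsymm _ (hsI _) hk0) fun x => ?_
    have h1 := hcomp (s (k + k₀)) (hsI _) hk0.ne' t₀ ht₀ hk0 (U r₁) (fun w hw =>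
      hUric r₁ hr₁ hr₁0.ne w (hI.out ht₀ (hsI _) hw) (hr₁0.trans_le hw.1).ne') x
    have h2 := hcomp r₂ hr₂ hr₂0.ne' t₀ ht₀ hr₂0 (U (s (k + k₀))) (fun w hw =>
      hUric _ (hsI _) hk0.ne' w (hI.out ht₀ hr₂ hw) (hw.2.trans_lt hk).ne) x
    rw [hU0 (s (k + k₀))] at h1 h2
    have h3 := (abs_le.1 (hcs (U r₁ t₀) x)).2
    have h4 := (abs_le.1 (hcs (U r₂ t₀) x)).1
    have h5 : 0 ≤ ‖U r₁ t₀‖ * ‖x‖ ^ 2 := by positivity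
    have h6 : 0 ≤ ‖U r₂ t₀‖ * ‖x‖ ^ 2 := by positivity
    rw [abs_le]
    constructor <;> linarith
  have : ProperSpace (E →L[ℝ] E) := FiniteDimensional.proper ℝ _
  obtain ⟨V, -, θ, hθ, hV⟩ := tendsto_subseq_of_bounded Metric.isBounded_closedBall hWb
  have hθ' : Filter.Tendsto (fun k => θ k + k₀) Filter.atTop Filter.atTop :=
    (Filter.tendsto_add_atTop_nat k₀).comp hθ.tendsto_atTop
  have hVs : ∀ x y, inner ℝ (V x) y = inner ℝ x (V y) := by
    intro x y
    have h1 : Filter.Tendsto (fun k => inner ℝ (W (s (θ k + k₀)) x) y) Filter.atTop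
        (𝓝 (inner ℝ (V x) y)) :=
      ((((ContinuousLinearMap.apply ℝ E x).continuous.tendsto V).comp hV).inner
        tendsto_const_nhds)
    have h2 : Filter.Tendsto (fun k => inner ℝ x (W (s (θ k + k₀)) y)) Filter.atTop
        (𝓝 (inner ℝ x (V y))) :=
      (tendsto_const_nhds.inner
        (((ContinuousLinearMap.apply ℝ E y).continuous.tendsto V).comp hV))
    refine tendsto_nhds_unique h1 (h2.congr fun k => ?_)
    exact (hWsymm _ (hsI _) (hr₂0.trans (hk₀ _ (Nat.le_add_left _ _))) x y).symm
  -- The solution with initial value `V` is a limit of solutions with a uniform lower bound, hence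
  -- invertible everywhere.
  refine ⟨fun t => (P' t + Q' t * V) * Ring.inverse (P t + Q t * V), fun t ht =>
    (hA V).isRiccatiAt ht ((hA V).wronskian_eq_zero hI hKs ht₀ (fun c d => ?_) ht)
      (hunit _ fun x hx => ?_)⟩
  · rw [hA0, hA0']
    exact hVs c d
  · obtain ⟨c, hc, hck⟩ := hlow t ht
    have h1 : Filter.Tendsto (fun k => ‖A (s (θ k + k₀)) t x‖ ^ 2) Filter.atTop
        (𝓝 (‖(P t + Q t * V) x‖ ^ 2)) := by
      have h2 : Filter.Tendsto (fun k => P t + Q t * W (s (θ k + k₀))) Filter.atTop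
          (𝓝 (P t + Q t * V)) := tendsto_const_nhds.add (tendsto_const_nhds.mul hV)
      exact ((((ContinuousLinearMap.apply ℝ E x).continuous.tendsto _).comp h2).norm.pow 2)
    have h3 : c * ‖x‖ ^ 2 ≤ ‖(P t + Q t * V) x‖ ^ 2 :=
      ge_of_tendsto h1 ((hθ'.eventually hck).mono fun k hk => hk x)
    rw [hx, norm_zero] at h3
    have h4 : ‖x‖ ^ 2 ≤ 0 := by nlinarith [sq_nonneg ‖x‖]
    exact norm_eq_zero.1 (pow_eq_zero_iff two_ne_zero |>.1 (le_antisymm h4 (sq_nonneg _)))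

end Riccati

/-! ### Weighted Raychaudhuri inequality -/

section Raychaudhuri

open Set

/-- A solution of `dh/dτ ≤ -c h²` that exists for all times `τ ∈ (-∞, ∞)` vanishes. -/
theorem eq_zero_of_deriv_le_neg_sq {I : Set ℝ} (hI : I.OrdConnected) {h h' τ τ' : ℝ → ℝ} {c : ℝ}
    (hc : 0 < c) (hh : ∀ t ∈ I, HasDerivAt h (h' t) t) (hτ : ∀ t ∈ I, HasDerivAt τ (τ' t) t)
    (hτ0 : ∀ t ∈ I, 0 ≤ τ' t) (hle : ∀ t ∈ I, h' t ≤ -c * τ' t * h t ^ 2)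
    (htop : ∀ C, ∀ t ∈ I, ∃ s ∈ I, t ≤ s ∧ C ≤ τ s)
    (hbot : ∀ C, ∀ t ∈ I, ∃ s ∈ I, s ≤ t ∧ τ s ≤ C) : ∀ t ∈ I, h t = 0 := by
  have hanti : AntitoneOn h I := by
    refine antitoneOn_of_deriv_nonpos hI.convex
      (fun t ht => (hh t ht).continuousAt.continuousWithinAt)
      (fun t ht => (hh t (interior_subset ht)).differentiableAt.differentiableWithinAt)
      (fun t ht => ?_)
    rw [(hh t (interior_subset ht)).deriv]
    have h1 := hle t (interior_subset ht)
    have h2 := hτ0 t (interior_subset ht)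
    have : 0 ≤ c * τ' t * h t ^ 2 := by positivity
    linarith
  -- `1 / h - c τ` is nondecreasing as long as `h` does not vanish
  have hmono : ∀ p ∈ I, ∀ q ∈ I, p ≤ q → (∀ u ∈ Icc p q, h u ≠ 0) →
      (h p)⁻¹ - c * τ p ≤ (h q)⁻¹ - c * τ q := by
    intro p hp q hq hpq hne
    have hsub : Icc p q ⊆ I := hI.out hp hq
    have hd : ∀ u ∈ Icc p q, HasDerivAt (fun u => (h u)⁻¹ - c * τ u)
        (-h' u / h u ^ 2 - c * τ' u) u := fun u hu =>
      ((hh u (hsub hu)).inv (hne u hu)).sub ((hτ u (hsub hu)).const_mul c)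
    have hm : MonotoneOn (fun u => (h u)⁻¹ - c * τ u) (Icc p q) := by
      refine monotoneOn_of_deriv_nonneg (convex_Icc p q)
        (fun u hu => (hd u hu).continuousAt.continuousWithinAt)
        (fun u hu => (hd u (interior_subset hu)).differentiableAt.differentiableWithinAt)
        (fun u hu => ?_)
      have hu' := interior_subset hu
      rw [(hd u hu').deriv, sub_nonneg, le_div_iff₀ (by have := hne u hu'; positivity)]
      have := hle u (hsub hu')
      linarith
    exact hm ⟨le_rfl, hpq⟩ ⟨hpq, le_rfl⟩ hpq
  intro t ht
  rcases lt_trichotomy (h t) 0 with hneg | h0 | hpos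
  · exfalso
    obtain ⟨s, hs, hts, hCs⟩ := htop (τ t - (h t)⁻¹ / c) t ht
    have hneg' : ∀ u ∈ Icc t s, h u < 0 := fun u hu =>
      (hanti ht (hI.out ht hs hu) hu.1).trans_lt hneg
    have h1 := hmono t ht s hs hts fun u hu => (hneg' u hu).ne
    have h2 : (h s)⁻¹ < 0 := inv_lt_zero.2 (hneg' s ⟨hts, le_rfl⟩)
    have h3 : c * (τ t - (h t)⁻¹ / c) ≤ c * τ s := by gcongr
    have h4 : c * (τ t - (h t)⁻¹ / c) = c * τ t - (h t)⁻¹ := by field_simp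
    linarith
  · exact h0
  · exfalso
    obtain ⟨s, hs, hst, hCs⟩ := hbot (τ t - (h t)⁻¹ / c) t ht
    have hpos' : ∀ u ∈ Icc s t, 0 < h u := fun u hu =>
      hpos.trans_le (hanti (hI.out hs ht hu) ht hu.2)
    have h1 := hmono s hs t ht hst fun u hu => (hpos' u hu).ne'
    have h2 : 0 < (h s)⁻¹ := inv_pos.2 (hpos' s ⟨le_rfl, hst⟩)
    have h3 : c * τ s ≤ c * (τ t - (h t)⁻¹ / c) := by gcongr
    have h4 : c * (τ t - (h t)⁻¹ / c) = c * τ t - (h t)⁻¹ := by field_simp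
    linarith

variable {E : Type*} [NormedAddCommGroup E] [InnerProductSpace ℝ E] [FiniteDimensional ℝ E]

variable (E) in
/-- The trace of an endomorphism as a continuous linear functional. -/
noncomputable def traceL : (E →L[ℝ] E) →L[ℝ] ℝ :=
  LinearMap.toContinuousLinearMap (LinearMap.trace ℝ E ∘ₗ ContinuousLinearMap.coeLM ℝ)

theorem traceL_apply (U : E →L[ℝ] E) : traceL E U = LinearMap.trace ℝ E U := rfl

theorem traceL_eq_sum {ι : Type*} [Fintype ι] (b : OrthonormalBasis ι ℝ E) (U : E →L[ℝ] E) :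
    traceL E U = ∑ i, inner ℝ (b i) (U (b i)) := by
  rw [traceL_apply, LinearMap.trace_eq_sum_inner _ b]
  rfl

theorem traceL_sq_eq_sum {ι : Type*} [Fintype ι] (b : OrthonormalBasis ι ℝ E) {U : E →L[ℝ] E}
    (hU : ∀ x y, inner ℝ (U x) y = inner ℝ x (U y)) :
    traceL E (U * U) = ∑ i, ‖U (b i)‖ ^ 2 := by
  rw [traceL_eq_sum b]
  refine Finset.sum_congr rfl fun i _ => ?_
  rw [← real_inner_self_eq_norm_sq, hU]
  rfl

/-- The Cauchy-Schwarz inequality `(tr U)² ≤ n tr U²` for symmetric operators. -/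
theorem sq_traceL_le {U : E →L[ℝ] E} (hU : ∀ x y, inner ℝ (U x) y = inner ℝ x (U y)) :
    traceL E U ^ 2 ≤ Module.finrank ℝ E * traceL E (U * U) := by
  let b := stdOrthonormalBasis ℝ E
  rw [traceL_eq_sum b, traceL_sq_eq_sum b hU]
  refine (sq_sum_le_card_mul_sum_sq (s := Finset.univ)
    (f := fun i => inner ℝ (b i) (U (b i)))).trans ?_
  rw [Finset.card_univ, Fintype.card_fin]
  refine mul_le_mul_of_nonneg_left (Finset.sum_le_sum fun i _ => ?_) (Nat.cast_nonneg _)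
  rw [← sq_abs]
  have := abs_real_inner_le_norm (b i) (U (b i))
  rw [b.orthonormal.norm_eq_one, one_mul] at this
  exact pow_le_pow_left₀ (abs_nonneg _) this 2

theorem eq_zero_of_traceL_sq_nonpos {U : E →L[ℝ] E}
    (hU : ∀ x y, inner ℝ (U x) y = inner ℝ x (U y)) (h : traceL E (U * U) ≤ 0) : U = 0 := by
  let b := stdOrthonormalBasis ℝ E
  rw [traceL_sq_eq_sum b hU] at h
  have h0 := (Finset.sum_eq_zero_iff_of_nonneg (fun i _ => sq_nonneg ‖U (b i)‖)).1
    (le_antisymm h (Finset.sum_nonneg fun i _ => sq_nonneg ‖U (b i)‖))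
  ext1 x
  rw [← b.sum_repr x, map_sum]
  refine Finset.sum_eq_zero fun i hi => ?_
  have := h0 i hi
  rw [map_smul, norm_eq_zero.1 (pow_eq_zero_iff two_ne_zero |>.1 this), smul_zero]

/-- If the weighted Ricci curvature `tr K + ψ'' - q ψ'²` is nonnegative and the `ε`-proper time `τ`
is complete, then a symmetric Riccati solution on the whole interval forces `K = 0`. With `φ = tr U
- ψ'`, the function `h = exp (2 (1 - ε) ψ / n) φ` satisfies `dh/dτ ≤ -(c / (n C)) h²`, where `C` is
the constant speed. The hypothesis `hform`, which says that `x² + 2 ε x y + (1 + n q) y² ≥ c x²` for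
`y = ψ'`, is what remains after `tr U² ≥ (tr U)² / n` with `tr U = φ + ψ'`. -/
theorem eq_zero_of_isRiccatiAt {I : Set ℝ} (hIo : IsOpen I) (hI : I.OrdConnected)
    (hn : 0 < Module.finrank ℝ E) {K U : ℝ → E →L[ℝ] E} (hU : ∀ t ∈ I, IsRiccatiAt K U t)
    {ψ ψ' ψ'' τ : ℝ → ℝ} (hψ : ∀ t ∈ I, HasDerivAt ψ (ψ' t) t)
    (hψ' : ∀ t ∈ I, HasDerivAt ψ' (ψ'' t) t) {q ε c C : ℝ} (hq : 0 < 1 + Module.finrank ℝ E * q)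
    (hRic : ∀ t ∈ I, 0 ≤ traceL E (K t) + ψ'' t - q * ψ' t ^ 2) (hc : 0 < c) (hC : 0 < C)
    (hform : ∀ t ∈ I, ∀ x, c * x ^ 2 ≤ x ^ 2 + 2 * ε * x * ψ' t +
      (1 + Module.finrank ℝ E * q) * ψ' t ^ 2)
    (hτ : ∀ t ∈ I, HasDerivAt τ (Real.exp (2 * (ε - 1) / Module.finrank ℝ E * ψ t) * C) t)
    (htop : ∀ C, ∀ t ∈ I, ∃ s ∈ I, t ≤ s ∧ C ≤ τ s)
    (hbot : ∀ C, ∀ t ∈ I, ∃ s ∈ I, s ≤ t ∧ τ s ≤ C) : ∀ t ∈ I, K t = 0 := by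
  set n : ℝ := (Module.finrank ℝ E : ℝ) with hndef
  have hn0 : 0 < n := Nat.cast_pos.2 hn
  set φ : ℝ → ℝ := fun t => traceL E (U t) - ψ' t with hφ
  have hφd : ∀ t ∈ I, HasDerivAt φ (-traceL E (U t * U t) - traceL E (K t) - ψ'' t) t := by
    intro t ht
    have h1 := ((traceL E).hasFDerivAt.comp_hasDerivAt t (hU t ht).2).sub (hψ' t ht)
    refine h1.congr_deriv ?_
    simp
  set k : ℝ := 2 * (1 - ε) / n with hk
  have hkn : 2 * (ε - 1) / n = -k := by rw [hk]; ring
  rw [hkn] at hτ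
  set h : ℝ → ℝ := fun t => Real.exp (k * ψ t) * φ t with hh
  have hhd : ∀ t ∈ I, HasDerivAt h (Real.exp (k * ψ t) * (k * ψ' t) * φ t +
      Real.exp (k * ψ t) * (-traceL E (U t * U t) - traceL E (K t) - ψ'' t)) t := fun t ht =>
    (((hψ t ht).const_mul k).exp).mul (hφd t ht)
  have hh0 : ∀ t ∈ I, h t = 0 := by
    refine eq_zero_of_deriv_le_neg_sq hI (c := c / (n * C)) (by positivity) hhd hτ
      (fun t _ => by positivity) (fun t ht => ?_) htop hbot
    have hU2 := sq_traceL_le (hU t ht).1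
    have hR := hRic t ht
    have hF := hform t ht (φ t)
    have htr : traceL E (U t) = φ t + ψ' t := by simp [hφ]
    rw [htr, ← hndef] at hU2
    have hee : Real.exp (-k * ψ t) * Real.exp (k * ψ t) = 1 := by
      rw [← Real.exp_add]; simp
    have hrhs : -(c / (n * C)) * (Real.exp (-k * ψ t) * C) * h t ^ 2 =
        Real.exp (k * ψ t) * (-(c / n) * φ t ^ 2) := by
      have : -(c / (n * C)) * (Real.exp (-k * ψ t) * C) * h t ^ 2 =
          (Real.exp (-k * ψ t) * Real.exp (k * ψ t)) *
            (Real.exp (k * ψ t) * (-(c / n) * φ t ^ 2)) := by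
        rw [hh]; field_simp
      rw [this, hee, one_mul]
    rw [hrhs, mul_assoc, ← mul_add]
    refine mul_le_mul_of_nonneg_left ?_ (Real.exp_pos _).le
    have h1 : n * (k * ψ' t * φ t + (-traceL E (U t * U t) - traceL E (K t) - ψ'' t)) ≤
        n * (-(c / n) * φ t ^ 2) := by
      have e1 : n * (-(c / n) * φ t ^ 2) = -(c * φ t ^ 2) := by field_simp
      have e2 : n * (k * ψ' t * φ t) = 2 * (1 - ε) * (ψ' t * φ t) := by rw [hk]; field_simp
      have e3 := mul_nonneg hn0.le hR
      rw [e1, mul_add, e2]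
      nlinarith
    exact le_of_mul_le_mul_left h1 hn0
  have hφ0 : ∀ t ∈ I, φ t = 0 := fun t ht =>
    (mul_eq_zero.1 (hh0 t ht)).resolve_left (Real.exp_pos _).ne'
  have hU0 : ∀ t ∈ I, U t = 0 := by
    intro t ht
    refine eq_zero_of_traceL_sq_nonpos (hU t ht).1 ?_
    have hev : φ =ᶠ[𝓝 t] fun _ => 0 := by
      filter_upwards [hIo.mem_nhds ht] with s hs using hφ0 s hs
    have hd0 := ((hφd t ht).congr_of_eventuallyEq hev.symm).unique (hasDerivAt_const t (0 : ℝ))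
    have hU2 := sq_traceL_le (hU t ht).1
    have hR := hRic t ht
    have htr : traceL E (U t) = ψ' t := by
      have := hφ0 t ht
      rw [hφ] at this
      exact sub_eq_zero.1 this
    rw [htr, ← hndef] at hU2
    have h1 : traceL E (U t * U t) ≤ -q * ψ' t ^ 2 := by linarith
    rcases le_total 0 q with hq0 | hq0
    · nlinarith [sq_nonneg (ψ' t)]
    · have h2 : -q * ψ' t ^ 2 ≤ -q * (n * traceL E (U t * U t)) :=
        mul_le_mul_of_nonneg_left hU2 (by linarith)
      have h3 : (1 + n * q) * traceL E (U t * U t) ≤ 0 := by linarith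
      by_contra hpos
      push Not at hpos
      have := mul_pos hq hpos
      linarith
  intro t ht
  have hev : U =ᶠ[𝓝 t] fun _ => 0 := by
    filter_upwards [hIo.mem_nhds ht] with s hs using hU0 s hs
  have hd0 := ((hU t ht).2.congr_of_eventuallyEq hev.symm).unique
    (hasDerivAt_const t (0 : E →L[ℝ] E))
  rw [hU0 t ht] at hd0
  simpa using hd0

end Raychaudhuri

/-! ### Calculus of functions of position and velocity -/

namespace LorentzFinsler

open Set

variable {n : ℕ}

/-- `f(x, v)` is smooth on the set `W` of pairs `(x, v)`. -/
def SmoothPV (W : Set (CoordSpace n × CoordSpace n)) (f : CoordSpace n → CoordSpace n → ℝ) : Prop :=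
  ContDiffOn ℝ ∞ (fun z : CoordSpace n × CoordSpace n => f z.1 z.2) W

variable {W : Set (CoordSpace n × CoordSpace n)} {f g : CoordSpace n → CoordSpace n → ℝ}
  {x v : CoordSpace n}

theorem SmoothPV.differentiableAt (hW : IsOpen W) (hf : SmoothPV W f) (hz : (x, v) ∈ W) :
    DifferentiableAt ℝ (fun z : CoordSpace n × CoordSpace n => f z.1 z.2) (x, v) :=
  (hf.contDiffAt (hW.mem_nhds hz)).differentiableAt (by simp)

theorem SmoothPV.hasFDerivAt_left (hW : IsOpen W) (hf : SmoothPV W f) (hz : (x, v) ∈ W) :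
    HasFDerivAt (fun y => f y v) ((fderiv ℝ (fun z : CoordSpace n × CoordSpace n => f z.1 z.2)
      (x, v)).comp (ContinuousLinearMap.inl ℝ _ _)) x := by
  have h1 := (hf.differentiableAt hW hz).hasFDerivAt
  exact HasFDerivAt.comp x (f := fun e => (e, v)) h1 (hasFDerivAt_prodMk_left x v)

theorem SmoothPV.hasFDerivAt_right (hW : IsOpen W) (hf : SmoothPV W f) (hz : (x, v) ∈ W) :
    HasFDerivAt (fun w => f x w) ((fderiv ℝ (fun z : CoordSpace n × CoordSpace n => f z.1 z.2)
      (x, v)).comp (ContinuousLinearMap.inr ℝ _ _)) v := by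
  have h1 := (hf.differentiableAt hW hz).hasFDerivAt
  exact HasFDerivAt.comp v (f := fun e => (x, e)) h1 (hasFDerivAt_prodMk_right x v)

theorem SmoothPV.dX_eq (hW : IsOpen W) (hf : SmoothPV W f) (hz : (x, v) ∈ W) (β : Fin (n + 1)) :
    dX β f x v = fderiv ℝ (fun z : CoordSpace n × CoordSpace n => f z.1 z.2) (x, v)
      (coordBasis β, 0) := by
  rw [dX, (hf.hasFDerivAt_left hW hz).fderiv]; rfl

theorem SmoothPV.dV_eq (hW : IsOpen W) (hf : SmoothPV W f) (hz : (x, v) ∈ W) (β : Fin (n + 1)) :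
    dV β f x v = fderiv ℝ (fun z : CoordSpace n × CoordSpace n => f z.1 z.2) (x, v)
      (0, coordBasis β) := by
  rw [dV, (hf.hasFDerivAt_right hW hz).fderiv]; rfl

theorem SmoothPV.fderiv_const (hW : IsOpen W) (hf : SmoothPV W f) (a : CoordSpace n × CoordSpace n) :
    ContDiffOn ℝ ∞ (fun z => fderiv ℝ (fun z : CoordSpace n × CoordSpace n => f z.1 z.2) z a) W :=
  (hf.fderiv_of_isOpen hW (m := ∞) (by simp)).clm_apply contDiffOn_const

theorem SmoothPV.dX (hW : IsOpen W) (hf : SmoothPV W f) (β : Fin (n + 1)) :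
    SmoothPV W (dX β f) :=
  (hf.fderiv_const hW _).congr fun _ hz => hf.dX_eq hW hz β

theorem SmoothPV.dV (hW : IsOpen W) (hf : SmoothPV W f) (β : Fin (n + 1)) :
    SmoothPV W (dV β f) :=
  (hf.fderiv_const hW _).congr fun _ hz => hf.dV_eq hW hz β

theorem fderiv_congr_PV (hW : IsOpen W) {F G : CoordSpace n × CoordSpace n → ℝ}
    (h : ∀ z ∈ W, F z = G z) {z : CoordSpace n × CoordSpace n} (hz : z ∈ W) :
    fderiv ℝ F z = fderiv ℝ G z :=
  Filter.EventuallyEq.fderiv_eq (by filter_upwards [hW.mem_nhds hz] with y hy using h y hy)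

theorem dX_congr (hW : IsOpen W) (h : ∀ x v, (x, v) ∈ W → f x v = g x v) (hz : (x, v) ∈ W)
    (β : Fin (n + 1)) : dX β f x v = dX β g x v := by
  have : (fun y => f y v) =ᶠ[𝓝 x] fun y => g y v := by
    filter_upwards [(hW.preimage (Continuous.prodMk_left v)).mem_nhds hz] with y hy using h y v hy
  rw [dX, dX, this.fderiv_eq]

theorem dV_congr (hW : IsOpen W) (h : ∀ x v, (x, v) ∈ W → f x v = g x v) (hz : (x, v) ∈ W)
    (β : Fin (n + 1)) : dV β f x v = dV β g x v := by
  have : (fun w => f x w) =ᶠ[𝓝 v] fun w => g x w := by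
    filter_upwards [(hW.preimage (Continuous.prodMk_right x)).mem_nhds hz] with w hw using h x w hw
  rw [dV, dV, this.fderiv_eq]

/-- The second derivatives of `f` in two fixed directions commute. -/
theorem SmoothPV.second_symm (hW : IsOpen W) (hf : SmoothPV W f) {z : CoordSpace n × CoordSpace n}
    (hz : z ∈ W) (a b : CoordSpace n × CoordSpace n) :
    fderiv ℝ (fun z => fderiv ℝ (fun z : CoordSpace n × CoordSpace n => f z.1 z.2) z a) z b =
      fderiv ℝ (fun z => fderiv ℝ (fun z : CoordSpace n × CoordSpace n => f z.1 z.2) z b) z a := by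
  have hc := hf.contDiffAt (hW.mem_nhds hz)
  have hs : IsSymmSndFDerivAt ℝ (fun z : CoordSpace n × CoordSpace n => f z.1 z.2) z :=
    hc.isSymmSndFDerivAt (by simpa using WithTop.coe_le_coe.2 (le_top : (2 : ℕ∞) ≤ ⊤))
  have hd : DifferentiableAt ℝ (fderiv ℝ (fun z : CoordSpace n × CoordSpace n => f z.1 z.2)) z :=
    (hc.fderiv_right (m := 1) (by norm_cast)).differentiableAt (by simp)
  have key : ∀ a b, fderiv ℝ (fun z =>
      fderiv ℝ (fun z : CoordSpace n × CoordSpace n => f z.1 z.2) z a) z b =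
      fderiv ℝ (fderiv ℝ (fun z : CoordSpace n × CoordSpace n => f z.1 z.2)) z b a := by
    intro a b
    have := (hd.hasFDerivAt.clm_apply (hasFDerivAt_const a z)).fderiv
    rw [this]; simp
  rw [key, key, hs]

theorem SmoothPV.dX_dX (hW : IsOpen W) (hf : SmoothPV W f) (hz : (x, v) ∈ W) (α β : Fin (n + 1)) :
    LorentzFinsler.dX α (LorentzFinsler.dX β f) x v =
      LorentzFinsler.dX β (LorentzFinsler.dX α f) x v := by
  rw [(hf.dX hW β).dX_eq hW hz, (hf.dX hW α).dX_eq hW hz,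
    fderiv_congr_PV hW (fun z hz => hf.dX_eq hW (x := z.1) (v := z.2) hz β) hz,
    fderiv_congr_PV hW (fun z hz => hf.dX_eq hW (x := z.1) (v := z.2) hz α) hz]
  exact hf.second_symm hW hz _ _

theorem SmoothPV.dX_dV (hW : IsOpen W) (hf : SmoothPV W f) (hz : (x, v) ∈ W) (α β : Fin (n + 1)) :
    LorentzFinsler.dX α (LorentzFinsler.dV β f) x v =
      LorentzFinsler.dV β (LorentzFinsler.dX α f) x v := by
  rw [(hf.dV hW β).dX_eq hW hz, (hf.dX hW α).dV_eq hW hz,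
    fderiv_congr_PV hW (fun z hz => hf.dV_eq hW (x := z.1) (v := z.2) hz β) hz,
    fderiv_congr_PV hW (fun z hz => hf.dX_eq hW (x := z.1) (v := z.2) hz α) hz]
  exact hf.second_symm hW hz _ _

theorem SmoothPV.dV_dV (hW : IsOpen W) (hf : SmoothPV W f) (hz : (x, v) ∈ W) (α β : Fin (n + 1)) :
    LorentzFinsler.dV α (LorentzFinsler.dV β f) x v =
      LorentzFinsler.dV β (LorentzFinsler.dV α f) x v := by
  rw [(hf.dV hW β).dV_eq hW hz, (hf.dV hW α).dV_eq hW hz,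
    fderiv_congr_PV hW (fun z hz => hf.dV_eq hW (x := z.1) (v := z.2) hz β) hz,
    fderiv_congr_PV hW (fun z hz => hf.dV_eq hW (x := z.1) (v := z.2) hz α) hz]
  exact hf.second_symm hW hz _ _

theorem SmoothPV.mul (hf : SmoothPV W f) (hg : SmoothPV W g) :
    SmoothPV W (fun x v => f x v * g x v) := ContDiffOn.mul hf hg

theorem SmoothPV.add (hf : SmoothPV W f) (hg : SmoothPV W g) :
    SmoothPV W (fun x v => f x v + g x v) := ContDiffOn.add hf hg

theorem SmoothPV.sub (hf : SmoothPV W f) (hg : SmoothPV W g) :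
    SmoothPV W (fun x v => f x v - g x v) := ContDiffOn.sub hf hg

theorem SmoothPV.const_mul (c : ℝ) (hf : SmoothPV W f) :
    SmoothPV W (fun x v => c * f x v) := ContDiffOn.mul contDiffOn_const hf

theorem SmoothPV.sum {ι : Type*} (s : Finset ι) {F : ι → CoordSpace n → CoordSpace n → ℝ}
    (hF : ∀ i ∈ s, SmoothPV W (F i)) : SmoothPV W (fun x v => ∑ i ∈ s, F i x v) :=
  ContDiffOn.sum hF

theorem SmoothPV.prod {ι : Type*} (s : Finset ι) {F : ι → CoordSpace n → CoordSpace n → ℝ}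
    (hF : ∀ i ∈ s, SmoothPV W (F i)) : SmoothPV W (fun x v => ∏ i ∈ s, F i x v) :=
  contDiffOn_prod hF

theorem SmoothPV.inv (hf : SmoothPV W f) (h : ∀ x v, (x, v) ∈ W → f x v ≠ 0) :
    SmoothPV W (fun x v => (f x v)⁻¹) := ContDiffOn.inv hf fun z hz => h z.1 z.2 hz

theorem smoothPV_const (c : ℝ) : SmoothPV W (fun _ _ => c) := contDiffOn_const

theorem smoothPV_coord (β : Fin (n + 1)) : SmoothPV W (fun _ v => v β) := by
  have : ContDiff ℝ ∞ fun z : CoordSpace n × CoordSpace n => z.2 β :=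
    (EuclideanSpace.proj (𝕜 := ℝ) β).contDiff.comp contDiff_snd
  exact this.contDiffOn

theorem dX_mul (hW : IsOpen W) (hf : SmoothPV W f) (hg : SmoothPV W g) (hz : (x, v) ∈ W)
    (β : Fin (n + 1)) :
    dX β (fun x v => f x v * g x v) x v = dX β f x v * g x v + f x v * dX β g x v := by
  have h := (hf.hasFDerivAt_left hW hz).differentiableAt.hasFDerivAt.fun_mul
    (hg.hasFDerivAt_left hW hz).differentiableAt.hasFDerivAt
  rw [dX, h.fderiv]; simp [dX]; ring

theorem dV_mul (hW : IsOpen W) (hf : SmoothPV W f) (hg : SmoothPV W g) (hz : (x, v) ∈ W)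
    (β : Fin (n + 1)) :
    dV β (fun x v => f x v * g x v) x v = dV β f x v * g x v + f x v * dV β g x v := by
  have h := (hf.hasFDerivAt_right hW hz).differentiableAt.hasFDerivAt.fun_mul
    (hg.hasFDerivAt_right hW hz).differentiableAt.hasFDerivAt
  rw [dV, h.fderiv]; simp [dV]; ring

theorem dX_sum (hW : IsOpen W) {ι : Type*} (s : Finset ι) {F : ι → CoordSpace n → CoordSpace n → ℝ}
    (hF : ∀ i ∈ s, SmoothPV W (F i)) (hz : (x, v) ∈ W) (β : Fin (n + 1)) :
    dX β (fun x v => ∑ i ∈ s, F i x v) x v = ∑ i ∈ s, dX β (F i) x v := by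
  have h := HasFDerivAt.fun_sum fun i hi =>
    ((hF i hi).hasFDerivAt_left hW hz).differentiableAt.hasFDerivAt
  rw [dX, h.fderiv]; simp [dX]

theorem dV_sum (hW : IsOpen W) {ι : Type*} (s : Finset ι) {F : ι → CoordSpace n → CoordSpace n → ℝ}
    (hF : ∀ i ∈ s, SmoothPV W (F i)) (hz : (x, v) ∈ W) (β : Fin (n + 1)) :
    dV β (fun x v => ∑ i ∈ s, F i x v) x v = ∑ i ∈ s, dV β (F i) x v := by
  have h := HasFDerivAt.fun_sum fun i hi =>
    ((hF i hi).hasFDerivAt_right hW hz).differentiableAt.hasFDerivAt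
  rw [dV, h.fderiv]; simp [dV]

theorem dX_sub (hW : IsOpen W) (hf : SmoothPV W f) (hg : SmoothPV W g) (hz : (x, v) ∈ W)
    (β : Fin (n + 1)) :
    dX β (fun x v => f x v - g x v) x v = dX β f x v - dX β g x v := by
  have h := (hf.hasFDerivAt_left hW hz).differentiableAt.hasFDerivAt.fun_sub
    (hg.hasFDerivAt_left hW hz).differentiableAt.hasFDerivAt
  rw [dX, h.fderiv]; simp [dX]

theorem dV_sub (hW : IsOpen W) (hf : SmoothPV W f) (hg : SmoothPV W g) (hz : (x, v) ∈ W)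
    (β : Fin (n + 1)) :
    dV β (fun x v => f x v - g x v) x v = dV β f x v - dV β g x v := by
  have h := (hf.hasFDerivAt_right hW hz).differentiableAt.hasFDerivAt.fun_sub
    (hg.hasFDerivAt_right hW hz).differentiableAt.hasFDerivAt
  rw [dV, h.fderiv]; simp [dV]

theorem dX_const_mul (c : ℝ) (hW : IsOpen W) (hf : SmoothPV W f) (hz : (x, v) ∈ W)
    (β : Fin (n + 1)) : dX β (fun x v => c * f x v) x v = c * dX β f x v := by
  have h := (hf.hasFDerivAt_left hW hz).differentiableAt.hasFDerivAt.const_mul c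
  rw [dX, h.fderiv]; simp [dX]

theorem dV_const_mul (c : ℝ) (hW : IsOpen W) (hf : SmoothPV W f) (hz : (x, v) ∈ W)
    (β : Fin (n + 1)) : dV β (fun x v => c * f x v) x v = c * dV β f x v := by
  have h := (hf.hasFDerivAt_right hW hz).differentiableAt.hasFDerivAt.const_mul c
  rw [dV, h.fderiv]; simp [dV]

theorem dX_coord (α β : Fin (n + 1)) : dX α (fun _ v => v β) x v = 0 := by
  simp [dX]

theorem dV_coord (α β : Fin (n + 1)) :
    dV α (fun _ v : CoordSpace n => v β) x v = if β = α then 1 else 0 := by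
  have h : HasFDerivAt (fun w : CoordSpace n => w β) (EuclideanSpace.proj (𝕜 := ℝ) β) v :=
    (EuclideanSpace.proj (𝕜 := ℝ) β).hasFDerivAt
  rw [dV, h.fderiv]
  simp [coordBasis]

theorem dV_sum_coord_mul (hW : IsOpen W) {F : Fin (n + 1) → CoordSpace n → CoordSpace n → ℝ}
    (hF : ∀ i, SmoothPV W (F i)) (hz : (x, v) ∈ W) (α : Fin (n + 1)) :
    dV α (fun x v => ∑ β, F β x v * v β) x v = F α x v + ∑ β, dV α (F β) x v * v β := by
  rw [dV_sum hW _ (fun i _ => (hF i).mul (smoothPV_coord i)) hz]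
  simp_rw [dV_mul hW (hF _) (smoothPV_coord _) hz, dV_coord]
  rw [Finset.sum_add_distrib, add_comm]
  simp

theorem dX_sum_coord_mul (hW : IsOpen W) {F : Fin (n + 1) → CoordSpace n → CoordSpace n → ℝ}
    (hF : ∀ i, SmoothPV W (F i)) (hz : (x, v) ∈ W) (α : Fin (n + 1)) :
    dX α (fun x v => ∑ β, F β x v * v β) x v = ∑ β, dX α (F β) x v * v β := by
  rw [dX_sum hW _ (fun i _ => (hF i).mul (smoothPV_coord i)) hz]
  simp_rw [dX_mul hW (hF _) (smoothPV_coord _) hz, dX_coord]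
  simp

theorem sum_smul_coordBasis (u : CoordSpace n) : ∑ β, u β • coordBasis β = u := by
  ext α
  simp [coordBasis, Pi.single_apply]

theorem SmoothPV.fderiv_apply (hW : IsOpen W) (hf : SmoothPV W f) (hz : (x, v) ∈ W)
    (a b : CoordSpace n) :
    fderiv ℝ (fun z : CoordSpace n × CoordSpace n => f z.1 z.2) (x, v) (a, b) =
      ∑ β, LorentzFinsler.dX β f x v * a β + ∑ β, LorentzFinsler.dV β f x v * b β := by
  have h : ((a, b) : CoordSpace n × CoordSpace n) =
      ∑ β, a β • ((coordBasis β, 0) : CoordSpace n × CoordSpace n) +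
      ∑ β, b β • ((0, coordBasis β) : CoordSpace n × CoordSpace n) := by
    refine Prod.ext ?_ ?_
    · simp [Prod.fst_sum, sum_smul_coordBasis]
    · simp [Prod.snd_sum, sum_smul_coordBasis]
  rw [h, map_add, map_sum, map_sum]
  simp_rw [map_smul, hf.dX_eq hW hz, hf.dV_eq hW hz, smul_eq_mul, mul_comm]

/-- The chain rule along a curve. -/
theorem SmoothPV.hasDerivAt_comp (hW : IsOpen W) (hf : SmoothPV W f) {ξ ζ : ℝ → CoordSpace n}
    {ξ' ζ' : CoordSpace n} {t : ℝ} (hz : (ξ t, ζ t) ∈ W) (hξ : HasDerivAt ξ ξ' t)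
    (hζ : HasDerivAt ζ ζ' t) :
    HasDerivAt (fun s => f (ξ s) (ζ s))
      (∑ β, LorentzFinsler.dX β f (ξ t) (ζ t) * ξ' β +
        ∑ β, LorentzFinsler.dV β f (ξ t) (ζ t) * ζ' β) t := by
  rw [← hf.fderiv_apply hW hz]
  exact (hf.differentiableAt hW hz).hasFDerivAt.comp_hasDerivAt t (hξ.prodMk hζ)

end LorentzFinsler

/-! ### Identities between the metric, the spray and the connection in a chart -/

namespace LorentzFinsler

open Set

variable {n : ℕ} {M : Type*} [TopologicalSpace M] [ChartedSpace (CoordSpace n) M]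
  [IsManifold (𝓡 (n + 1)) ∞ M] {L : TangentBundle (𝓡 (n + 1)) M → ℝ} {p : M}
  {W : Set (CoordSpace n × CoordSpace n)} {x v : CoordSpace n}

/-- On the open set `W` of pairs `(x, v)`, the coordinate expression of `L` is smooth, satisfies
Euler's identity for functions that are homogeneous of degree two, and is non-degenerate. -/
structure IsFinslerOn (L : TangentBundle (𝓡 (n + 1)) M → ℝ) (p : M)
    (W : Set (CoordSpace n × CoordSpace n)) : Prop where
  isOpen : IsOpen W
  smooth : SmoothPV W (localL L p)
  euler : ∀ x v, (x, v) ∈ W → ∑ β, dV β (localL L p) x v * v β = 2 * localL L p x v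
  det_ne_zero : ∀ x v, (x, v) ∈ W → (gMatrix L p x v).det ≠ 0

/-- The mixed derivative `∂²L / ∂v^α ∂x^β`. -/
noncomputable def mixedHess (L : TangentBundle (𝓡 (n + 1)) M → ℝ) (p : M) (α β : Fin (n + 1)) :
    CoordSpace n → CoordSpace n → ℝ :=
  dV α (dX β (localL L p))

/-- The derivative of a function `f(x, v)` along the geodesic spray, i.e. along the solutions of
`x' = v`, `v' = -2 G(x, v)`. -/
noncomputable def sprayDeriv (L : TangentBundle (𝓡 (n + 1)) M → ℝ) (p : M)
    (f : CoordSpace n → CoordSpace n → ℝ) (x v : CoordSpace n) : ℝ :=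
  ∑ β, dX β f x v * v β - 2 * ∑ δ, dV δ f x v * sprayCoeff L p δ x v

theorem SmoothPV.det {m : ℕ} {A : Fin m → Fin m → CoordSpace n → CoordSpace n → ℝ}
    (hA : ∀ i j, SmoothPV W (A i j)) :
    SmoothPV W (fun x v => (Matrix.of fun i j => A i j x v).det) := by
  simp_rw [Matrix.det_apply']
  exact SmoothPV.sum _ fun σ _ => (SmoothPV.prod _ fun i _ => hA _ _).const_mul _

namespace IsFinslerOn

variable (h : IsFinslerOn L p W)
include h

theorem smooth_gLow (α β : Fin (n + 1)) : SmoothPV W (gLow L p α β) :=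
  (h.smooth.dV h.isOpen β).dV h.isOpen α

theorem smooth_mixedHess (α β : Fin (n + 1)) : SmoothPV W (mixedHess L p α β) :=
  (h.smooth.dX h.isOpen β).dV h.isOpen α

theorem smooth_gUp (α β : Fin (n + 1)) : SmoothPV W (gUp L p α β) := by
  have hdet : SmoothPV W (fun x v => (gMatrix L p x v).det) := SmoothPV.det h.smooth_gLow
  have hadj : SmoothPV W (fun x v => (gMatrix L p x v).adjugate α β) := by
    simp_rw [Matrix.adjugate_apply]
    refine SmoothPV.det (A := fun i j x v => (gMatrix L p x v).updateRow β (Pi.single α 1) i j)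
      fun i j => ?_
    by_cases hi : i = β
    · subst hi
      simp_rw [Matrix.updateRow_self]
      exact smoothPV_const _
    · simp_rw [Matrix.updateRow_ne hi]
      exact h.smooth_gLow i j
  refine ((hdet.inv h.det_ne_zero).mul hadj).congr fun z hz => ?_
  simp [gUp, Matrix.inv_def, Ring.inverse_eq_inv']

theorem smooth_christoffelTilde (α β γ : Fin (n + 1)) :
    SmoothPV W (christoffelTilde L p α β γ) :=
  (SmoothPV.sum _ fun δ _ => (h.smooth_gUp α δ).mul
    ((((h.smooth_gLow δ γ).dX h.isOpen β).add ((h.smooth_gLow β δ).dX h.isOpen γ)).sub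
      ((h.smooth_gLow β γ).dX h.isOpen δ))).const_mul _

theorem smooth_sprayCoeff (α : Fin (n + 1)) : SmoothPV W (sprayCoeff L p α) :=
  (SmoothPV.sum _ fun β _ => SmoothPV.sum _ fun γ _ =>
    ((h.smooth_christoffelTilde α β γ).mul (smoothPV_coord β)).mul (smoothPV_coord γ)).const_mul _

theorem smooth_nonlinConn (α β : Fin (n + 1)) : SmoothPV W (nonlinConn L p α β) :=
  (h.smooth_sprayCoeff α).dV h.isOpen β

theorem gLow_symm (hz : (x, v) ∈ W) (α β : Fin (n + 1)) :
    gLow L p α β x v = gLow L p β α x v := h.smooth.dV_dV h.isOpen hz α β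

theorem sum_gLow_mul_gUp (hz : (x, v) ∈ W) (c : Fin (n + 1) → ℝ) (α : Fin (n + 1)) :
    ∑ δ, gLow L p α δ x v * ∑ κ, gUp L p δ κ x v * c κ = c α := by
  have h1 : gMatrix L p x v * (gMatrix L p x v)⁻¹ = 1 :=
    Matrix.mul_nonsing_inv _ (isUnit_iff_ne_zero.2 (h.det_ne_zero x v hz))
  have h2 : (gMatrix L p x v).mulVec ((gMatrix L p x v)⁻¹.mulVec c) = c := by
    rw [Matrix.mulVec_mulVec, h1, Matrix.one_mulVec]
  exact congrFun h2 α

/-- Nondegeneracy of the metric. -/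
theorem gLow_cancel (hz : (x, v) ∈ W) {b c : Fin (n + 1) → ℝ}
    (hbc : ∀ α, ∑ δ, gLow L p α δ x v * b δ = ∑ δ, gLow L p α δ x v * c δ) : b = c := by
  have h1 : (gMatrix L p x v)⁻¹ * gMatrix L p x v = 1 :=
    Matrix.nonsing_inv_mul _ (isUnit_iff_ne_zero.2 (h.det_ne_zero x v hz))
  have h2 : (gMatrix L p x v).mulVec b = (gMatrix L p x v).mulVec c := funext hbc
  have h3 := congrArg ((gMatrix L p x v)⁻¹.mulVec) h2
  rwa [Matrix.mulVec_mulVec, Matrix.mulVec_mulVec, h1, Matrix.one_mulVec, Matrix.one_mulVec] at h3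

theorem sum_gLow_mul_coord (hz : (x, v) ∈ W) (α : Fin (n + 1)) :
    ∑ β, gLow L p α β x v * v β = dV α (localL L p) x v := by
  have h1 := dV_congr h.isOpen h.euler hz α
  rw [dV_sum_coord_mul h.isOpen (fun β => h.smooth.dV h.isOpen β) hz,
    dV_const_mul 2 h.isOpen h.smooth hz] at h1
  change dV α (localL L p) x v + ∑ β, gLow L p α β x v * v β = _ at h1
  linarith

theorem sum_mixedHess_mul_coord (hz : (x, v) ∈ W) (α : Fin (n + 1)) :
    ∑ β, mixedHess L p β α x v * v β = 2 * dX α (localL L p) x v := by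
  have h1 := dX_congr h.isOpen h.euler hz α
  rw [dX_sum_coord_mul h.isOpen (fun β => h.smooth.dV h.isOpen β) hz,
    dX_const_mul 2 h.isOpen h.smooth hz] at h1
  rw [← h1]
  exact Finset.sum_congr rfl fun β _ => by rw [h.smooth.dX_dV h.isOpen hz]; rfl

theorem sum_dX_gLow_mul_coord (hz : (x, v) ∈ W) (γ α : Fin (n + 1)) :
    ∑ β, dX γ (gLow L p α β) x v * v β = mixedHess L p α γ x v := by
  have h1 := dX_congr h.isOpen (fun x v hz => h.sum_gLow_mul_coord (x := x) (v := v) hz α) hz γ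
  rw [dX_sum_coord_mul h.isOpen (fun β => h.smooth_gLow α β) hz] at h1
  rw [h1, h.smooth.dX_dV h.isOpen hz]; rfl

theorem dX_gLow_symm (hz : (x, v) ∈ W) (γ α β : Fin (n + 1)) :
    dX γ (gLow L p α β) x v = dX γ (gLow L p β α) x v :=
  dX_congr h.isOpen (fun _ _ hz => h.gLow_symm hz α β) hz γ

theorem dV_gLow_symm (hz : (x, v) ∈ W) (γ α β : Fin (n + 1)) :
    dV γ (gLow L p α β) x v = dV γ (gLow L p β α) x v :=
  dV_congr h.isOpen (fun _ _ hz => h.gLow_symm hz α β) hz γ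

theorem dV_gLow_left (hz : (x, v) ∈ W) (γ α β : Fin (n + 1)) :
    dV γ (gLow L p α β) x v = dV α (gLow L p γ β) x v :=
  (h.smooth.dV h.isOpen β).dV_dV h.isOpen hz γ α

theorem sum_dV_gLow_mul_coord (hz : (x, v) ∈ W) (μ α : Fin (n + 1)) :
    ∑ β, dV μ (gLow L p α β) x v * v β = 0 := by
  have h1 := dV_congr h.isOpen (fun x v hz => h.sum_gLow_mul_coord (x := x) (v := v) hz α) hz μ
  rw [dV_sum_coord_mul h.isOpen (fun β => h.smooth_gLow α β) hz, h.gLow_symm hz] at h1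
  change _ = gLow L p μ α x v at h1
  linarith

theorem dV_mixedHess (hz : (x, v) ∈ W) (γ α β : Fin (n + 1)) :
    dV γ (mixedHess L p α β) x v = dX β (gLow L p α γ) x v := by
  have h1 : dV γ (mixedHess L p α β) x v = dV γ (dX β (dV α (localL L p))) x v :=
    dV_congr h.isOpen (fun _ _ hz => (h.smooth.dX_dV h.isOpen hz β α).symm) hz γ
  rw [h1, ← (h.smooth.dV h.isOpen α).dX_dV h.isOpen hz, h.dX_gLow_symm hz]
  rfl

theorem dX_mixedHess (hz : (x, v) ∈ W) (γ α β : Fin (n + 1)) :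
    dX γ (mixedHess L p α β) x v = dX β (mixedHess L p α γ) x v := by
  have h1 : dX γ (mixedHess L p α β) x v = dV α (dX γ (dX β (localL L p))) x v :=
    (h.smooth.dX h.isOpen β).dX_dV h.isOpen hz γ α
  have h2 : dX β (mixedHess L p α γ) x v = dV α (dX β (dX γ (localL L p))) x v :=
    (h.smooth.dX h.isOpen γ).dX_dV h.isOpen hz β α
  rw [h1, h2]
  exact dV_congr h.isOpen (fun _ _ hz => h.smooth.dX_dX h.isOpen hz γ β) hz α

theorem sum_gLow_mul_christoffelTilde (hz : (x, v) ∈ W) (α β γ : Fin (n + 1)) :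
    ∑ δ, gLow L p α δ x v * christoffelTilde L p δ β γ x v =
      (1 / 2) * (dX β (gLow L p α γ) x v + dX γ (gLow L p β α) x v - dX α (gLow L p β γ) x v) := by
  rw [← h.sum_gLow_mul_gUp hz (fun α => (1 / 2) * (dX β (gLow L p α γ) x v +
    dX γ (gLow L p β α) x v - dX α (gLow L p β γ) x v)) α]
  refine Finset.sum_congr rfl fun δ _ => ?_
  rw [christoffelTilde, Finset.mul_sum]
  congr 1
  exact Finset.sum_congr rfl fun κ _ => by ring

/-- The spray in Euler-Lagrange form: `2 g G = L_{vx} v - L_x`. -/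
theorem sum_gLow_mul_sprayCoeff (hz : (x, v) ∈ W) (α : Fin (n + 1)) :
    ∑ δ, gLow L p α δ x v * (2 * sprayCoeff L p δ x v) =
      ∑ β, mixedHess L p α β x v * v β - dX α (localL L p) x v := by
  have h1 : ∑ δ, gLow L p α δ x v * (2 * sprayCoeff L p δ x v) =
      ∑ β, ∑ γ, (∑ δ, gLow L p α δ x v * christoffelTilde L p δ β γ x v) * v β * v γ := by
    simp_rw [sprayCoeff, Finset.sum_mul, Finset.mul_sum]
    rw [Finset.sum_comm]
    refine Finset.sum_congr rfl fun β _ => ?_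
    rw [Finset.sum_comm]
    exact Finset.sum_congr rfl fun γ _ => Finset.sum_congr rfl fun δ _ => by ring
  have h2 : ∀ β, ∑ γ, dX β (gLow L p α γ) x v * v γ = mixedHess L p α β x v := fun β =>
    h.sum_dX_gLow_mul_coord hz β α
  have h3 : ∀ γ, ∑ β, dX γ (gLow L p β α) x v * v β = mixedHess L p α γ x v := fun γ => by
    rw [← h.sum_dX_gLow_mul_coord hz γ α]
    exact Finset.sum_congr rfl fun β _ => by rw [h.dX_gLow_symm hz]
  have h4 : ∀ β, ∑ γ, dX α (gLow L p β γ) x v * v γ = mixedHess L p β α x v := fun β =>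
    h.sum_dX_gLow_mul_coord hz α β
  have e1 : ∑ β, ∑ γ, dX β (gLow L p α γ) x v * v β * v γ = ∑ β, mixedHess L p α β x v * v β :=
    Finset.sum_congr rfl fun β _ => by
      rw [← h2, Finset.sum_mul]; exact Finset.sum_congr rfl fun γ _ => by ring
  have e2 : ∑ β, ∑ γ, dX γ (gLow L p β α) x v * v β * v γ = ∑ γ, mixedHess L p α γ x v * v γ := by
    rw [Finset.sum_comm]
    exact Finset.sum_congr rfl fun γ _ => by rw [← h3, Finset.sum_mul]
  have e3 : ∑ β, ∑ γ, dX α (gLow L p β γ) x v * v β * v γ = 2 * dX α (localL L p) x v := by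
    rw [← h.sum_mixedHess_mul_coord hz]
    exact Finset.sum_congr rfl fun β _ => by
      rw [← h4, Finset.sum_mul]; exact Finset.sum_congr rfl fun γ _ => by ring
  rw [h1]
  simp_rw [h.sum_gLow_mul_christoffelTilde hz]
  have h5 : ∑ β, ∑ γ, 1 / 2 * (dX β (gLow L p α γ) x v + dX γ (gLow L p β α) x v -
      dX α (gLow L p β γ) x v) * v β * v γ = 1 / 2 * (∑ β, ∑ γ, dX β (gLow L p α γ) x v * v β * v γ
      + ∑ β, ∑ γ, dX γ (gLow L p β α) x v * v β * v γ
      - ∑ β, ∑ γ, dX α (gLow L p β γ) x v * v β * v γ) := by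
    simp_rw [← Finset.sum_add_distrib, ← Finset.sum_sub_distrib, Finset.mul_sum]
    exact Finset.sum_congr rfl fun β _ => Finset.sum_congr rfl fun γ _ => by ring
  rw [h5, e1, e2, e3]; ring

/-- `2 g N = Dg + L_{vx} - L_{xv}`, where `D` is the derivative along the spray. -/
theorem sum_gLow_mul_nonlinConn (hz : (x, v) ∈ W) (α γ : Fin (n + 1)) :
    ∑ δ, gLow L p α δ x v * (2 * nonlinConn L p δ γ x v) =
      sprayDeriv L p (gLow L p α γ) x v + mixedHess L p α γ x v - mixedHess L p γ α x v := by
  have h1 := dV_congr h.isOpen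
    (fun x v hz => h.sum_gLow_mul_sprayCoeff (x := x) (v := v) hz α) hz γ
  have hs : ∀ δ, SmoothPV W (fun x v => 2 * sprayCoeff L p δ x v) := fun δ =>
    (h.smooth_sprayCoeff δ).const_mul 2
  rw [dV_sum h.isOpen _ (fun δ _ => (h.smooth_gLow α δ).mul (hs δ)) hz,
    dV_sub h.isOpen (SmoothPV.sum _ fun β _ => (h.smooth_mixedHess α β).mul (smoothPV_coord β))
      (h.smooth.dX h.isOpen α) hz,
    dV_sum_coord_mul h.isOpen (fun β => h.smooth_mixedHess α β) hz] at h1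
  simp_rw [dV_mul h.isOpen (h.smooth_gLow _ _) (hs _) hz,
    dV_const_mul 2 h.isOpen (h.smooth_sprayCoeff _) hz, Finset.sum_add_distrib,
    h.dV_mixedHess hz] at h1
  change _ + ∑ δ, gLow L p α δ x v * (2 * nonlinConn L p δ γ x v) = _ - mixedHess L p γ α x v at h1
  have h2 : ∑ δ, dV γ (gLow L p α δ) x v * (2 * sprayCoeff L p δ x v) =
      2 * ∑ δ, dV δ (gLow L p α γ) x v * sprayCoeff L p δ x v := by
    rw [Finset.mul_sum]
    refine Finset.sum_congr rfl fun δ _ => ?_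
    rw [h.dV_gLow_left hz γ α δ, h.dV_gLow_symm hz, h.dV_gLow_left hz α δ γ]
    ring
  rw [h2] at h1
  rw [sprayDeriv]
  linarith

/-- `2 g ∂_x G = D L_{vx} - L_{xx}`, where `D` is the derivative along the spray. -/
theorem sum_gLow_mul_dX_sprayCoeff (hz : (x, v) ∈ W) (α γ : Fin (n + 1)) :
    ∑ δ, gLow L p α δ x v * (2 * dX γ (sprayCoeff L p δ) x v) =
      sprayDeriv L p (mixedHess L p α γ) x v - dX γ (dX α (localL L p)) x v := by
  have h1 := dX_congr h.isOpen
    (fun x v hz => h.sum_gLow_mul_sprayCoeff (x := x) (v := v) hz α) hz γ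
  have hs : ∀ δ, SmoothPV W (fun x v => 2 * sprayCoeff L p δ x v) := fun δ =>
    (h.smooth_sprayCoeff δ).const_mul 2
  rw [dX_sum h.isOpen _ (fun δ _ => (h.smooth_gLow α δ).mul (hs δ)) hz,
    dX_sub h.isOpen (SmoothPV.sum _ fun β _ => (h.smooth_mixedHess α β).mul (smoothPV_coord β))
      (h.smooth.dX h.isOpen α) hz,
    dX_sum_coord_mul h.isOpen (fun β => h.smooth_mixedHess α β) hz] at h1
  simp_rw [dX_mul h.isOpen (h.smooth_gLow _ _) (hs _) hz,
    dX_const_mul 2 h.isOpen (h.smooth_sprayCoeff _) hz, Finset.sum_add_distrib,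
    h.dX_mixedHess hz γ] at h1
  have h2 : ∑ δ, dX γ (gLow L p α δ) x v * (2 * sprayCoeff L p δ x v) =
      2 * ∑ δ, dV δ (mixedHess L p α γ) x v * sprayCoeff L p δ x v := by
    rw [Finset.mul_sum]
    refine Finset.sum_congr rfl fun δ _ => ?_
    rw [h.dV_mixedHess hz]
    ring
  rw [h2] at h1
  rw [sprayDeriv]
  linarith

/-- `N v = 2 G`: the spray coefficients are homogeneous of degree two in the velocity. It is derived
from `2 g N = Dg + L_{vx} - L_{xv}` and Euler's identity for `L`. -/
theorem sum_nonlinConn_mul_coord (hz : (x, v) ∈ W) (α : Fin (n + 1)) :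
    ∑ γ, nonlinConn L p α γ x v * v γ = 2 * sprayCoeff L p α x v := by
  have key := h.gLow_cancel hz (b := fun δ => 2 * ∑ γ, nonlinConn L p δ γ x v * v γ)
    (c := fun δ => 2 * (2 * sprayCoeff L p δ x v)) fun α => ?_
  · have := congrFun key α
    beta_reduce at this
    linarith
  have h1 : ∑ δ, gLow L p α δ x v * (2 * ∑ γ, nonlinConn L p δ γ x v * v γ) =
      ∑ γ, (∑ δ, gLow L p α δ x v * (2 * nonlinConn L p δ γ x v)) * v γ := by
    simp_rw [Finset.sum_mul, Finset.mul_sum]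
    rw [Finset.sum_comm]
    exact Finset.sum_congr rfl fun γ _ => Finset.sum_congr rfl fun δ _ => by ring
  have h2 : ∑ δ, gLow L p α δ x v * (2 * (2 * sprayCoeff L p δ x v)) =
      2 * ∑ δ, gLow L p α δ x v * (2 * sprayCoeff L p δ x v) := by
    rw [Finset.mul_sum]; exact Finset.sum_congr rfl fun δ _ => by ring
  have h3 : ∑ γ, sprayDeriv L p (gLow L p α γ) x v * v γ = ∑ β, mixedHess L p α β x v * v β := by
    have e1 : ∑ γ, (∑ β, dX β (gLow L p α γ) x v * v β) * v γ =
        ∑ β, mixedHess L p α β x v * v β := by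
      simp_rw [← h.sum_dX_gLow_mul_coord hz, Finset.sum_mul]
      rw [Finset.sum_comm]
      exact Finset.sum_congr rfl fun γ _ => Finset.sum_congr rfl fun δ _ => by ring
    have e2 : ∑ γ, (2 * ∑ δ, dV δ (gLow L p α γ) x v * sprayCoeff L p δ x v) * v γ = 0 := by
      have : ∑ γ, (2 * ∑ δ, dV δ (gLow L p α γ) x v * sprayCoeff L p δ x v) * v γ =
          ∑ δ, 2 * sprayCoeff L p δ x v * ∑ γ, dV δ (gLow L p α γ) x v * v γ := by
        simp_rw [Finset.mul_sum, Finset.sum_mul]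
        rw [Finset.sum_comm]
        exact Finset.sum_congr rfl fun γ _ => Finset.sum_congr rfl fun δ _ => by ring
      rw [this]
      exact Finset.sum_eq_zero fun δ _ => by rw [h.sum_dV_gLow_mul_coord hz, mul_zero]
    simp_rw [sprayDeriv, sub_mul, Finset.sum_sub_distrib]
    rw [e1, e2, sub_zero]
  rw [h1, h2, h.sum_gLow_mul_sprayCoeff hz]
  simp_rw [h.sum_gLow_mul_nonlinConn hz, sub_mul, add_mul, Finset.sum_sub_distrib,
    Finset.sum_add_distrib]
  rw [h3, h.sum_mixedHess_mul_coord hz]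
  ring

/-- The Chern connection contracted with the reference vector is the nonlinear connection. -/
theorem sum_christoffel_mul_coord (hz : (x, v) ∈ W) (α γ : Fin (n + 1)) :
    ∑ β, christoffel L p α β γ x v * v β = nonlinConn L p α γ x v := by
  have key := h.gLow_cancel hz (b := fun δ => ∑ β, christoffel L p δ β γ x v * v β)
    (c := fun δ => nonlinConn L p δ γ x v) fun α => ?_
  · exact congrFun key α
  have hc : ∀ α β, ∑ δ, gLow L p α δ x v * christoffel L p δ β γ x v =
      (1 / 2) * (dX β (gLow L p α γ) x v + dX γ (gLow L p β α) x v - dX α (gLow L p β γ) x v) -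
      (1 / 2) * ∑ μ, (dV μ (gLow L p α γ) x v * nonlinConn L p μ β x v
        + dV μ (gLow L p β α) x v * nonlinConn L p μ γ x v
        - dV μ (gLow L p β γ) x v * nonlinConn L p μ α x v) := by
    intro α β
    rw [← h.sum_gLow_mul_christoffelTilde hz, ← h.sum_gLow_mul_gUp hz
      (fun α => ∑ μ, (dV μ (gLow L p α γ) x v * nonlinConn L p μ β x v
        + dV μ (gLow L p β α) x v * nonlinConn L p μ γ x v
        - dV μ (gLow L p β γ) x v * nonlinConn L p μ α x v)) α,
      Finset.mul_sum, ← Finset.sum_sub_distrib]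
    refine Finset.sum_congr rfl fun δ _ => ?_
    rw [christoffel, mul_sub]
    congr 1
    simp_rw [Finset.mul_sum]
    exact Finset.sum_congr rfl fun κ _ => Finset.sum_congr rfl fun μ _ => by ring
  have h1 : ∑ δ, gLow L p α δ x v * ∑ β, christoffel L p δ β γ x v * v β =
      ∑ β, (∑ δ, gLow L p α δ x v * christoffel L p δ β γ x v) * v β := by
    simp_rw [Finset.sum_mul, Finset.mul_sum]
    rw [Finset.sum_comm]
    exact Finset.sum_congr rfl fun γ _ => Finset.sum_congr rfl fun δ _ => by ring
  have e1 : ∑ β, dX γ (gLow L p β α) x v * v β = mixedHess L p α γ x v := by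
    rw [← h.sum_dX_gLow_mul_coord hz]
    exact Finset.sum_congr rfl fun β _ => by rw [h.dX_gLow_symm hz]
  have e2 : ∑ β, dX α (gLow L p β γ) x v * v β = mixedHess L p γ α x v := by
    rw [← h.sum_dX_gLow_mul_coord hz]
    exact Finset.sum_congr rfl fun β _ => by rw [h.dX_gLow_symm hz]
  have e3 : ∑ β, (∑ μ, dV μ (gLow L p α γ) x v * nonlinConn L p μ β x v) * v β =
      2 * ∑ μ, dV μ (gLow L p α γ) x v * sprayCoeff L p μ x v := by
    simp_rw [Finset.sum_mul]
    rw [Finset.sum_comm, Finset.mul_sum]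
    refine Finset.sum_congr rfl fun μ _ => ?_
    have : 2 * (dV μ (gLow L p α γ) x v * sprayCoeff L p μ x v) =
        dV μ (gLow L p α γ) x v * ∑ β, nonlinConn L p μ β x v * v β := by
      rw [h.sum_nonlinConn_mul_coord hz]; ring
    rw [this, Finset.mul_sum]
    exact Finset.sum_congr rfl fun β _ => by ring
  have e4 : ∀ α γ, ∑ β, (∑ μ, dV μ (gLow L p β α) x v * nonlinConn L p μ γ x v) * v β = 0 := by
    intro α γ
    simp_rw [Finset.sum_mul]
    rw [Finset.sum_comm]
    refine Finset.sum_eq_zero fun μ _ => ?_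
    have : ∑ β, dV μ (gLow L p β α) x v * nonlinConn L p μ γ x v * v β =
        nonlinConn L p μ γ x v * ∑ β, dV μ (gLow L p α β) x v * v β := by
      rw [Finset.mul_sum]
      exact Finset.sum_congr rfl fun β _ => by rw [h.dV_gLow_symm hz]; ring
    rw [this, h.sum_dV_gLow_mul_coord hz, mul_zero]
  have h2 : ∑ β, (∑ δ, gLow L p α δ x v * christoffel L p δ β γ x v) * v β =
      (1 / 2) * (∑ β, dX β (gLow L p α γ) x v * v β + ∑ β, dX γ (gLow L p β α) x v * v β -
        ∑ β, dX α (gLow L p β γ) x v * v β) -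
      (1 / 2) * (∑ β, (∑ μ, dV μ (gLow L p α γ) x v * nonlinConn L p μ β x v) * v β +
        ∑ β, (∑ μ, dV μ (gLow L p β α) x v * nonlinConn L p μ γ x v) * v β -
        ∑ β, (∑ μ, dV μ (gLow L p β γ) x v * nonlinConn L p μ α x v) * v β) := by
    have comb : ∀ a b c A B C : Fin (n + 1) → ℝ,
        ∑ β, (1 / 2 * (a β + b β - c β) - 1 / 2 * (A β + B β - C β)) * v β =
        1 / 2 * (∑ β, a β * v β + ∑ β, b β * v β - ∑ β, c β * v β) -
        1 / 2 * (∑ β, A β * v β + ∑ β, B β * v β - ∑ β, C β * v β) := by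
      intro a b c A B C
      simp_rw [← Finset.sum_add_distrib, ← Finset.sum_sub_distrib, Finset.mul_sum,
        ← Finset.sum_sub_distrib]
      exact Finset.sum_congr rfl fun β _ => by ring
    simp_rw [hc, Finset.sum_sub_distrib, Finset.sum_add_distrib]
    exact comb _ _ _ _ _ _
  have h3 := h.sum_gLow_mul_nonlinConn hz α γ
  have h4 : ∑ δ, gLow L p α δ x v * (2 * nonlinConn L p δ γ x v) =
      2 * ∑ δ, gLow L p α δ x v * nonlinConn L p δ γ x v := by
    rw [Finset.mul_sum]; exact Finset.sum_congr rfl fun δ _ => by ring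
  rw [h4, sprayDeriv] at h3
  rw [h1, h2, e1, e2, e3, e4, e4]
  linarith

end IsFinslerOn

end LorentzFinsler

/-! ### Operators along a solution of the spray -/

namespace LorentzFinsler

open Set

variable {n : ℕ}

/-- The operator on the coordinate space with matrix `A`. -/
noncomputable def matOp (A : Fin (n + 1) → Fin (n + 1) → ℝ) : CoordSpace n →L[ℝ] CoordSpace n :=
  Matrix.toEuclideanCLM (n := Fin (n + 1)) (𝕜 := ℝ) (Matrix.of A)

theorem matOp_apply (A : Fin (n + 1) → Fin (n + 1) → ℝ) (u : CoordSpace n) (i : Fin (n + 1)) :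
    matOp A u i = ∑ j, A i j * u j := rfl

theorem matOp_mul (A B : Fin (n + 1) → Fin (n + 1) → ℝ) :
    matOp A * matOp B = matOp fun i j => ∑ k, A i k * B k j := by
  rw [matOp, matOp, ← map_mul]; rfl

theorem matOp_add (A B : Fin (n + 1) → Fin (n + 1) → ℝ) :
    matOp A + matOp B = matOp fun i j => A i j + B i j := by
  rw [matOp, matOp, ← map_add]; rfl

theorem matOp_sub (A B : Fin (n + 1) → Fin (n + 1) → ℝ) :
    matOp A - matOp B = matOp fun i j => A i j - B i j := by
  rw [matOp, matOp, ← map_sub]; rfl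

theorem matOp_smul (c : ℝ) (A : Fin (n + 1) → Fin (n + 1) → ℝ) :
    c • matOp A = matOp fun i j => c * A i j := by
  rw [matOp, ← map_smul]; rfl

theorem star_matOp (A : Fin (n + 1) → Fin (n + 1) → ℝ) :
    star (matOp A) = matOp fun i j => A j i := by
  rw [matOp, ← map_star]; rfl

theorem star_op_sub (A B : CoordSpace n →L[ℝ] CoordSpace n) : star (A - B) = star A - star B :=
  star_sub A B

theorem star_op_add (A B : CoordSpace n →L[ℝ] CoordSpace n) : star (A + B) = star A + star B :=
  star_add A B

theorem star_op_smul (c : ℝ) (A : CoordSpace n →L[ℝ] CoordSpace n) :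
    star (c • A) = c • star A := by
  rw [star_smul, star_trivial]

theorem two_smul_op (A : CoordSpace n →L[ℝ] CoordSpace n) : (2 : ℝ) • A = A + A := two_smul ℝ A

theorem isUnit_matOp {A : Fin (n + 1) → Fin (n + 1) → ℝ} (h : (Matrix.of A).det ≠ 0) :
    IsUnit (matOp A) :=
  ((Matrix.isUnit_iff_isUnit_det _).2 (isUnit_iff_ne_zero.2 h)).map
    (Matrix.toEuclideanCLM (n := Fin (n + 1)) (𝕜 := ℝ))

theorem matOp_eq_sum (A : Fin (n + 1) → Fin (n + 1) → ℝ) :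
    matOp A = ∑ i, ∑ j, A i j • matOp fun k l => (Matrix.single i j (1 : ℝ)) k l := by
  have h := Matrix.matrix_eq_sum_single (Matrix.of A)
  conv_lhs => rw [matOp, h]
  simp_rw [map_sum]
  refine Finset.sum_congr rfl fun i _ => Finset.sum_congr rfl fun j _ => ?_
  rw [matOp, ← map_smul]
  congr 1
  ext k l
  simp [Matrix.single_apply]

theorem hasDerivAt_matOp {A : ℝ → Fin (n + 1) → Fin (n + 1) → ℝ}
    {A' : Fin (n + 1) → Fin (n + 1) → ℝ} {t : ℝ}
    (h : ∀ i j, HasDerivAt (fun s => A s i j) (A' i j) t) :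
    HasDerivAt (fun s => matOp (A s)) (matOp A') t := by
  rw [matOp_eq_sum A']
  simp_rw [matOp_eq_sum (A _)]
  exact HasDerivAt.fun_sum fun i _ => HasDerivAt.fun_sum fun j _ =>
    (h i j).smul_const (matOp fun k l => (Matrix.single i j (1 : ℝ)) k l)

theorem contDiffOn_matOp {m : ℕ∞ω} {A : ℝ → Fin (n + 1) → Fin (n + 1) → ℝ} {J : Set ℝ}
    (h : ∀ i j, ContDiffOn ℝ m (fun s => A s i j) J) :
    ContDiffOn ℝ m (fun s => matOp (A s)) J := by
  simp_rw [matOp_eq_sum (A _)]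
  exact ContDiffOn.sum fun i _ => ContDiffOn.sum fun j _ => (h i j).smul contDiffOn_const

variable {M : Type*} [TopologicalSpace M] [ChartedSpace (CoordSpace n) M]
  [IsManifold (𝓡 (n + 1)) ∞ M] {L : TangentBundle (𝓡 (n + 1)) M → ℝ} {p : M}
  {W : Set (CoordSpace n × CoordSpace n)} {ξ ζ : ℝ → CoordSpace n} {J : Set ℝ} {t : ℝ}

/-- `ξ` is a solution on `J`, with velocity `ζ`, of the geodesic equation in the chart labelled
by `p`, and it stays in `W`. -/
structure IsSprayCurve (L : TangentBundle (𝓡 (n + 1)) M → ℝ) (p : M)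
    (W : Set (CoordSpace n × CoordSpace n)) (ξ ζ : ℝ → CoordSpace n) (J : Set ℝ) : Prop where
  isOpen : IsOpen J
  mem : ∀ t ∈ J, (ξ t, ζ t) ∈ W
  deriv_pos : ∀ t ∈ J, HasDerivAt ξ (ζ t) t
  deriv_vel : ∀ t ∈ J, HasDerivAt ζ
    (WithLp.toLp 2 fun α => -(2 * sprayCoeff L p α (ξ t) (ζ t))) t
  smooth : ContDiffOn ℝ ∞ ξ J

/-- The operator with matrix entries `A i j (x, v)` along a curve. -/
noncomputable def alongOp (A : Fin (n + 1) → Fin (n + 1) → CoordSpace n → CoordSpace n → ℝ)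
    (ξ ζ : ℝ → CoordSpace n) (t : ℝ) : CoordSpace n →L[ℝ] CoordSpace n :=
  matOp fun i j => A i j (ξ t) (ζ t)

section

variable (h : IsFinslerOn L p W) (hc : IsSprayCurve L p W ξ ζ J)
include h hc

theorem IsSprayCurve.hasDerivAt_comp {f : CoordSpace n → CoordSpace n → ℝ} (hf : SmoothPV W f)
    (ht : t ∈ J) :
    HasDerivAt (fun s => f (ξ s) (ζ s)) (sprayDeriv L p f (ξ t) (ζ t)) t := by
  refine (hf.hasDerivAt_comp h.isOpen (hc.mem t ht) (hc.deriv_pos t ht)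
    (hc.deriv_vel t ht)).congr_deriv ?_
  rw [sprayDeriv, Finset.mul_sum, sub_eq_add_neg, ← Finset.sum_neg_distrib]
  congr 1
  exact Finset.sum_congr rfl fun δ _ => by ring

theorem IsSprayCurve.hasDerivAt_alongOp
    {A : Fin (n + 1) → Fin (n + 1) → CoordSpace n → CoordSpace n → ℝ}
    (hA : ∀ i j, SmoothPV W (A i j)) (ht : t ∈ J) :
    HasDerivAt (alongOp A ξ ζ) (alongOp (fun i j => sprayDeriv L p (A i j)) ξ ζ t) t :=
  hasDerivAt_matOp fun i j => hc.hasDerivAt_comp h (hA i j) ht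

omit h in
theorem IsSprayCurve.smooth_vel : ContDiffOn ℝ ∞ ζ J := by
  have h1 : ContDiffOn ℝ ∞ (deriv ξ) J := hc.smooth.deriv_of_isOpen hc.isOpen (by simp)
  exact h1.congr fun t ht => (hc.deriv_pos t ht).deriv.symm

omit h in
theorem IsSprayCurve.contDiffOn_alongOp
    {A : Fin (n + 1) → Fin (n + 1) → CoordSpace n → CoordSpace n → ℝ}
    (hA : ∀ i j, SmoothPV W (A i j)) : ContDiffOn ℝ ∞ (alongOp A ξ ζ) J :=
  contDiffOn_matOp fun i j => (hA i j).comp (hc.smooth.prodMk (hc.smooth_vel)) hc.mem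

/-- The Euler-Lagrange equations. -/
theorem IsSprayCurve.hasDerivAt_dV (ht : t ∈ J) (κ : Fin (n + 1)) :
    HasDerivAt (fun s => dV κ (localL L p) (ξ s) (ζ s)) (dX κ (localL L p) (ξ t) (ζ t)) t := by
  refine (hc.hasDerivAt_comp h (h.smooth.dV h.isOpen κ) ht).congr_deriv ?_
  have hz := hc.mem t ht
  have h1 := h.sum_gLow_mul_sprayCoeff hz κ
  have h2 : ∑ β, dX β (dV κ (localL L p)) (ξ t) (ζ t) * ζ t β =
      ∑ β, mixedHess L p κ β (ξ t) (ζ t) * ζ t β :=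
    Finset.sum_congr rfl fun β _ => by rw [h.smooth.dX_dV h.isOpen hz]; rfl
  have h3 : 2 * ∑ δ, dV δ (dV κ (localL L p)) (ξ t) (ζ t) * sprayCoeff L p δ (ξ t) (ζ t) =
      ∑ δ, gLow L p κ δ (ξ t) (ζ t) * (2 * sprayCoeff L p δ (ξ t) (ζ t)) := by
    rw [Finset.mul_sum]
    refine Finset.sum_congr rfl fun δ _ => ?_
    rw [h.gLow_symm hz]
    change 2 * (gLow L p δ κ (ξ t) (ζ t) * _) = _
    ring
  rw [sprayDeriv, h2, h3, h1]
  ring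

theorem IsSprayCurve.isUnit_g (ht : t ∈ J) : IsUnit (alongOp (gLow L p) ξ ζ t) :=
  isUnit_matOp (h.det_ne_zero _ _ (hc.mem t ht))

theorem IsSprayCurve.star_g (ht : t ∈ J) :
    star (alongOp (gLow L p) ξ ζ t) = alongOp (gLow L p) ξ ζ t := by
  rw [alongOp, star_matOp]
  congr 1
  ext i j
  exact h.gLow_symm (hc.mem t ht) j i

theorem IsSprayCurve.two_g_mul_nonlinConn (ht : t ∈ J) :
    (2 : ℝ) • (alongOp (gLow L p) ξ ζ t * alongOp (nonlinConn L p) ξ ζ t) =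
      alongOp (fun i j => sprayDeriv L p (gLow L p i j)) ξ ζ t +
      alongOp (mixedHess L p) ξ ζ t - star (alongOp (mixedHess L p) ξ ζ t) := by
  simp only [alongOp, star_matOp, matOp_mul, matOp_add, matOp_sub, matOp_smul]
  congr 1
  ext i j
  rw [← h.sum_gLow_mul_nonlinConn (hc.mem t ht), Finset.mul_sum]
  exact Finset.sum_congr rfl fun k _ => by ring

theorem IsSprayCurve.star_sprayDeriv_g (ht : t ∈ J) :
    star (alongOp (fun i j => sprayDeriv L p (gLow L p i j)) ξ ζ t) =
      alongOp (fun i j => sprayDeriv L p (gLow L p i j)) ξ ζ t := by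
  have hz := hc.mem t ht
  rw [alongOp, star_matOp]
  congr 1
  ext i j
  simp only [sprayDeriv, h.dX_gLow_symm hz _ j i, h.dV_gLow_symm hz _ j i]

/-- The metric is parallel along geodesics. -/
theorem IsSprayCurve.hasDerivAt_g (ht : t ∈ J) :
    HasDerivAt (alongOp (gLow L p) ξ ζ)
      (alongOp (gLow L p) ξ ζ t * alongOp (nonlinConn L p) ξ ζ t +
        star (alongOp (nonlinConn L p) ξ ζ t) * alongOp (gLow L p) ξ ζ t) t := by
  refine (hc.hasDerivAt_alongOp h h.smooth_gLow ht).congr_deriv ?_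
  have h1 := hc.two_g_mul_nonlinConn h ht
  have h2 := congrArg star h1
  rw [star_op_sub, star_op_add, star_star, star_op_smul, star_mul, hc.star_g h ht,
    hc.star_sprayDeriv_g h ht] at h2
  have h3 : (2 : ℝ) • alongOp (fun i j => sprayDeriv L p (gLow L p i j)) ξ ζ t =
      (2 : ℝ) • (alongOp (gLow L p) ξ ζ t * alongOp (nonlinConn L p) ξ ζ t +
        star (alongOp (nonlinConn L p) ξ ζ t) * alongOp (gLow L p) ξ ζ t) := by
    rw [smul_add, h1, h2, two_smul_op]; abel
  exact (smul_right_injective _ (two_ne_zero : (2 : ℝ) ≠ 0)) h3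

/-- The symmetric part `L_{vx} - g N` of the mixed second derivatives of `L`. -/
noncomputable def _root_.LorentzFinsler.symmHess (L : TangentBundle (𝓡 (n + 1)) M → ℝ) (p : M)
    (ξ ζ : ℝ → CoordSpace n) (t : ℝ) : CoordSpace n →L[ℝ] CoordSpace n :=
  alongOp (mixedHess L p) ξ ζ t - alongOp (gLow L p) ξ ζ t * alongOp (nonlinConn L p) ξ ζ t

theorem IsSprayCurve.star_symmHess (ht : t ∈ J) :
    star (symmHess L p ξ ζ t) = symmHess L p ξ ζ t := by
  have h1 := hc.two_g_mul_nonlinConn h ht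
  have h2 := congrArg star h1
  rw [star_op_sub, star_op_add, star_star, star_op_smul, hc.star_sprayDeriv_g h ht] at h2
  have h3 : (2 : ℝ) • star (symmHess L p ξ ζ t) = (2 : ℝ) • symmHess L p ξ ζ t := by
    rw [symmHess, star_op_sub, smul_sub, smul_sub, h1, h2, two_smul_op, two_smul_op]; abel
  exact (smul_right_injective _ (two_ne_zero : (2 : ℝ) ≠ 0)) h3

/-- The curvature in terms of the second derivatives of `L`, i.e. of the second variation. -/
theorem IsSprayCurve.hasDerivAt_symmHess (ht : t ∈ J) :
    HasDerivAt (symmHess L p ξ ζ)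
      (alongOp (gLow L p) ξ ζ t * alongOp (curvCoeff L p) ξ ζ t
        - star (alongOp (nonlinConn L p) ξ ζ t) *
          (alongOp (gLow L p) ξ ζ t * alongOp (nonlinConn L p) ξ ζ t)
        + alongOp (fun i j => dX i (dX j (localL L p))) ξ ζ t) t := by
  have hz := hc.mem t ht
  refine ((hc.hasDerivAt_alongOp h h.smooth_mixedHess ht).sub ((hc.hasDerivAt_g h ht).mul
    (hc.hasDerivAt_alongOp h h.smooth_nonlinConn ht))).congr_deriv ?_
  have hR : alongOp (curvCoeff L p) ξ ζ t =
      alongOp (fun i j x v => 2 * dX j (sprayCoeff L p i) x v) ξ ζ t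
      - alongOp (fun i j => sprayDeriv L p (nonlinConn L p i j)) ξ ζ t
      - alongOp (nonlinConn L p) ξ ζ t * alongOp (nonlinConn L p) ξ ζ t := by
    simp only [alongOp, matOp_mul, matOp_sub]
    congr 1
    ext i j
    rw [curvCoeff, sprayDeriv, Finset.sum_sub_distrib, Finset.mul_sum]
    congr 3
    exact Finset.sum_congr rfl fun k _ => by ring
  have hG : alongOp (gLow L p) ξ ζ t * alongOp (fun i j x v => 2 * dX j (sprayCoeff L p i) x v) ξ ζ t
      = alongOp (fun i j => sprayDeriv L p (mixedHess L p i j)) ξ ζ t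
        - alongOp (fun i j => dX i (dX j (localL L p))) ξ ζ t := by
    simp only [alongOp, matOp_mul, matOp_sub]
    congr 1
    ext i j
    rw [h.sum_gLow_mul_dX_sprayCoeff hz, h.smooth.dX_dX h.isOpen hz]
  rw [hR, mul_sub, mul_sub, hG]
  noncomm_ring

/-- The curvature endomorphism is symmetric. -/
theorem IsSprayCurve.star_g_mul_curv (ht : t ∈ J) :
    star (alongOp (gLow L p) ξ ζ t * alongOp (curvCoeff L p) ξ ζ t) =
      alongOp (gLow L p) ξ ζ t * alongOp (curvCoeff L p) ξ ζ t := by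
  have h1 := hc.hasDerivAt_symmHess h ht
  have h2 : HasDerivAt (symmHess L p ξ ζ) _ t := h1.star.congr_of_eventuallyEq (by
    filter_upwards [hc.isOpen.mem_nhds ht] with s hs using (hc.star_symmHess h hs).symm)
  have h3 := h2.unique h1
  have hH : star (alongOp (fun i j => dX i (dX j (localL L p))) ξ ζ t) =
      alongOp (fun i j => dX i (dX j (localL L p))) ξ ζ t := by
    rw [alongOp, star_matOp]
    congr 1
    ext i j
    exact h.smooth.dX_dX h.isOpen (hc.mem t ht) j i
  rw [star_op_add, star_op_sub, hH] at h3
  have h4 : star (star (alongOp (nonlinConn L p) ξ ζ t) *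
      (alongOp (gLow L p) ξ ζ t * alongOp (nonlinConn L p) ξ ζ t)) =
      star (alongOp (nonlinConn L p) ξ ζ t) *
      (alongOp (gLow L p) ξ ζ t * alongOp (nonlinConn L p) ξ ζ t) := by
    rw [star_mul, star_mul, star_star, hc.star_g h ht, mul_assoc]
  rw [h4] at h3
  exact sub_left_injective (add_left_injective _ h3)

/-- The velocity of a geodesic is parallel. -/
theorem IsSprayCurve.hasDerivAt_vel (ht : t ∈ J) :
    HasDerivAt ζ (-(alongOp (nonlinConn L p) ξ ζ t (ζ t))) t := by
  refine (hc.deriv_vel t ht).congr_deriv ?_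
  ext α
  rw [PiLp.neg_apply, alongOp, matOp_apply, h.sum_nonlinConn_mul_coord (hc.mem t ht)]

end

end LorentzFinsler

/-! ### Change of coordinates -/

namespace LorentzFinsler

open Set

variable {n : ℕ}

theorem hasDerivAt_toLp {P : ℝ → Fin (n + 1) → ℝ} {P' : Fin (n + 1) → ℝ} {t : ℝ}
    (h : ∀ κ, HasDerivAt (fun s => P s κ) (P' κ) t) :
    HasDerivAt (fun s => (WithLp.toLp 2 (P s) : CoordSpace n)) (WithLp.toLp 2 P') t :=
  (PiLp.continuousLinearEquiv 2 ℝ (fun _ : Fin (n + 1) => ℝ)).symm.hasFDerivAt.comp_hasDerivAt t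
    (hasDerivAt_pi.2 h)

variable {W Wq : Set (CoordSpace n × CoordSpace n)} {x v : CoordSpace n}

theorem SmoothPV.hasDerivAt_line_left (hW : IsOpen W) {f : CoordSpace n → CoordSpace n → ℝ}
    (hf : SmoothPV W f) (hz : (x, v) ∈ W) (i : Fin (n + 1)) :
    HasDerivAt (fun s : ℝ => f (x + s • coordBasis i) v) (LorentzFinsler.dX i f x v) 0 := by
  have h1 : HasDerivAt (fun s : ℝ => x + s • (coordBasis i : CoordSpace n)) (coordBasis i) 0 := by
    simpa using ((hasDerivAt_id (0 : ℝ)).smul_const (coordBasis i : CoordSpace n)).const_add x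
  have h2 := (hf.hasFDerivAt_left hW hz).differentiableAt.hasFDerivAt
  have h3 : HasFDerivAt (fun y => f y v) (fderiv ℝ (fun y => f y v) x)
      (x + (0 : ℝ) • (coordBasis i : CoordSpace n)) := by simpa using h2
  exact h3.comp_hasDerivAt 0 h1

theorem SmoothPV.hasDerivAt_line_right (hW : IsOpen W) {f : CoordSpace n → CoordSpace n → ℝ}
    (hf : SmoothPV W f) (hz : (x, v) ∈ W) (i : Fin (n + 1)) :
    HasDerivAt (fun s : ℝ => f x (v + s • coordBasis i)) (LorentzFinsler.dV i f x v) 0 := by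
  have h1 : HasDerivAt (fun s : ℝ => v + s • (coordBasis i : CoordSpace n)) (coordBasis i) 0 := by
    simpa using ((hasDerivAt_id (0 : ℝ)).smul_const (coordBasis i : CoordSpace n)).const_add v
  have h2 := (hf.hasFDerivAt_right hW hz).differentiableAt.hasFDerivAt
  have h3 : HasFDerivAt (fun w => f x w) (fderiv ℝ (fun w => f x w) v)
      (v + (0 : ℝ) • (coordBasis i : CoordSpace n)) := by simpa using h2
  exact h3.comp_hasDerivAt 0 h1

/-- The components of a map `φ`, as functions of `(x, v)`. -/
def posC (φ : CoordSpace n → CoordSpace n) (κ : Fin (n + 1)) (x _v : CoordSpace n) : ℝ := φ x κ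

/-- The Jacobian matrix `∂φ^κ / ∂x^j`. -/
noncomputable def jacC (φ : CoordSpace n → CoordSpace n) (κ j : Fin (n + 1)) :
    CoordSpace n → CoordSpace n → ℝ := dX j (posC φ κ)

/-- The components of the image `dφ_x(v)` of a vector. -/
noncomputable def velC (φ : CoordSpace n → CoordSpace n) (κ : Fin (n + 1)) (x v : CoordSpace n) :
    ℝ := ∑ l, jacC φ κ l x v * v l

/-- The function `F(φ(x), dφ_x(v))`. -/
noncomputable def pullC (φ : CoordSpace n → CoordSpace n) (F : CoordSpace n → CoordSpace n → ℝ)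
    (x v : CoordSpace n) : ℝ :=
  F (φ x) (WithLp.toLp 2 fun κ => velC φ κ x v)

/-- The derivative `∂(dφ_x(v))^κ / ∂x^j`, i.e. the second derivative of `φ` in the directions
`∂/∂x^j` and `v`. -/
noncomputable def hessC (φ : CoordSpace n → CoordSpace n) (κ j : Fin (n + 1)) (x v : CoordSpace n) :
    ℝ := ∑ l, dX j (jacC φ κ l) x v * v l

/-- The lifted map `(x, v) ↦ (φ(x), dφ_x(v))` is smooth on `W` and maps it into `Wq`. -/
structure IsLift (φ : CoordSpace n → CoordSpace n) (W Wq : Set (CoordSpace n × CoordSpace n)) :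
    Prop where
  smooth : ∀ κ, SmoothPV W (posC φ κ)
  maps : ∀ x v, (x, v) ∈ W → (φ x, WithLp.toLp 2 fun κ => velC φ κ x v) ∈ Wq

theorem dV_jacC (φ : CoordSpace n → CoordSpace n) (i κ j : Fin (n + 1)) :
    dV i (jacC φ κ j) x v = 0 := by simp [dV, jacC, dX, posC]

theorem dV_dX_jacC (φ : CoordSpace n → CoordSpace n) (i l κ j : Fin (n + 1)) :
    dV i (dX l (jacC φ κ j)) x v = 0 := by simp [dV, jacC, dX, posC]

theorem dV_posC (φ : CoordSpace n → CoordSpace n) (i κ : Fin (n + 1)) :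
    dV i (posC φ κ) x v = 0 := by simp [dV, posC]

section

variable {φ : CoordSpace n → CoordSpace n} (hφ : IsLift φ W Wq) (hW : IsOpen W)
include hφ hW

theorem IsLift.smooth_jacC (κ j : Fin (n + 1)) : SmoothPV W (jacC φ κ j) :=
  (hφ.smooth κ).dX hW j

theorem IsLift.smooth_velC (κ : Fin (n + 1)) : SmoothPV W (velC φ κ) :=
  SmoothPV.sum _ fun l _ => (hφ.smooth_jacC hW κ l).mul (smoothPV_coord l)

theorem IsLift.smooth_hessC (κ j : Fin (n + 1)) : SmoothPV W (hessC φ κ j) :=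
  SmoothPV.sum _ fun l _ => ((hφ.smooth_jacC hW κ l).dX hW j).mul (smoothPV_coord l)

theorem IsLift.dV_velC (hz : (x, v) ∈ W) (i κ : Fin (n + 1)) :
    dV i (velC φ κ) x v = jacC φ κ i x v := by
  refine (dV_sum_coord_mul hW (fun l => hφ.smooth_jacC hW κ l) hz i).trans ?_
  simp [dV_jacC]

theorem IsLift.dX_velC (hz : (x, v) ∈ W) (i κ : Fin (n + 1)) :
    dX i (velC φ κ) x v = hessC φ κ i x v :=
  dX_sum_coord_mul hW (fun l => hφ.smooth_jacC hW κ l) hz i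

theorem IsLift.dV_hessC (hz : (x, v) ∈ W) (i κ j : Fin (n + 1)) :
    dV i (hessC φ κ j) x v = dX j (jacC φ κ i) x v := by
  refine (dV_sum_coord_mul hW (fun l => (hφ.smooth_jacC hW κ l).dX hW j) hz i).trans ?_
  simp [dV_dX_jacC]

theorem IsLift.dX_jacC (hz : (x, v) ∈ W) (i κ j : Fin (n + 1)) :
    dX i (jacC φ κ j) x v = dX j (jacC φ κ i) x v :=
  (hφ.smooth κ).dX_dX hW hz i j

theorem IsLift.hessC_eq (hz : (x, v) ∈ W) (κ j : Fin (n + 1)) :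
    hessC φ κ j x v = ∑ l, dX l (jacC φ κ j) x v * v l :=
  Finset.sum_congr rfl fun l _ => by rw [hφ.dX_jacC hW hz]

theorem IsLift.dX_hessC (hz : (x, v) ∈ W) (i κ j : Fin (n + 1)) :
    dX i (hessC φ κ j) x v = ∑ l, dX l (dX j (jacC φ κ i)) x v * v l := by
  have := dX_sum_coord_mul hW (fun l => (hφ.smooth_jacC hW κ l).dX hW j) hz i
  refine this.trans (Finset.sum_congr rfl fun l _ => ?_)
  rw [dX_congr hW (fun x v hz => hφ.dX_jacC hW hz j κ l) hz i,
    (hφ.smooth_jacC hW κ j).dX_dX hW hz i l,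
    dX_congr hW (fun x v hz => hφ.dX_jacC hW hz i κ j) hz l]

theorem IsLift.smooth_pullC {F : CoordSpace n → CoordSpace n → ℝ}
    (hF : SmoothPV Wq F) : SmoothPV W (pullC φ F) := by
  have h1 : ContDiffOn ℝ ∞ (fun z : CoordSpace n × CoordSpace n => φ z.1) W :=
    contDiffOn_euclidean.2 hφ.smooth
  have h2 : ContDiffOn ℝ ∞ (fun z : CoordSpace n × CoordSpace n =>
      (WithLp.toLp 2 fun κ => velC φ κ z.1 z.2 : CoordSpace n)) W :=
    contDiffOn_euclidean.2 fun κ => hφ.smooth_velC hW κ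
  exact hF.comp (h1.prodMk h2) fun z hz => hφ.maps z.1 z.2 hz

/-- The chain rule for `F(φ(x), dφ_x(v))` in the position. -/
theorem IsLift.dX_pullC (hWq : IsOpen Wq) {F : CoordSpace n → CoordSpace n → ℝ}
    (hF : SmoothPV Wq F) (hz : (x, v) ∈ W) (i : Fin (n + 1)) :
    dX i (pullC φ F) x v = ∑ κ, pullC φ (dX κ F) x v * jacC φ κ i x v +
      ∑ κ, pullC φ (dV κ F) x v * hessC φ κ i x v := by
  refine ((hφ.smooth_pullC hW hF).hasDerivAt_line_left hW hz i).unique ?_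
  have h1 : HasDerivAt (fun s : ℝ => φ (x + s • coordBasis i))
      (WithLp.toLp 2 fun κ => jacC φ κ i x v) 0 :=
    hasDerivAt_toLp fun κ => (hφ.smooth κ).hasDerivAt_line_left hW hz i
  have h2 : HasDerivAt (fun s : ℝ => (WithLp.toLp 2 fun κ => velC φ κ (x + s • coordBasis i) v :
      CoordSpace n)) (WithLp.toLp 2 fun κ => hessC φ κ i x v) 0 :=
    hasDerivAt_toLp fun κ => by
      rw [← hφ.dX_velC hW hz]
      exact (hφ.smooth_velC hW κ).hasDerivAt_line_left hW hz i
  have h3 := hF.hasDerivAt_comp hWq (by simpa using hφ.maps x v hz) h1 h2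
  simpa [pullC] using h3

theorem IsLift.dV_pullC (hWq : IsOpen Wq) {F : CoordSpace n → CoordSpace n → ℝ}
    (hF : SmoothPV Wq F) (hz : (x, v) ∈ W) (i : Fin (n + 1)) :
    dV i (pullC φ F) x v = ∑ κ, pullC φ (dV κ F) x v * jacC φ κ i x v := by
  refine ((hφ.smooth_pullC hW hF).hasDerivAt_line_right hW hz i).unique ?_
  have h2 : HasDerivAt (fun s : ℝ => (WithLp.toLp 2 fun κ => velC φ κ x (v + s • coordBasis i) :
      CoordSpace n)) (WithLp.toLp 2 fun κ => jacC φ κ i x v) 0 :=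
    hasDerivAt_toLp fun κ => by
      rw [← hφ.dV_velC hW hz]
      exact (hφ.smooth_velC hW κ).hasDerivAt_line_right hW hz i
  have h3 := hF.hasDerivAt_comp hWq (by simpa using hφ.maps x v hz)
    (hasDerivAt_const (0 : ℝ) (φ x)) h2
  simpa [pullC] using h3

/-- Second derivatives of `F(φ(x), dφ_x(v))`. -/
theorem IsLift.dV_dV_pullC (hWq : IsOpen Wq) {F : CoordSpace n → CoordSpace n → ℝ}
    (hF : SmoothPV Wq F) (hz : (x, v) ∈ W) (i j : Fin (n + 1)) :
    dV i (dV j (pullC φ F)) x v = ∑ κ, (∑ l, jacC φ l i x v * pullC φ (dV l (dV κ F)) x v) *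
      jacC φ κ j x v := by
  rw [dV_congr hW (fun x v hz => hφ.dV_pullC hW hWq hF hz j) hz i,
    dV_sum hW _ (fun κ _ => (hφ.smooth_pullC hW (hF.dV hWq κ)).mul (hφ.smooth_jacC hW κ j)) hz]
  refine Finset.sum_congr rfl fun κ _ => ?_
  rw [dV_mul hW (hφ.smooth_pullC hW (hF.dV hWq κ)) (hφ.smooth_jacC hW κ j) hz, dV_jacC,
    hφ.dV_pullC hW hWq (hF.dV hWq κ) hz, mul_zero, add_zero]
  congr 1
  exact Finset.sum_congr rfl fun l _ => mul_comm _ _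

theorem IsLift.dV_dX_pullC (hWq : IsOpen Wq) {F : CoordSpace n → CoordSpace n → ℝ}
    (hF : SmoothPV Wq F) (hz : (x, v) ∈ W) (i j : Fin (n + 1)) :
    dV i (dX j (pullC φ F)) x v =
      ∑ κ, (∑ l, jacC φ l i x v * pullC φ (dV l (dX κ F)) x v) * jacC φ κ j x v +
      ∑ κ, (∑ l, jacC φ l i x v * pullC φ (dV l (dV κ F)) x v) * hessC φ κ j x v +
      ∑ κ, pullC φ (dV κ F) x v * dX j (jacC φ κ i) x v := by
  have s1 : ∀ κ, SmoothPV W (fun x v => pullC φ (dX κ F) x v * jacC φ κ j x v) := fun κ =>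
    (hφ.smooth_pullC hW (hF.dX hWq κ)).mul (hφ.smooth_jacC hW κ j)
  have s2 : ∀ κ, SmoothPV W (fun x v => pullC φ (dV κ F) x v * hessC φ κ j x v) := fun κ =>
    (hφ.smooth_pullC hW (hF.dV hWq κ)).mul (hφ.smooth_hessC hW κ j)
  have e1 : dV i (dX j (pullC φ F)) x v =
      ∑ κ, dV i (fun x v => pullC φ (dX κ F) x v * jacC φ κ j x v) x v +
      ∑ κ, dV i (fun x v => pullC φ (dV κ F) x v * hessC φ κ j x v) x v := by
    rw [dV_congr hW (fun x v hz => hφ.dX_pullC hW hWq hF hz j) hz i,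
      ← dV_sum hW _ (fun κ _ => s1 κ) hz, ← dV_sum hW _ (fun κ _ => s2 κ) hz]
    have := ((SmoothPV.sum Finset.univ fun κ _ => s1 κ).hasFDerivAt_right
      hW hz).differentiableAt.hasFDerivAt.fun_add ((SmoothPV.sum Finset.univ fun κ _ =>
      s2 κ).hasFDerivAt_right hW hz).differentiableAt.hasFDerivAt
    rw [dV, this.fderiv]; rfl
  rw [e1, add_assoc]
  congr 1
  · refine Finset.sum_congr rfl fun κ _ => ?_
    rw [dV_mul hW (hφ.smooth_pullC hW (hF.dX hWq κ)) (hφ.smooth_jacC hW κ j) hz, dV_jacC,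
      hφ.dV_pullC hW hWq (hF.dX hWq κ) hz, mul_zero, add_zero]
    simp_rw [mul_comm (jacC φ _ i x v)]
  · rw [← Finset.sum_add_distrib]
    refine Finset.sum_congr rfl fun κ _ => ?_
    rw [dV_mul hW (hφ.smooth_pullC hW (hF.dV hWq κ)) (hφ.smooth_hessC hW κ j) hz,
      hφ.dV_hessC hW hz, hφ.dV_pullC hW hWq (hF.dV hWq κ) hz]
    simp_rw [mul_comm (jacC φ _ i x v)]

theorem IsLift.dX_dX_pullC (hWq : IsOpen Wq) {F : CoordSpace n → CoordSpace n → ℝ}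
    (hF : SmoothPV Wq F) (hz : (x, v) ∈ W) (i j : Fin (n + 1)) :
    dX i (dX j (pullC φ F)) x v =
      ∑ κ, (∑ l, jacC φ l i x v * pullC φ (dX l (dX κ F)) x v) * jacC φ κ j x v +
      ∑ κ, (∑ l, hessC φ l i x v * pullC φ (dV l (dX κ F)) x v) * jacC φ κ j x v +
      ∑ κ, (∑ l, jacC φ l i x v * pullC φ (dX l (dV κ F)) x v) * hessC φ κ j x v +
      ∑ κ, (∑ l, hessC φ l i x v * pullC φ (dV l (dV κ F)) x v) * hessC φ κ j x v +
      ∑ κ, (pullC φ (dX κ F) x v * dX j (jacC φ κ i) x v +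
        pullC φ (dV κ F) x v * ∑ l, dX l (dX j (jacC φ κ i)) x v * v l) := by
  have s1 : ∀ κ, SmoothPV W (fun x v => pullC φ (dX κ F) x v * jacC φ κ j x v) := fun κ =>
    (hφ.smooth_pullC hW (hF.dX hWq κ)).mul (hφ.smooth_jacC hW κ j)
  have s2 : ∀ κ, SmoothPV W (fun x v => pullC φ (dV κ F) x v * hessC φ κ j x v) := fun κ =>
    (hφ.smooth_pullC hW (hF.dV hWq κ)).mul (hφ.smooth_hessC hW κ j)
  have e1 : dX i (dX j (pullC φ F)) x v =
      ∑ κ, dX i (fun x v => pullC φ (dX κ F) x v * jacC φ κ j x v) x v +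
      ∑ κ, dX i (fun x v => pullC φ (dV κ F) x v * hessC φ κ j x v) x v := by
    rw [dX_congr hW (fun x v hz => hφ.dX_pullC hW hWq hF hz j) hz i,
      ← dX_sum hW _ (fun κ _ => s1 κ) hz, ← dX_sum hW _ (fun κ _ => s2 κ) hz]
    have := ((SmoothPV.sum Finset.univ fun κ _ => s1 κ).hasFDerivAt_left
      hW hz).differentiableAt.hasFDerivAt.fun_add ((SmoothPV.sum Finset.univ fun κ _ =>
      s2 κ).hasFDerivAt_left hW hz).differentiableAt.hasFDerivAt
    rw [dX, this.fderiv]; rfl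
  rw [e1, ← Finset.sum_add_distrib, ← Finset.sum_add_distrib, ← Finset.sum_add_distrib,
    ← Finset.sum_add_distrib, ← Finset.sum_add_distrib]
  refine Finset.sum_congr rfl fun κ _ => ?_
  rw [dX_mul hW (hφ.smooth_pullC hW (hF.dX hWq κ)) (hφ.smooth_jacC hW κ j) hz,
    dX_mul hW (hφ.smooth_pullC hW (hF.dV hWq κ)) (hφ.smooth_hessC hW κ j) hz,
    hφ.dX_hessC hW hz, hφ.dX_pullC hW hWq (hF.dX hWq κ) hz, hφ.dX_pullC hW hWq (hF.dV hWq κ) hz,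
    hφ.dX_jacC hW hz]
  simp_rw [mul_comm (jacC φ _ i x v), mul_comm (hessC φ _ i x v)]
  ring

end

end LorentzFinsler

namespace LorentzFinsler

open Set

/-! The noncommutative algebra behind the transformation laws. The letters `g`, `N`, `R`, `M`, `H`,
`S` stand for the metric, the nonlinear connection, the curvature, `L_{vx}`, `L_{xx}` and the
symmetric part `M - g N`, with an index `p` or `q` for the chart. The Jacobian is `T`, its
derivative along the geodesic is `T'`, the inhomogeneous terms are `B` and `B'`, and a further `s`
denotes an adjoint. -/

section Algebra

variable {A : Type*} [Ring A]

/-- The transformation law of `2 g N`: the derivative of the law for `g` gives the symmetric part of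
`g N`, and the symmetry of `M - g N` in both charts gives the antisymmetric part. -/
theorem add_self_eq_of_transition {gp Np Nps Mp Mps gq Nq Nqs Mq Mqs T Ts T' Ts' B : A}
    (e1 : gp * Np + Nps * gp = (Ts' * gq + Ts * (gq * Nq + Nqs * gq)) * T + Ts * gq * T')
    (e2 : Mps - Nps * gp = Mp - gp * Np) (e3 : Mqs - Nqs * gq = Mq - gq * Nq)
    (e4 : Mp = Ts * Mq * T + Ts * gq * T' + B) (e5 : Mps = Ts * Mqs * T + Ts' * gq * T + B) :
    gp * Np + gp * Np = Ts * gq * (Nq * T + T') + Ts * gq * (Nq * T + T') := by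
  linear_combination (norm := noncomm_ring) e1 + e2 + e4 - e5 - Ts * e3 * T

/-- The transformation law of the symmetric part `M - g N`. -/
theorem sub_mul_eq_of_transition {gp Np Mp gq Nq Mq T Ts T' B : A}
    (e1 : Mp = Ts * Mq * T + Ts * gq * T' + B) (e2 : gp = Ts * gq * T)
    (e3 : T * Np = Nq * T + T') : Mp - gp * Np = Ts * (Mq - gq * Nq) * T + B := by
  rw [e2, mul_assoc _ T, e3, e1]; noncomm_ring

/-- The transformation law of `g R`, from the derivative of the law for `M - g N`. -/
theorem mul_eq_mul_of_transition {gp Np Nps Rp Hp gq Nq Nqs Rq Hq Mq Mqs Sq T Ts T' Ts' B' : A}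
    (e1 : gp * Rp - Nps * (gp * Np) + Hp =
      (Ts' * Sq + Ts * (gq * Rq - Nqs * (gq * Nq) + Hq)) * T + Ts * Sq * T' + B')
    (e2 : Hp = Ts * Hq * T + Ts' * Mq * T + Ts * Mqs * T' + Ts' * gq * T' + B')
    (e3 : Mq = gq * Nq + Sq) (e4 : Mqs = Nqs * gq + Sq) (e5 : gp = Ts * gq * T)
    (e6 : T * Np = Nq * T + T') (e7 : Nps * Ts = Ts * Nqs + Ts') :
    gp * Rp = Ts * gq * (Rq * T) := by
  have e8 : Nps * (gp * Np) = (Ts * Nqs + Ts') * gq * (Nq * T + T') := by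
    rw [← e6, ← e7, e5]; noncomm_ring
  subst e3 e4
  linear_combination (norm := noncomm_ring) e1 - e2 + e8

end Algebra

variable {n : ℕ} {M : Type*} [TopologicalSpace M] [ChartedSpace (CoordSpace n) M]
  [IsManifold (𝓡 (n + 1)) ∞ M] {L : TangentBundle (𝓡 (n + 1)) M → ℝ} {p q : M}
  {W Wq : Set (CoordSpace n × CoordSpace n)} {ξ ζ ξ' ζ' : ℝ → CoordSpace n} {J : Set ℝ} {t : ℝ}
  {φ : CoordSpace n → CoordSpace n}

/-- `φ` is the change of coordinates from the chart labelled by `p` to the one labelled by `q`,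
and `(ξ, ζ)` and `(ξ', ζ')` are the coordinates in these charts of one and the same geodesic. -/
structure IsTransition (L : TangentBundle (𝓡 (n + 1)) M → ℝ) (p q : M)
    (W Wq : Set (CoordSpace n × CoordSpace n)) (ξ ζ ξ' ζ' : ℝ → CoordSpace n) (J : Set ℝ)
    (φ : CoordSpace n → CoordSpace n) : Prop where
  left : IsFinslerOn L p W
  right : IsFinslerOn L q Wq
  curve_left : IsSprayCurve L p W ξ ζ J
  curve_right : IsSprayCurve L q Wq ξ' ζ' J
  lift : IsLift φ W Wq
  pull : ∀ x v, (x, v) ∈ W → localL L p x v = pullC φ (localL L q) x v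
  curve : ∀ t ∈ J, ξ' t = φ (ξ t)
  isUnit_jac : ∀ t ∈ J, IsUnit (alongOp (jacC φ) ξ ζ t)

namespace IsTransition

variable (h : IsTransition L p q W Wq ξ ζ ξ' ζ' J φ)
include h

theorem vel (ht : t ∈ J) : ζ' t = WithLp.toLp 2 fun κ => velC φ κ (ξ t) (ζ t) := by
  refine (h.curve_right.deriv_pos t ht).unique ?_
  have h1 : ξ' =ᶠ[𝓝 t] fun s => (WithLp.toLp 2 fun κ => posC φ κ (ξ s) (ζ s) : CoordSpace n) := by
    filter_upwards [h.curve_left.isOpen.mem_nhds ht] with s hs using h.curve s hs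
  refine HasDerivAt.congr_of_eventuallyEq (hasDerivAt_toLp fun κ => ?_) h1
  refine (h.curve_left.hasDerivAt_comp h.left (h.lift.smooth κ) ht).congr_deriv ?_
  simp [sprayDeriv, dV_posC, velC, jacC]

theorem pullC_eq (ht : t ∈ J) (F : CoordSpace n → CoordSpace n → ℝ) :
    pullC φ F (ξ t) (ζ t) = F (ξ' t) (ζ' t) := by
  rw [pullC, h.curve t ht, h.vel ht]

theorem hasDerivAt_jac (ht : t ∈ J) :
    HasDerivAt (alongOp (jacC φ) ξ ζ) (alongOp (hessC φ) ξ ζ t) t := by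
  refine (h.curve_left.hasDerivAt_alongOp h.left (h.lift.smooth_jacC h.left.isOpen)
    ht).congr_deriv ?_
  rw [alongOp, alongOp]
  congr 1
  ext i j
  rw [h.lift.hessC_eq h.left.isOpen (h.curve_left.mem t ht)]
  simp [sprayDeriv, dV_jacC]

theorem g_eq (ht : t ∈ J) : alongOp (gLow L p) ξ ζ t =
    star (alongOp (jacC φ) ξ ζ t) * alongOp (gLow L q) ξ' ζ' t * alongOp (jacC φ) ξ ζ t := by
  have hW := h.left.isOpen
  have hz := h.curve_left.mem t ht
  simp only [alongOp, star_matOp, matOp_mul]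
  congr 1
  ext i j
  have h1 : gLow L p i j (ξ t) (ζ t) = dV i (dV j (pullC φ (localL L q))) (ξ t) (ζ t) :=
    dV_congr hW (fun x v hz => dV_congr hW h.pull hz j) hz i
  rw [h1, h.lift.dV_dV_pullC hW h.right.isOpen h.right.smooth hz]
  simp_rw [h.pullC_eq ht]
  rfl

/-- The inhomogeneous term `L_{q, v} D²φ` in the transformation law of the second derivatives of
`L`. -/
noncomputable def _root_.LorentzFinsler.hessTerm (L : TangentBundle (𝓡 (n + 1)) M → ℝ) (q : M)
    (φ : CoordSpace n → CoordSpace n) (i j : Fin (n + 1)) (x v : CoordSpace n) : ℝ :=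
  ∑ κ, pullC φ (dV κ (localL L q)) x v * dX j (jacC φ κ i) x v

theorem star_hessTerm (ht : t ∈ J) :
    star (alongOp (hessTerm L q φ) ξ ζ t) = alongOp (hessTerm L q φ) ξ ζ t := by
  rw [alongOp, star_matOp]
  congr 1
  ext i j
  exact Finset.sum_congr rfl fun κ _ => by
    rw [h.lift.dX_jacC h.left.isOpen (h.curve_left.mem t ht)]

/-- The transformation law of `L_{vx}`, by the chain rule. -/
theorem mixedHess_eq (ht : t ∈ J) : alongOp (mixedHess L p) ξ ζ t =
    star (alongOp (jacC φ) ξ ζ t) * alongOp (mixedHess L q) ξ' ζ' t * alongOp (jacC φ) ξ ζ t +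
    star (alongOp (jacC φ) ξ ζ t) * alongOp (gLow L q) ξ' ζ' t * alongOp (hessC φ) ξ ζ t +
    alongOp (hessTerm L q φ) ξ ζ t := by
  have hW := h.left.isOpen
  have hz := h.curve_left.mem t ht
  simp only [alongOp, star_matOp, matOp_mul, matOp_add]
  congr 1
  ext i j
  have h1 : mixedHess L p i j (ξ t) (ζ t) = dV i (dX j (pullC φ (localL L q))) (ξ t) (ζ t) :=
    dV_congr hW (fun x v hz => dX_congr hW h.pull hz j) hz i
  rw [h1, h.lift.dV_dX_pullC hW h.right.isOpen h.right.smooth hz, hessTerm]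
  simp_rw [h.pullC_eq ht]
  rfl

/-- By the Euler-Lagrange equations the inhomogeneous terms in the transformation laws of the mixed
and of the horizontal second derivatives of `L` are related by differentiation. -/
theorem hasDerivAt_hessTerm (ht : t ∈ J) : HasDerivAt (alongOp (hessTerm L q φ) ξ ζ)
    (alongOp (fun i j x v => ∑ κ, (pullC φ (dX κ (localL L q)) x v * dX j (jacC φ κ i) x v +
        pullC φ (dV κ (localL L q)) x v * ∑ l, dX l (dX j (jacC φ κ i)) x v * v l)) ξ ζ t) t := by
  have hW := h.left.isOpen
  refine hasDerivAt_matOp fun i j => ?_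
  refine HasDerivAt.fun_sum fun κ _ => HasDerivAt.fun_mul ?_ ?_
  · rw [h.pullC_eq ht]
    refine (h.curve_right.hasDerivAt_dV h.right ht κ).congr_of_eventuallyEq ?_
    filter_upwards [h.curve_left.isOpen.mem_nhds ht] with s hs using h.pullC_eq hs _
  · refine (h.curve_left.hasDerivAt_comp h.left
      ((h.lift.smooth_jacC hW κ i).dX hW j) ht).congr_deriv ?_
    simp [sprayDeriv, dV_dX_jacC]

/-- The transformation law of `L_{xx}`, by the chain rule. -/
theorem hess_eq (ht : t ∈ J) : alongOp (fun i j => dX i (dX j (localL L p))) ξ ζ t =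
    star (alongOp (jacC φ) ξ ζ t) * alongOp (fun i j => dX i (dX j (localL L q))) ξ' ζ' t *
      alongOp (jacC φ) ξ ζ t +
    star (alongOp (hessC φ) ξ ζ t) * alongOp (mixedHess L q) ξ' ζ' t * alongOp (jacC φ) ξ ζ t +
    star (alongOp (jacC φ) ξ ζ t) * star (alongOp (mixedHess L q) ξ' ζ' t) *
      alongOp (hessC φ) ξ ζ t +
    star (alongOp (hessC φ) ξ ζ t) * alongOp (gLow L q) ξ' ζ' t * alongOp (hessC φ) ξ ζ t +
    alongOp (fun i j x v => ∑ κ, (pullC φ (dX κ (localL L q)) x v * dX j (jacC φ κ i) x v +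
        pullC φ (dV κ (localL L q)) x v * ∑ l, dX l (dX j (jacC φ κ i)) x v * v l)) ξ ζ t := by
  have hW := h.left.isOpen
  have hz := h.curve_left.mem t ht
  simp only [alongOp, star_matOp, matOp_mul, matOp_add]
  congr 1
  ext i j
  have h1 : dX i (dX j (localL L p)) (ξ t) (ζ t) =
      dX i (dX j (pullC φ (localL L q))) (ξ t) (ζ t) :=
    dX_congr hW (fun x v hz => dX_congr hW h.pull hz j) hz i
  have h2 : ∀ l κ, dX l (dV κ (localL L q)) (ξ' t) (ζ' t) = mixedHess L q κ l (ξ' t) (ζ' t) :=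
    fun l κ => h.right.smooth.dX_dV h.right.isOpen (h.curve_right.mem t ht) l κ
  rw [h1, h.lift.dX_dX_pullC hW h.right.isOpen h.right.smooth hz]
  simp_rw [h.pullC_eq ht, h2]
  rfl

/-- The transformation law of the nonlinear connection. -/
theorem jac_mul_nonlinConn (ht : t ∈ J) :
    alongOp (jacC φ) ξ ζ t * alongOp (nonlinConn L p) ξ ζ t =
      alongOp (nonlinConn L q) ξ' ζ' t * alongOp (jacC φ) ξ ζ t + alongOp (hessC φ) ξ ζ t := by
  have e1 := (h.curve_left.hasDerivAt_g h.left ht).unique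
    ((((h.hasDerivAt_jac ht).star.fun_mul (h.curve_right.hasDerivAt_g h.right ht)).fun_mul
      (h.hasDerivAt_jac ht)).congr_of_eventuallyEq (by
        filter_upwards [h.curve_left.isOpen.mem_nhds ht] with s hs using h.g_eq hs))
  have e2 := h.curve_left.star_symmHess h.left ht
  have e3 := h.curve_right.star_symmHess h.right ht
  have e4 := h.mixedHess_eq ht
  have e5 := congrArg star e4
  have hg := h.curve_right.star_g h.right ht
  have hgp := h.curve_left.star_g h.left ht
  have hu := (h.isUnit_jac t ht).star.mul (h.curve_right.isUnit_g h.right ht)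
  rw [symmHess, star_op_sub, star_mul, hgp] at e2
  rw [symmHess, star_op_sub, star_mul, hg] at e3
  rw [star_op_add, star_op_add, star_mul, star_mul, star_mul, star_mul, star_star, hg,
    h.star_hessTerm ht, ← mul_assoc, ← mul_assoc] at e5
  have e6 := add_self_eq_of_transition e1 e2 e3 e4 e5
  rw [← two_smul_op, ← two_smul_op] at e6
  have e7 := (smul_right_injective (CoordSpace n →L[ℝ] CoordSpace n)
    (two_ne_zero : (2 : ℝ) ≠ 0)) e6
  rw [h.g_eq ht, mul_assoc (_ * _)] at e7
  exact hu.mul_left_cancel e7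

/-- The transformation law of the curvature endomorphism. -/
theorem jac_mul_curv (ht : t ∈ J) :
    alongOp (jacC φ) ξ ζ t * alongOp (curvCoeff L p) ξ ζ t =
      alongOp (curvCoeff L q) ξ' ζ' t * alongOp (jacC φ) ξ ζ t := by
  have hsymm : ∀ s ∈ J, symmHess L p ξ ζ s = star (alongOp (jacC φ) ξ ζ s) *
      symmHess L q ξ' ζ' s * alongOp (jacC φ) ξ ζ s + alongOp (hessTerm L q φ) ξ ζ s :=
    fun s hs => sub_mul_eq_of_transition (h.mixedHess_eq hs) (h.g_eq hs) (h.jac_mul_nonlinConn hs)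
  have e1 := (h.curve_left.hasDerivAt_symmHess h.left ht).unique
    (((((h.hasDerivAt_jac ht).star.fun_mul
      (h.curve_right.hasDerivAt_symmHess h.right ht)).fun_mul
      (h.hasDerivAt_jac ht)).fun_add (h.hasDerivAt_hessTerm ht)).congr_of_eventuallyEq (by
        filter_upwards [h.curve_left.isOpen.mem_nhds ht] with s hs using hsymm s hs))
  have e2 := h.jac_mul_nonlinConn ht
  have e3 := congrArg star e2
  have hM : alongOp (mixedHess L q) ξ' ζ' t = alongOp (gLow L q) ξ' ζ' t *
    alongOp (nonlinConn L q) ξ' ζ' t + symmHess L q ξ' ζ' t := by rw [symmHess]; abel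
  have hMs := congrArg star hM
  rw [star_op_add, star_mul, h.curve_right.star_g h.right ht,
    h.curve_right.star_symmHess h.right ht] at hMs
  have hu := (h.isUnit_jac t ht).star.mul (h.curve_right.isUnit_g h.right ht)
  rw [star_mul, star_op_add, star_mul] at e3
  have e8 := mul_eq_mul_of_transition e1 (h.hess_eq ht) hM hMs (h.g_eq ht) e2 e3
  rw [h.g_eq ht, mul_assoc (_ * _)] at e8
  exact hu.mul_left_cancel e8

end IsTransition

end LorentzFinsler

/-! ### Charts of a Finsler spacetime -/

namespace LorentzFinsler

open Set

variable {n : ℕ} {M : Type*} [TopologicalSpace M] [ChartedSpace (CoordSpace n) M]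
  [IsManifold (𝓡 (n + 1)) ∞ M]

theorem toCoord_ofCoord {p q : M} (hq : q ∈ (extChartAt (𝓡 (n + 1)) p).source) (u : CoordSpace n) :
    toCoord p q (ofCoord p q u) = u := by
  refine Bundle.Trivialization.continuousLinearMapAt_symmL _ ?_ u
  rwa [TangentBundle.trivializationAt_baseSet, ← extChartAt_source (𝓡 (n + 1))]

theorem ofCoord_toCoord {p q : M} (hq : q ∈ (extChartAt (𝓡 (n + 1)) p).source)
    (w : TangentSpace (𝓡 (n + 1)) q) : ofCoord p q (toCoord p q w) = w := by
  refine Bundle.Trivialization.symmL_continuousLinearMapAt _ ?_ w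
  rwa [TangentBundle.trivializationAt_baseSet, ← extChartAt_source (𝓡 (n + 1))]

theorem toCoord_eq_mfderiv {p q : M} (hq : q ∈ (extChartAt (𝓡 (n + 1)) p).source)
    (w : TangentSpace (𝓡 (n + 1)) q) :
    toCoord p q w = mfderiv (𝓡 (n + 1)) 𝓘(ℝ, CoordSpace n) (extChartAt (𝓡 (n + 1)) p) q w := by
  rw [toCoord, TangentBundle.continuousLinearMapAt_trivializationAt
    (by rwa [← extChartAt_source (𝓡 (n + 1))])]
  rfl

/-- The tangent vector with coordinates `(x, v)` in the chart labelled by `p`. -/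
noncomputable def ofChart (p : M) (z : CoordSpace n × CoordSpace n) :
    TangentBundle (𝓡 (n + 1)) M :=
  ⟨(extChartAt (𝓡 (n + 1)) p).symm z.1, ofCoord p _ z.2⟩

theorem contMDiffOn_ofChart (p : M) :
    ContMDiffOn 𝓘(ℝ, CoordSpace n × CoordSpace n) (𝓡 (n + 1)).tangent ∞ (ofChart p)
      {z | z.1 ∈ (extChartAt (𝓡 (n + 1)) p).target} := by
  set e := trivializationAt (CoordSpace n) (TangentSpace (𝓡 (n + 1)) : M → Type _) p
  have h1 : ContMDiffOn ((𝓡 (n + 1)).prod 𝓘(ℝ, CoordSpace n))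
      ((𝓡 (n + 1)).prod 𝓘(ℝ, CoordSpace n)) ∞ e.toOpenPartialHomeomorph.symm e.target :=
    e.contMDiffOn_symm
  have h2 : ContMDiffOn 𝓘(ℝ, CoordSpace n × CoordSpace n)
      ((𝓡 (n + 1)).prod 𝓘(ℝ, CoordSpace n)) ∞
      (fun z : CoordSpace n × CoordSpace n => ((extChartAt (𝓡 (n + 1)) p).symm z.1, z.2))
      {z | z.1 ∈ (extChartAt (𝓡 (n + 1)) p).target} :=
    ((contMDiffOn_extChartAt_symm (n := ∞) p).comp
      (contDiff_fst.contMDiff.contMDiffOn) fun z hz => hz).prodMk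
        contDiff_snd.contMDiff.contMDiffOn
  have hb : ∀ z : CoordSpace n × CoordSpace n, z.1 ∈ (extChartAt (𝓡 (n + 1)) p).target →
      (extChartAt (𝓡 (n + 1)) p).symm z.1 ∈ e.baseSet := fun z hz => by
    rw [TangentBundle.trivializationAt_baseSet, ← extChartAt_source (𝓡 (n + 1))]
    exact (extChartAt (𝓡 (n + 1)) p).map_target hz
  refine (h1.comp h2 fun z hz => ?_).congr fun z hz => ?_
  · exact e.mem_target.2 (hb z hz)
  · rw [Function.comp_apply, ← e.mk_symm (hb z hz) z.2, ← e.symmL_apply (R := ℝ) (hb z hz) z.2]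
    rfl

theorem localL_eq (L : TangentBundle (𝓡 (n + 1)) M → ℝ) (p : M) (x v : CoordSpace n) :
    localL L p x v = L (ofChart p (x, v)) := rfl

theorem ofChart_extChartAt {p q : M} (hq : q ∈ (extChartAt (𝓡 (n + 1)) p).source)
    (w : TangentSpace (𝓡 (n + 1)) q) :
    ofChart p (extChartAt (𝓡 (n + 1)) p q, toCoord p q w) = ⟨q, w⟩ := by
  have h1 : (extChartAt (𝓡 (n + 1)) p).symm (extChartAt (𝓡 (n + 1)) p q) = q :=
    (extChartAt (𝓡 (n + 1)) p).left_inv hq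
  rw [ofChart]
  simp only
  rw [h1, ofCoord_toCoord hq]

theorem ofCoord_smul (p q : M) (c : ℝ) (u : CoordSpace n) :
    ofCoord p q (c • u) = c • ofCoord p q u := by
  rw [ofCoord, map_smul]; rfl

theorem ofCoord_zero (p q : M) : ofCoord p q (0 : CoordSpace n) = 0 := by
  rw [ofCoord, map_zero]

theorem toCoord_zero (p q : M) : toCoord p q (0 : TangentSpace (𝓡 (n + 1)) q) = 0 := by
  rw [toCoord, map_zero]

theorem ofCoord_eq_zero {p q : M} (hq : q ∈ (extChartAt (𝓡 (n + 1)) p).source)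
    {u : CoordSpace n} : ofCoord p q u = 0 ↔ u = 0 := by
  refine ⟨fun h => ?_, fun h => by rw [h, ofCoord_zero]⟩
  rw [← toCoord_ofCoord hq u, h, toCoord_zero]

theorem toCoord_eq_zero {p q : M} (hq : q ∈ (extChartAt (𝓡 (n + 1)) p).source)
    {w : TangentSpace (𝓡 (n + 1)) q} : toCoord p q w = 0 ↔ w = 0 := by
  refine ⟨fun h => ?_, fun h => by rw [h, toCoord_zero]⟩
  rw [← ofCoord_toCoord hq w, h, ofCoord_zero]

/-- The domain in the coordinates of the chart labelled by `p` that corresponds to the nonzero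
tangent vectors at points of `V`. -/
def chartDomain (p : M) (V : Set M) : Set (CoordSpace n × CoordSpace n) :=
  {z | z.1 ∈ (extChartAt (𝓡 (n + 1)) p).target ∧ (extChartAt (𝓡 (n + 1)) p).symm z.1 ∈ V ∧ z.2 ≠ 0}

omit [IsManifold (𝓡 (n + 1)) ∞ M] in
theorem isOpen_chartDomain (p : M) {V : Set M} (hV : IsOpen V) :
    IsOpen (chartDomain (n := n) p V) := by
  have h1 := (continuousOn_extChartAt_symm (I := 𝓡 (n + 1)) p).isOpen_inter_preimage
    (isOpen_extChartAt_target p) hV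
  have h2 : chartDomain (n := n) p V = Prod.fst ⁻¹' ((extChartAt (𝓡 (n + 1)) p).target ∩
      (extChartAt (𝓡 (n + 1)) p).symm ⁻¹' V) ∩ Prod.snd ⁻¹' {0}ᶜ := by
    ext z; simp [chartDomain, and_assoc]
  rw [h2]
  exact (h1.preimage continuous_fst).inter (isOpen_compl_singleton.preimage continuous_snd)

theorem FinslerSpacetime.smoothPV_localL (S : FinslerSpacetime n M) (p : M) (V : Set M) :
    SmoothPV (chartDomain p V) (localL S.L p) := by
  have h1 : ContMDiffOn 𝓘(ℝ, CoordSpace n × CoordSpace n) 𝓘(ℝ, ℝ) ∞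
      (S.L ∘ ofChart p) (chartDomain p V) := by
    refine S.smooth.comp ((contMDiffOn_ofChart p).mono fun z hz => hz.1) fun z hz => ?_
    have h2 := (extChartAt (𝓡 (n + 1)) p).map_target hz.1
    exact fun h => hz.2.2 ((ofCoord_eq_zero h2).1 h)
  exact h1.contDiffOn

theorem FinslerSpacetime.isFinslerOn (S : FinslerSpacetime n M) (p : M) {V : Set M}
    (hV : IsOpen V) : IsFinslerOn S.L p (chartDomain p V) where
  isOpen := isOpen_chartDomain p hV
  smooth := S.smoothPV_localL p V
  euler := by
    rintro x v hz
    have h1 : HasDerivAt (fun c : ℝ => localL S.L p x (c • v)) (2 * localL S.L p x v) 1 := by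
      have h2 : HasDerivAt (fun c : ℝ => c ^ 2 * localL S.L p x v) (2 * localL S.L p x v) 1 := by
        simpa using (hasDerivAt_pow 2 (1 : ℝ)).mul_const (localL S.L p x v)
      refine h2.congr_of_eventuallyEq ?_
      filter_upwards [lt_mem_nhds one_pos] with c hc
      simp only [localL]
      rw [ofCoord_smul, S.homogeneous _ _ _ hc]
    have hd : DifferentiableAt ℝ (fun w => localL S.L p x w) v :=
      ((S.smoothPV_localL p V).hasFDerivAt_right (isOpen_chartDomain p hV) hz).differentiableAt
    have h3 : HasDerivAt (fun c : ℝ => c • v) v 1 := by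
      simpa using (hasDerivAt_id (1 : ℝ)).smul_const v
    have h4 : HasFDerivAt (fun w => localL S.L p x w) (fderiv ℝ (fun w => localL S.L p x w) v)
      ((1 : ℝ) • v) := by simpa using hd.hasFDerivAt
    have h5 : HasDerivAt ((fun w => localL S.L p x w) ∘ fun c : ℝ => c • v)
        (fderiv ℝ (fun w => localL S.L p x w) v v) 1 := HasFDerivAt.comp_hasDerivAt 1 h4 h3
    rw [h1.unique h5]
    have h6 : fderiv ℝ (fun w => localL S.L p x w) v v =
        fderiv ℝ (fun w => localL S.L p x w) v (∑ β, v β • coordBasis β) := by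
      rw [sum_smul_coordBasis]
    rw [h6, map_sum]
    exact Finset.sum_congr rfl fun β _ => by rw [map_smul, smul_eq_mul, mul_comm]; rfl
  det_ne_zero := by
    rintro x v ⟨hx, -, hv⟩
    obtain ⟨-, P, hP, h⟩ := S.signature p x v hx hv
    intro h0
    have h1 := congrArg Matrix.det h
    have h2 : (gMatrix S.L p x v).det = 0 := h0
    rw [Matrix.det_mul, Matrix.det_mul, h2, mul_zero, zero_mul, Matrix.det_diagonal] at h1
    refine Finset.prod_ne_zero_iff.2 (fun α _ => ?_) h1.symm
    split_ifs <;> norm_num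

/-- The change of coordinates from the chart labelled by `p` to the one labelled by `q`. -/
noncomputable def transMap (p q : M) (x : CoordSpace n) : CoordSpace n :=
  extChartAt (𝓡 (n + 1)) q ((extChartAt (𝓡 (n + 1)) p).symm x)

/-- The differential of the change of coordinates is the transition function of the tangent bundle.
-/
theorem hasFDerivAt_transMap {p q : M} {x : CoordSpace n}
    (hx : x ∈ (extChartAt (𝓡 (n + 1)) p).target)
    (hq : (extChartAt (𝓡 (n + 1)) p).symm x ∈ (extChartAt (𝓡 (n + 1)) q).source) :
    HasFDerivAt (transMap p q)
      (((trivializationAt (CoordSpace n) (TangentSpace (𝓡 (n + 1)) : M → Type _) q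
        ).continuousLinearMapAt ℝ ((extChartAt (𝓡 (n + 1)) p).symm x)).comp
      ((trivializationAt (CoordSpace n) (TangentSpace (𝓡 (n + 1)) : M → Type _) p
        ).symmL ℝ ((extChartAt (𝓡 (n + 1)) p).symm x))) x := by
  have hp := (extChartAt (𝓡 (n + 1)) p).map_target hx
  rw [TangentBundle.continuousLinearMapAt_trivializationAt
    (by rwa [← extChartAt_source (𝓡 (n + 1))]), TangentBundle.symmL_trivializationAt
    (by rwa [← extChartAt_source (𝓡 (n + 1))]), ModelWithCorners.Boundaryless.range_eq_univ,
    mfderivWithin_univ, (extChartAt (𝓡 (n + 1)) p).right_inv hx]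
  have h1 : MDifferentiableAt 𝓘(ℝ, CoordSpace n) (𝓡 (n + 1)) (extChartAt (𝓡 (n + 1)) p).symm x :=
    ((contMDiffOn_extChartAt_symm (n := ∞) p).contMDiffAt
      ((isOpen_extChartAt_target p).mem_nhds hx)).mdifferentiableAt (by simp)
  have h2 : MDifferentiableAt (𝓡 (n + 1)) 𝓘(ℝ, CoordSpace n) (extChartAt (𝓡 (n + 1)) q)
      ((extChartAt (𝓡 (n + 1)) p).symm x) :=
    (contMDiffAt_extChartAt' (n := ∞) (by rwa [← extChartAt_source (𝓡 (n + 1))])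
      ).mdifferentiableAt (by simp)
  exact (h2.hasMFDerivAt.comp x h1.hasMFDerivAt).hasFDerivAt

theorem contDiffOn_transMap (p q : M) :
    ContDiffOn ℝ ∞ (transMap (n := n) p q) ((extChartAt (𝓡 (n + 1)) p).target ∩
      (extChartAt (𝓡 (n + 1)) p).symm ⁻¹' (extChartAt (𝓡 (n + 1)) q).source) := by
  have h1 : ContMDiffOn 𝓘(ℝ, CoordSpace n) 𝓘(ℝ, CoordSpace n) ∞ (transMap (n := n) p q) _ :=
    (contMDiffOn_extChartAt (I := 𝓡 (n + 1)) (n := ∞) (x := q)).comp'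
      (contMDiffOn_extChartAt_symm (I := 𝓡 (n + 1)) (n := ∞) p)
  rw [extChartAt_source]
  exact h1.contDiffOn

section

variable {p q : M} {x v : CoordSpace n} (hx : x ∈ (extChartAt (𝓡 (n + 1)) p).target)
    (hq : (extChartAt (𝓡 (n + 1)) p).symm x ∈ (extChartAt (𝓡 (n + 1)) q).source)
include hx hq

theorem matOp_jacC_transMap (u : CoordSpace n) :
    matOp (fun κ j => jacC (transMap p q) κ j x v) u =
      toCoord q ((extChartAt (𝓡 (n + 1)) p).symm x)
        (ofCoord p ((extChartAt (𝓡 (n + 1)) p).symm x) u) := by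
  have h1 := hasFDerivAt_transMap hx hq
  have h2 : ∀ κ j, jacC (transMap p q) κ j x v =
      toCoord q ((extChartAt (𝓡 (n + 1)) p).symm x)
        (ofCoord p ((extChartAt (𝓡 (n + 1)) p).symm x) (coordBasis j)) κ := by
    intro κ j
    have h3 := (EuclideanSpace.proj (𝕜 := ℝ) κ : CoordSpace n →L[ℝ] ℝ).hasFDerivAt.comp x h1
    exact congrArg (fun f => f (coordBasis j)) h3.fderiv
  ext κ
  rw [matOp_apply]
  simp_rw [h2]
  conv_rhs => rw [← sum_smul_coordBasis u]
  rw [ofCoord, map_sum, toCoord, map_sum]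
  rw [WithLp.ofLp_sum, Finset.sum_apply]
  refine Finset.sum_congr rfl fun j _ => ?_
  rw [map_smul, map_smul, mul_comm]
  rfl

theorem toLp_velC_transMap : (WithLp.toLp 2 fun κ => velC (transMap p q) κ x v : CoordSpace n) =
    toCoord q ((extChartAt (𝓡 (n + 1)) p).symm x)
        (ofCoord p ((extChartAt (𝓡 (n + 1)) p).symm x) v) := by
  rw [← matOp_jacC_transMap (v := v) hx hq]
  rfl

theorem isUnit_matOp_jacC_transMap : IsUnit (matOp fun κ j => jacC (transMap p q) κ j x v) := by
  have hp := (extChartAt (𝓡 (n + 1)) p).map_target hx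
  refine ⟨⟨_, ((trivializationAt (CoordSpace n) (TangentSpace (𝓡 (n + 1)) : M → Type _) p
        ).continuousLinearMapAt ℝ ((extChartAt (𝓡 (n + 1)) p).symm x)).comp
      ((trivializationAt (CoordSpace n) (TangentSpace (𝓡 (n + 1)) : M → Type _) q
        ).symmL ℝ ((extChartAt (𝓡 (n + 1)) p).symm x)), ?_, ?_⟩, rfl⟩
  · ext1 u
    rw [mul_apply_eq_comp]
    change matOp (fun κ j => jacC (transMap p q) κ j x v) (toCoord _ _ (ofCoord _ _ u)) = u
    rw [matOp_jacC_transMap hx hq, ofCoord_toCoord hp, toCoord_ofCoord hq]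
  · ext1 u
    rw [mul_apply_eq_comp]
    change toCoord p _ (ofCoord q _ (matOp (fun κ j => jacC (transMap p q) κ j x v) u)) = u
    rw [matOp_jacC_transMap hx hq, ofCoord_toCoord hq, toCoord_ofCoord hp]

end

theorem isLift_transMap (p q : M) : IsLift (transMap (n := n) p q)
    (chartDomain p (extChartAt (𝓡 (n + 1)) q).source) (chartDomain q univ) where
  smooth κ := by
    have h1 := (contDiffOn_transMap (n := n) p q).comp (s := chartDomain p
      (extChartAt (𝓡 (n + 1)) q).source) contDiff_fst.contDiffOn fun z hz => ⟨hz.1, hz.2.1⟩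
    exact (EuclideanSpace.proj (𝕜 := ℝ) κ : CoordSpace n →L[ℝ] ℝ).contDiff.comp_contDiffOn h1
  maps := by
    rintro x v ⟨hx, hq, hv⟩
    have hp := (extChartAt (𝓡 (n + 1)) p).map_target hx
    refine ⟨(extChartAt (𝓡 (n + 1)) q).map_source hq, mem_univ _, ?_⟩
    change (WithLp.toLp 2 fun κ => velC (transMap p q) κ x v : CoordSpace n) ≠ 0
    rw [toLp_velC_transMap hx hq, Ne, toCoord_eq_zero hq, ofCoord_eq_zero hp]
    exact hv

theorem localL_eq_pullC (L : TangentBundle (𝓡 (n + 1)) M → ℝ) {p q : M} {x v : CoordSpace n}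
    (hz : (x, v) ∈ chartDomain p (extChartAt (𝓡 (n + 1)) q).source) :
    localL L p x v = pullC (transMap p q) (localL L q) x v := by
  obtain ⟨hx, hq, hv⟩ := hz
  rw [pullC, toLp_velC_transMap hx hq, localL_eq, localL_eq, transMap, ofChart_extChartAt hq]
  rfl

section Geodesic

variable {S : FinslerSpacetime n M} {η : ℝ → M} {a b : EReal} {t : ℝ}

theorem isOpen_interval (a b : EReal) : IsOpen (interval a b) :=
  isOpen_Ioo.preimage continuous_coe_real_ereal

theorem FinslerSpacetime.L_zero (S : FinslerSpacetime n M) (x : M) : S.L ⟨x, 0⟩ = 0 := by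
  have h := S.homogeneous x 0 2 (by norm_num)
  rw [smul_zero] at h
  linarith

theorem FinslerSpacetime.ne_zero_of_mem_future {v : TangentBundle (𝓡 (n + 1)) M}
    (hv : v ∈ S.future) : v.2 ≠ 0 := by
  intro h
  have h1 : S.L ⟨v.1, v.2⟩ < 0 := hv.1
  rw [h, S.L_zero] at h1
  exact lt_irrefl _ h1

theorem FinslerSpacetime.future_subset_futureCausal : S.future ⊆ S.futureCausal :=
  fun _ hv => ⟨subset_closure hv, FinslerSpacetime.ne_zero_of_mem_future hv⟩

variable (hη : S.IsTimelikeGeodesic η a b)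
include hη

theorem FinslerSpacetime.IsTimelikeGeodesic.contMDiffAt (ht : t ∈ interval a b) :
    ContMDiffAt 𝓘(ℝ, ℝ) (𝓡 (n + 1)) ∞ η t :=
  hη.smooth.contMDiffAt ((isOpen_interval a b).mem_nhds ht)

theorem FinslerSpacetime.IsTimelikeGeodesic.isOpen_inter_preimage {V : Set M} (hV : IsOpen V) :
    IsOpen (interval a b ∩ η ⁻¹' V) :=
  hη.smooth.continuousOn.isOpen_inter_preimage (isOpen_interval a b) hV

theorem FinslerSpacetime.IsTimelikeGeodesic.contDiffOn_coordCurve (p : M) :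
    ContDiffOn ℝ ∞ (coordCurve (n := n) p η)
      (interval a b ∩ η ⁻¹' (extChartAt (𝓡 (n + 1)) p).source) := by
  rw [extChartAt_source]
  exact ((contMDiffOn_extChartAt (I := 𝓡 (n + 1)) (n := ∞) (x := p)).comp' hη.smooth).contDiffOn

theorem FinslerSpacetime.IsTimelikeGeodesic.toCoord_velocity {p : M} (ht : t ∈ interval a b)
    (hp : η t ∈ (extChartAt (𝓡 (n + 1)) p).source) :
    toCoord p (η t) (velocity (n := n) η t) = deriv (coordCurve p η) t := by
  have h2 : MDifferentiableAt (𝓡 (n + 1)) 𝓘(ℝ, CoordSpace n) (extChartAt (𝓡 (n + 1)) p) (η t) :=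
    (contMDiffAt_extChartAt' (n := ∞) (by rwa [← extChartAt_source (𝓡 (n + 1))])
      ).mdifferentiableAt (by simp)
  have h1 := (hη.contMDiffAt ht).mdifferentiableAt (by simp)
  rw [toCoord_eq_mfderiv hp]
  change _ = fderiv ℝ (extChartAt (𝓡 (n + 1)) p ∘ η) t (1 : ℝ)
  rw [← mfderiv_eq_fderiv, mfderiv_comp t h2 h1]
  rfl

/-- A timelike geodesic in the coordinates of the chart labelled by `p`. -/
theorem FinslerSpacetime.IsTimelikeGeodesic.isSprayCurve (p : M) {V : Set M} (hV : IsOpen V) :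
    IsSprayCurve S.L p (chartDomain p V) (coordCurve p η) (deriv (coordCurve p η))
      (interval a b ∩ η ⁻¹' ((extChartAt (𝓡 (n + 1)) p).source ∩ V)) := by
  have hJ := hη.isOpen_inter_preimage ((isOpen_extChartAt_source (I := 𝓡 (n + 1)) p).inter hV)
  have hsm : ContDiffOn ℝ ∞ (coordCurve p η)
      (interval a b ∩ η ⁻¹' ((extChartAt (𝓡 (n + 1)) p).source ∩ V)) :=
    (hη.contDiffOn_coordCurve p).mono fun t ht => ⟨ht.1, ht.2.1⟩
  refine ⟨hJ, fun t ht => ?_, fun t ht => ?_, fun t ht => ?_, hsm⟩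
  · refine ⟨(extChartAt (𝓡 (n + 1)) p).map_source ht.2.1, ?_, ?_⟩
    · change (extChartAt (𝓡 (n + 1)) p).symm (extChartAt (𝓡 (n + 1)) p (η t)) ∈ V
      rw [(extChartAt (𝓡 (n + 1)) p).left_inv ht.2.1]
      exact ht.2.2
    · change deriv (coordCurve p η) t ≠ 0
      rw [← hη.toCoord_velocity ht.1 ht.2.1, Ne, toCoord_eq_zero ht.2.1]
      exact FinslerSpacetime.ne_zero_of_mem_future (hη.timelike t ht.1)
  · exact ((hsm.contDiffAt (hJ.mem_nhds ht)).differentiableAt (by simp)).hasDerivAt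
  · have h1 : ContDiffOn ℝ ∞ (deriv (coordCurve p η)) _ := hsm.deriv_of_isOpen hJ (by simp)
    refine ((h1.contDiffAt (hJ.mem_nhds ht)).differentiableAt (by simp)).hasDerivAt.congr_deriv ?_
    ext α
    have h2 := hη.geodesic t ht.1 p ht.2.1 α
    change _ = -(2 * _)
    rw [sprayCoeff]
    linarith

/-- A timelike geodesic in two overlapping charts. -/
theorem FinslerSpacetime.IsTimelikeGeodesic.isTransition (p q : M) :
    IsTransition S.L p q (chartDomain p (extChartAt (𝓡 (n + 1)) q).source) (chartDomain q univ)
      (coordCurve p η) (deriv (coordCurve p η)) (coordCurve q η) (deriv (coordCurve q η))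
      (interval a b ∩ η ⁻¹' ((extChartAt (𝓡 (n + 1)) p).source ∩
        (extChartAt (𝓡 (n + 1)) q).source)) (transMap p q) where
  left := S.isFinslerOn p (isOpen_extChartAt_source q)
  right := S.isFinslerOn q isOpen_univ
  curve_left := hη.isSprayCurve p (isOpen_extChartAt_source q)
  curve_right := by
    have h1 := hη.isSprayCurve q isOpen_univ
    have hJ := hη.isOpen_inter_preimage ((isOpen_extChartAt_source (I := 𝓡 (n + 1)) p).inter
      (isOpen_extChartAt_source (I := 𝓡 (n + 1)) q))
    have hs : interval a b ∩ η ⁻¹' ((extChartAt (𝓡 (n + 1)) p).source ∩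
        (extChartAt (𝓡 (n + 1)) q).source) ⊆
        interval a b ∩ η ⁻¹' ((extChartAt (𝓡 (n + 1)) q).source ∩ univ) :=
      fun t ht => ⟨ht.1, ht.2.2, mem_univ _⟩
    exact ⟨hJ, fun t ht => h1.mem t (hs ht), fun t ht => h1.deriv_pos t (hs ht),
      fun t ht => h1.deriv_vel t (hs ht), h1.smooth.mono hs⟩
  lift := isLift_transMap p q
  pull _ _ hz := localL_eq_pullC S.L hz
  curve t ht := by
    rw [transMap, coordCurve, coordCurve, (extChartAt (𝓡 (n + 1)) p).left_inv ht.2.1]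
  isUnit_jac t ht := by
    refine isUnit_matOp_jacC_transMap ((extChartAt (𝓡 (n + 1)) p).map_source ht.2.1) ?_
    rw [coordCurve, (extChartAt (𝓡 (n + 1)) p).left_inv ht.2.1]
    exact ht.2.2

end Geodesic

end LorentzFinsler

/-! ### Lorentz frames -/

namespace LorentzFinsler

open Set

variable {n : ℕ}

/-- The operator with matrix `diag(-1, 1, …, 1)`. -/
noncomputable def minkOp (n : ℕ) : CoordSpace n →L[ℝ] CoordSpace n :=
  matOp fun i j => if i = j then (if i = 0 then -1 else 1) else 0

theorem minkOp_apply (u : CoordSpace n) (i : Fin (n + 1)) :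
    minkOp n u i = (if i = 0 then -1 else 1) * u i := by
  rw [minkOp, matOp_apply]; simp

theorem minkOp_mul_self : minkOp n * minkOp n = 1 := by
  ext u i
  rw [mul_apply_eq_comp, minkOp_apply, minkOp_apply]
  split_ifs <;> simp

theorem minkOp_coordBasis_zero : minkOp n (coordBasis 0) = -coordBasis 0 := by
  ext i
  rw [minkOp_apply, coordBasis, PiLp.neg_apply, PiLp.single_apply]
  split_ifs <;> simp

theorem star_minkOp : star (minkOp n) = minkOp n := by
  rw [minkOp, star_matOp]
  congr 1
  ext i j
  by_cases h : i = j
  · subst h; rfl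
  · rw [if_neg h, if_neg (Ne.symm h)]

theorem inner_star_apply (A : CoordSpace n →L[ℝ] CoordSpace n) (u w : CoordSpace n) :
    inner ℝ (star A u) w = inner ℝ u (A w) :=
  ContinuousLinearMap.adjoint_inner_left A w u

theorem inner_apply_star (A : CoordSpace n →L[ℝ] CoordSpace n) (u w : CoordSpace n) :
    inner ℝ (A u) w = inner ℝ u (star A w) :=
  (ContinuousLinearMap.adjoint_inner_right A u w).symm

theorem ext_inner_op {A B : CoordSpace n →L[ℝ] CoordSpace n}
    (h : ∀ u w, inner ℝ u (A w) = inner ℝ u (B w)) : A = B := by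
  ext1 w
  exact ext_inner_left ℝ fun u => h u w

/-- The reflection in the hyperplane that is orthogonal to `w` for the Minkowski inner product. -/
noncomputable def minkReflection (w : CoordSpace n) : CoordSpace n →L[ℝ] CoordSpace n :=
  1 - (2 / inner ℝ (minkOp n w) w) • (innerSL ℝ (minkOp n w)).smulRight w

theorem minkReflection_apply (w x : CoordSpace n) : minkReflection w x =
    x - (2 / inner ℝ (minkOp n w) w * inner ℝ (minkOp n w) x) • w := by
  simp [minkReflection, smul_smul]

theorem inner_minkOp_comm (u w : CoordSpace n) :
    inner ℝ (minkOp n u) w = inner ℝ (minkOp n w) u := by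
  rw [inner_apply_star, star_minkOp, real_inner_comm]

theorem inner_minkReflection {w : CoordSpace n} (hw : inner ℝ (minkOp n w) w ≠ 0)
    (x y : CoordSpace n) :
    inner ℝ (minkOp n (minkReflection w x)) (minkReflection w y) = inner ℝ (minkOp n x) y := by
  rw [minkReflection_apply, minkReflection_apply, map_sub, map_smul, inner_sub_left,
    inner_sub_right, inner_sub_right, real_inner_smul_left, real_inner_smul_left,
    real_inner_smul_right, real_inner_smul_right, inner_minkOp_comm x w]
  field_simp
  ring

theorem star_mul_minkOp_mul {A : CoordSpace n →L[ℝ] CoordSpace n}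
    (h : ∀ x y, inner ℝ (minkOp n (A x)) (A y) = inner ℝ (minkOp n x) y) :
    star A * minkOp n * A = minkOp n := ext_inner_op fun x y => by
  rw [mul_apply_eq_comp, mul_apply_eq_comp, ← inner_apply_star, real_inner_comm, h,
    real_inner_comm]

/-- A reflection that exchanges two timelike unit vectors (up to sign) carries the first basis
vector to a given one. -/
theorem exists_minkOp_isometry {u : CoordSpace n} (hu : inner ℝ (minkOp n u) u = -1) :
    ∃ A : CoordSpace n →L[ℝ] CoordSpace n, star A * minkOp n * A = minkOp n ∧
      A (coordBasis 0) = u := by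
  have he : inner ℝ (minkOp n (coordBasis 0)) (coordBasis 0) = -1 := by
    rw [minkOp_coordBasis_zero, inner_neg_left]
    simp [coordBasis]
  have hue : inner ℝ (minkOp n u) (coordBasis 0) = -u 0 := by
    rw [coordBasis, EuclideanSpace.inner_single_right]
    simp [minkOp_apply]
  have heu : inner ℝ (minkOp n (coordBasis 0)) u = -u 0 := by rw [inner_minkOp_comm, hue]
  rcases le_total (u 0) 0 with h | h
  · have hw : inner ℝ (minkOp n (u - coordBasis 0)) (u - coordBasis 0) = -2 + 2 * u 0 := by
      rw [map_sub, inner_sub_left, inner_sub_right, inner_sub_right, hu, hue, heu, he]; ring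
    have hw0 : -2 + 2 * u 0 ≠ 0 := by linarith
    refine ⟨minkReflection (u - coordBasis 0),
      star_mul_minkOp_mul (inner_minkReflection (hw ▸ hw0)), ?_⟩
    rw [minkReflection_apply, hw, map_sub, inner_sub_left, hue, he]
    have h1 : 2 / (-2 + 2 * u 0) * (-u 0 - -1) = -1 := by
      rw [div_mul_eq_mul_div, div_eq_iff hw0]; ring
    rw [h1]
    module
  · have hw : inner ℝ (minkOp n (u + coordBasis 0)) (u + coordBasis 0) = -2 - 2 * u 0 := by
      rw [map_add, inner_add_left, inner_add_right, inner_add_right, hu, hue, heu, he]; ring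
    have hw0 : -2 - 2 * u 0 ≠ 0 := by linarith
    refine ⟨-minkReflection (u + coordBasis 0), ?_, ?_⟩
    · refine star_mul_minkOp_mul fun x y => ?_
      rw [neg_apply, neg_apply, map_neg, inner_neg_neg, inner_minkReflection (hw ▸ hw0)]
    rw [neg_apply, minkReflection_apply, hw, map_add, inner_add_left, hue, he]
    have h1 : 2 / (-2 - 2 * u 0) * (-u 0 + -1) = 1 := by
      rw [div_mul_eq_mul_div, div_eq_iff hw0]; ring
    rw [h1]
    module

/-- A timelike vector can be completed to an orthogonal frame. -/
theorem HasLorentzSignature.exists_frame {A : Fin (n + 1) → Fin (n + 1) → ℝ}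
    (hA : HasLorentzSignature (Matrix.of A)) {v : CoordSpace n} {c : ℝ} (hc : 0 < c)
    (hv : inner ℝ (matOp A v) v = -c ^ 2) :
    ∃ B : CoordSpace n →L[ℝ] CoordSpace n, IsUnit B ∧ star B * matOp A * B = minkOp n ∧
      v = c • B (coordBasis 0) := by
  obtain ⟨hsymm, P, hP, h⟩ := hA
  have h1 : star (matOp fun i j => P i j) * matOp A * (matOp fun i j => P i j) = minkOp n := by
    have h2 := congrArg (Matrix.toEuclideanCLM (n := Fin (n + 1)) (𝕜 := ℝ)) h
    rw [map_mul, map_mul] at h2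
    rw [star_matOp, minkOp]
    refine h2.trans ?_
    rw [matOp]
    congr 1
  set B := matOp fun i j => P i j with hB
  have hBu : IsUnit B := isUnit_matOp (isUnit_iff_ne_zero.1 hP)
  set u : CoordSpace n := c⁻¹ • Ring.inverse B v with hu
  have hBv : B (Ring.inverse B v) = v := by
    rw [← mul_apply_eq_comp, Ring.mul_inverse_cancel _ hBu]; rfl
  have hBu' : c • B u = v := by
    rw [hu, map_smul, hBv, smul_smul, mul_inv_cancel₀ hc.ne', one_smul]
  have hu1 : inner ℝ (minkOp n u) u = -1 := by
    rw [← h1, mul_apply_eq_comp, mul_apply_eq_comp, inner_star_apply]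
    rw [← hBu', map_smul, real_inner_smul_left, real_inner_smul_right] at hv
    field_simp at hv
    linarith
  obtain ⟨Λ, hΛ, hΛ0⟩ := exists_minkOp_isometry hu1
  have hΛu : IsUnit Λ := by
    have h2 : minkOp n * star Λ * minkOp n * Λ = 1 := by
      rw [mul_assoc (minkOp n), mul_assoc (minkOp n), hΛ, minkOp_mul_self]
    have h3 : Function.Injective Λ := fun x y hxy => by
      have := congrArg (minkOp n * star Λ * minkOp n) hxy
      rwa [← mul_apply_eq_comp, ← mul_apply_eq_comp, h2] at this
    exact (ContinuousLinearMap.isUnit_iff_bijective).2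
      ⟨h3, LinearMap.surjective_of_injective (f := (Λ : CoordSpace n →ₗ[ℝ] CoordSpace n)) h3⟩
  refine ⟨B * Λ, hBu.mul hΛu, ?_, ?_⟩
  · rw [star_mul, ← hΛ, ← h1]
    simp only [mul_assoc]
  · rw [mul_apply_eq_comp, hΛ0, hBu']

end LorentzFinsler

/-! ### Parallel frames along a timelike geodesic -/

namespace LorentzFinsler

open Set

variable {n : ℕ} {M : Type*} [TopologicalSpace M] [ChartedSpace (CoordSpace n) M]
  [IsManifold (𝓡 (n + 1)) ∞ M]

theorem ordConnected_interval (a b : EReal) : (interval a b).OrdConnected :=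
  ⟨fun _ hx _ hy _ hz => ⟨hx.1.trans_le (EReal.coe_le_coe_iff.2 hz.1),
    (EReal.coe_le_coe_iff.2 hz.2).trans_lt hy.2⟩⟩

theorem nonempty_interval {a b : EReal} (hab : a < b) : (interval a b).Nonempty := by
  obtain ⟨t, h1, h2⟩ := EReal.lt_iff_exists_real_btwn.1 hab
  exact ⟨t, h1, h2⟩

/-- The differential at `q` of the chart labelled by `p`, as an operator on the coordinate space. -/
noncomputable def toOp (p q : M) : CoordSpace n →L[ℝ] CoordSpace n :=
  (trivializationAt (CoordSpace n) (TangentSpace (𝓡 (n + 1)) : M → Type _) p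
    ).continuousLinearMapAt ℝ q

/-- The inverse of `toOp p q`. -/
noncomputable def ofOp (p q : M) : CoordSpace n →L[ℝ] CoordSpace n :=
  (trivializationAt (CoordSpace n) (TangentSpace (𝓡 (n + 1)) : M → Type _) p).symmL ℝ q

theorem toOp_apply (p q : M) (u : CoordSpace n) : toOp p q u = toCoord p q u := rfl

theorem toOp_mul_ofOp {p q : M} (hq : q ∈ (extChartAt (𝓡 (n + 1)) p).source) :
    toOp (n := n) p q * ofOp p q = 1 := ContinuousLinearMap.ext fun u => toCoord_ofCoord hq u

theorem ofOp_mul_toOp {p q : M} (hq : q ∈ (extChartAt (𝓡 (n + 1)) p).source) :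
    ofOp (n := n) p q * toOp p q = 1 := ContinuousLinearMap.ext fun u => ofCoord_toCoord hq u

theorem isUnit_toOp {p q : M} (hq : q ∈ (extChartAt (𝓡 (n + 1)) p).source) :
    IsUnit (toOp (n := n) p q) :=
  ⟨⟨_, _, toOp_mul_ofOp hq, ofOp_mul_toOp hq⟩, rfl⟩

theorem matOp_jacC_mul_toOp {p q m : M} (hp : m ∈ (extChartAt (𝓡 (n + 1)) p).source)
    (hq : m ∈ (extChartAt (𝓡 (n + 1)) q).source) (v : CoordSpace n) :
    matOp (fun κ j => jacC (transMap p q) κ j (extChartAt (𝓡 (n + 1)) p m) v) * toOp p m =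
      toOp q m := by
  have h1 := (extChartAt (𝓡 (n + 1)) p).left_inv hp
  have h2 := matOp_jacC_transMap (v := v) ((extChartAt (𝓡 (n + 1)) p).map_source hp)
    (q := q) (by rwa [h1])
  generalize (extChartAt (𝓡 (n + 1)) p).symm (extChartAt (𝓡 (n + 1)) p m) = m' at h1 h2
  subst h1
  ext1 u
  rw [mul_apply_eq_comp, h2, toOp_apply]
  exact congrArg (toCoord q m') (ofCoord_toCoord hp u)

/-- The operator with matrix entries `A i j (x, v)` in the chart labelled by `p`, along the tangent
vectors of `η`. -/
noncomputable abbrev chartOp (η : ℝ → M) (p : M)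
    (A : Fin (n + 1) → Fin (n + 1) → CoordSpace n → CoordSpace n → ℝ) (t : ℝ) :
    CoordSpace n →L[ℝ] CoordSpace n :=
  alongOp A (coordCurve p η) (deriv (coordCurve p η)) t

/-- The times at which a curve on `(a, b)` is in the domain of the chart labelled by `p`. -/
abbrev chartTimes (n : ℕ) {M : Type*} [TopologicalSpace M] [ChartedSpace (CoordSpace n) M]
    (η : ℝ → M) (a b : EReal) (p : M) : Set ℝ :=
  interval a b ∩ η ⁻¹' (extChartAt (𝓡 (n + 1)) p).source

/-- A frame `X` along `η`, given in the canonical coordinates of the tangent spaces, in the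
coordinates of the chart labelled by `p`. -/
noncomputable def frameIn (η : ℝ → M) (X : ℝ → CoordSpace n →L[ℝ] CoordSpace n) (p : M) (t : ℝ) :
    CoordSpace n →L[ℝ] CoordSpace n :=
  toOp p (η t) * X t

/-- `X` is a parallel frame along `η` that is orthonormal for `g_{η̇}` and whose first vector is
`η̇ / c`. -/
structure IsLorentzFrame (S : FinslerSpacetime n M) (η : ℝ → M) (a b : EReal) (c : ℝ)
    (X : ℝ → CoordSpace n →L[ℝ] CoordSpace n) : Prop where
  isUnit : ∀ p, ∀ t ∈ chartTimes n η a b p, IsUnit (frameIn η X p t)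
  parallel : ∀ p, ∀ t ∈ chartTimes n η a b p, HasDerivAt (frameIn η X p)
    (-(chartOp η p (nonlinConn S.L p) t * frameIn η X p t)) t
  metric : ∀ p, ∀ t ∈ chartTimes n η a b p,
    star (frameIn η X p t) * chartOp η p (gLow S.L p) t * frameIn η X p t = minkOp n
  vel : ∀ p, ∀ t ∈ chartTimes n η a b p,
    deriv (coordCurve p η) t = c • frameIn η X p t (coordBasis 0)

variable {S : FinslerSpacetime n M} {η : ℝ → M} {a b : EReal} {t : ℝ}

omit [IsManifold (𝓡 (n + 1)) ∞ M] in
theorem mem_chartTimes_self (ht : t ∈ interval a b) : t ∈ chartTimes n η a b (η t) :=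
  ⟨ht, mem_extChartAt_source _⟩

theorem jac_mul_frameIn (X : ℝ → CoordSpace n →L[ℝ] CoordSpace n) {p q : M}
    (hp : t ∈ chartTimes n η a b p) (hq : t ∈ chartTimes n η a b q) :
    chartOp η p (jacC (transMap p q)) t * frameIn η X p t = frameIn η X q t := by
  rw [frameIn, frameIn, ← mul_assoc]
  congr 1
  exact matOp_jacC_mul_toOp hp.2 hq.2 _

theorem star_op_neg (A : CoordSpace n →L[ℝ] CoordSpace n) : star (-A) = -star A := star_neg A

/-- If `Eᵗ g E = D` with `D² = 1`, then `D Eᵗ g` is the inverse of `E`. -/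
theorem mul_eq_one_of_conj {A : Type*} [Ring A] {E Es g D : A} (hE : IsUnit E) (hD : D * D = 1)
    (h : Es * g * E = D) : E * (D * (Es * g)) = 1 := by
  obtain ⟨u, rfl⟩ := hE
  have h1 : D * (Es * g) * u = 1 := by rw [mul_assoc, h, hD]
  have h2 : D * (Es * g) = ↑u⁻¹ := Units.eq_inv_of_mul_eq_one_right h1
  rw [h2, Units.mul_inv]

/-- `Eᵗ g E` has zero derivative if `E' = -N E` and `g' = g N + Nᵗ g`. -/
theorem conj_deriv_eq_zero {A : Type*} [Ring A] (E Es g N Ns : A) :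
    (-(Es * Ns) * g + Es * (g * N + Ns * g)) * E + Es * g * -(N * E) = 0 := by
  noncomm_ring

/-- The transformation law of the nonlinear connection turns `E' = -N E` in one chart into the same
equation in another one. -/
theorem frame_deriv_eq {A : Type*} [Ring A] {T T' Np Nq E E' : A}
    (h : T * Np = Nq * T + T') (hE : T * E = E') : T' * E + T * (-Np * E) = -Nq * E' := by
  rw [← hE, neg_mul, mul_neg, ← mul_assoc T, h]
  noncomm_ring

namespace FinslerSpacetime.IsTimelikeGeodesic

variable (hη : S.IsTimelikeGeodesic η a b)
include hη

theorem isOpen_chartTimes (p : M) : IsOpen (chartTimes n η a b p) :=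
  hη.isOpen_inter_preimage (isOpen_extChartAt_source p)

theorem sprayCurve (p : M) : IsSprayCurve S.L p (chartDomain p univ) (coordCurve p η)
    (deriv (coordCurve p η)) (chartTimes n η a b p) := by
  have h := hη.isSprayCurve p isOpen_univ
  rwa [inter_univ] at h

theorem jac_apply_vel {p q : M} (hp : t ∈ chartTimes n η a b p) (hq : t ∈ chartTimes n η a b q) :
    chartOp (n := n) η p (jacC (transMap p q)) t (deriv (coordCurve p η) t) =
      deriv (coordCurve q η) t :=
  ((hη.isTransition p q).vel ⟨hp.1, hp.2, hq.2⟩).symm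

theorem g_eq {p q : M} (hp : t ∈ chartTimes n η a b p) (hq : t ∈ chartTimes n η a b q) :
    chartOp η p (gLow S.L p) t = star (chartOp η p (jacC (transMap p q)) t) *
      chartOp η q (gLow S.L q) t * chartOp η p (jacC (transMap p q)) t :=
  (hη.isTransition p q).g_eq ⟨hp.1, hp.2, hq.2⟩

theorem jac_mul_curv {p q : M} (hp : t ∈ chartTimes n η a b p) (hq : t ∈ chartTimes n η a b q) :
    chartOp η p (jacC (transMap p q)) t * chartOp η p (curvCoeff S.L p) t =
      chartOp η q (curvCoeff S.L q) t * chartOp η p (jacC (transMap p q)) t :=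
  (hη.isTransition p q).jac_mul_curv ⟨hp.1, hp.2, hq.2⟩

/-- A quantity that does not depend on the chart and has zero derivative in every chart is constant
along the geodesic. -/
theorem eq_of_hasDerivAt_zero {V : Type*} [NormedAddCommGroup V] [NormedSpace ℝ V] {f : M → ℝ → V}
    (hf : ∀ p q, ∀ t ∈ chartTimes n η a b p, t ∈ chartTimes n η a b q → f p t = f q t)
    (hd : ∀ p, ∀ t ∈ chartTimes n η a b p, HasDerivAt (f p) 0 t) {p q : M} {s : ℝ}
    (hs : s ∈ chartTimes n η a b p) (ht : t ∈ chartTimes n η a b q) : f p s = f q t := by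
  have h1 : ∀ u ∈ interval a b, HasDerivAt (fun s => f (η s) s) 0 u := fun u hu => by
    refine (hd (η u) u (mem_chartTimes_self hu)).congr_of_eventuallyEq ?_
    filter_upwards [(hη.isOpen_chartTimes (η u)).mem_nhds (mem_chartTimes_self hu)] with r hr
    exact hf _ _ r (mem_chartTimes_self hr.1) hr
  have h2 := (isOpen_interval a b).is_const_of_deriv_eq_zero
    (ordConnected_interval a b).isPreconnected
    (fun u hu => (h1 u hu).differentiableAt.differentiableWithinAt) (fun u hu => (h1 u hu).deriv)
    hs.1 ht.1
  rw [hf p (η s) s hs (mem_chartTimes_self hs.1), hf q (η t) t ht (mem_chartTimes_self ht.1)]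
  exact h2

/-- The system of linear differential equations `E' = - N E` in the charts that expresses that a
frame is parallel. -/
noncomputable def parallelODE : BundleODE (CoordSpace n) M (interval a b) where
  J := chartTimes n η a b
  T p t := toOp p (η t)
  B p t := -chartOp η p (nonlinConn S.L p) t
  isOpen_J := hη.isOpen_chartTimes
  isUnit_T p t ht := isUnit_toOp ht.2
  continuousOn_B p := ((hη.sprayCurve p).contDiffOn_alongOp
    (S.isFinslerOn p isOpen_univ).smooth_nonlinConn).continuousOn.neg
  compat p q t hp hq X hX := by
    have htr := hη.isTransition p q
    have ht : t ∈ interval a b ∩ η ⁻¹' ((extChartAt (𝓡 (n + 1)) p).source ∩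
      (extChartAt (𝓡 (n + 1)) q).source) := ⟨hp.1, hp.2, hq.2⟩
    have h1 := ((htr.hasDerivAt_jac ht).fun_mul hX).congr_of_eventuallyEq (f₁ := frameIn η X q) (by
      filter_upwards [htr.curve_left.isOpen.mem_nhds ht] with s hs
      exact (jac_mul_frameIn X ⟨hs.1, hs.2.1⟩ ⟨hs.1, hs.2.2⟩).symm)
    exact h1.congr_deriv (frame_deriv_eq (htr.jac_mul_nonlinConn ht) (jac_mul_frameIn X hp hq))
  cover t ht := ⟨η t, mem_chartTimes_self ht⟩

/-- `g_v(v, v) = 2 L(v)`, by Euler's identity. -/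
theorem inner_g_vel {p : M} (ht : t ∈ chartTimes n η a b p) :
    inner ℝ (chartOp η p (gLow S.L p) t (deriv (coordCurve p η) t)) (deriv (coordCurve p η) t) =
      2 * S.L (lift η t) := by
  have hF := S.isFinslerOn p isOpen_univ
  have hz := (hη.sprayCurve p).mem t ht
  have h1 : localL S.L p (coordCurve p η t) (deriv (coordCurve p η) t) = S.L (lift η t) := by
    rw [localL_eq, ← hη.toCoord_velocity ht.1 ht.2, coordCurve, ofChart_extChartAt ht.2]
    rfl
  rw [← h1, ← hF.euler _ _ hz, real_inner_comm, PiLp.inner_apply]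
  refine Finset.sum_congr rfl fun α _ => ?_
  rw [← hF.sum_gLow_mul_coord hz]
  rfl

theorem L_neg (ht : t ∈ interval a b) : S.L (lift η t) < 0 := (hη.timelike t ht).1

/-- Parallel transport of an orthonormal frame yields a parallel orthonormal frame. -/
theorem exists_isLorentzFrame (hab : a < b) : ∃ c > 0, ∃ X, IsLorentzFrame S η a b c X := by
  obtain ⟨t₀, ht₀⟩ := nonempty_interval hab
  have hp₀ := mem_chartTimes_self (n := n) (η := η) ht₀
  set c := Real.sqrt (-2 * S.L (lift η t₀)) with hc
  have hL := hη.L_neg ht₀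
  have hc0 : 0 < c := Real.sqrt_pos.2 (by linarith)
  have hc2 : c ^ 2 = -2 * S.L (lift η t₀) := Real.sq_sqrt (by linarith)
  have hz₀ := (hη.sprayCurve (η t₀)).mem t₀ hp₀
  obtain ⟨B, hB, hBg, hBv⟩ := HasLorentzSignature.exists_frame
    (S.signature (η t₀) _ _ hz₀.1 hz₀.2.2) hc0 (v := deriv (coordCurve (η t₀) η) t₀)
    ((hη.inner_g_vel hp₀).trans (by rw [hc2]; ring))
  obtain ⟨X, hX₀, hX⟩ := hη.parallelODE.exists_sol (isOpen_interval a b)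
    (ordConnected_interval a b) ht₀ (A := ofOp (η t₀) (η t₀) * B)
    (IsUnit.mul ⟨⟨_, _, ofOp_mul_toOp hp₀.2, toOp_mul_ofOp hp₀.2⟩, rfl⟩ hB)
  have hfr₀ : frameIn η X (η t₀) t₀ = B := by
    rw [frameIn, hX₀, ← mul_assoc, toOp_mul_ofOp hp₀.2, one_mul]
  have hunit : ∀ p, ∀ t ∈ chartTimes n η a b p, IsUnit (frameIn η X p t) := fun p t ht =>
    (isUnit_toOp ht.2).mul (hX t ht.1).1
  have hpar : ∀ p, ∀ t ∈ chartTimes n η a b p, HasDerivAt (frameIn η X p)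
      (-(chartOp η p (nonlinConn S.L p) t * frameIn η X p t)) t := fun p t ht =>
    ((hX t ht.1).2 p ht).congr_deriv (neg_mul _ _)
  have hmet : ∀ p, ∀ t ∈ chartTimes n η a b p,
      star (frameIn η X p t) * chartOp η p (gLow S.L p) t * frameIn η X p t = minkOp n := by
    intro p t ht
    rw [← hBg, ← hfr₀]
    refine hη.eq_of_hasDerivAt_zero (f := fun p t => star (frameIn η X p t) *
      chartOp η p (gLow S.L p) t * frameIn η X p t) (fun p q t hp hq => ?_) (fun p t ht => ?_)
      ht hp₀
    · have h1 := hη.g_eq hp hq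
      have h2 := jac_mul_frameIn X hp hq
      beta_reduce
      rw [← h2, star_mul, h1]
      simp only [mul_assoc]
    · refine (((hpar p t ht).star.fun_mul ((hη.sprayCurve p).hasDerivAt_g
        (S.isFinslerOn p isOpen_univ) ht)).fun_mul (hpar p t ht)).congr_deriv ?_
      rw [star_op_neg, star_mul]
      exact conj_deriv_eq_zero _ _ _ _ _
  refine ⟨c, hc0, X, hunit, hpar, hmet, fun p t ht => ?_⟩
  -- The components of `η̇` in the frame are constant, since both are parallel.
  have hvel : star (frameIn η X p t) (chartOp η p (gLow S.L p) t (deriv (coordCurve p η) t)) =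
      star (frameIn η X (η t₀) t₀) (chartOp η (η t₀) (gLow S.L (η t₀)) t₀
        (deriv (coordCurve (η t₀) η) t₀)) := by
    refine hη.eq_of_hasDerivAt_zero (f := fun p t => star (frameIn η X p t)
      (chartOp η p (gLow S.L p) t (deriv (coordCurve p η) t)))
      (fun p q t hp hq => ?_) (fun p t ht => ?_) ht hp₀
    · have h1 := hη.g_eq hp hq
      have h2 := jac_mul_frameIn X hp hq
      beta_reduce
      rw [← h2, star_mul, ← hη.jac_apply_vel hp hq, h1]
      rfl
    · have hF := S.isFinslerOn p isOpen_univ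
      refine ((hpar p t ht).star.clm_apply (((hη.sprayCurve p).hasDerivAt_g hF ht).clm_apply
        ((hη.sprayCurve p).hasDerivAt_vel hF ht))).congr_deriv ?_
      rw [star_op_neg, star_mul]
      simp only [neg_apply, add_apply, mul_apply_eq_comp, map_neg, map_add]
      abel
  have h1 := mul_eq_one_of_conj (hunit p t ht) minkOp_mul_self (hmet p t ht)
  have h2 : deriv (coordCurve p η) t = frameIn η X p t (minkOp n (star (frameIn η X p t)
      (chartOp η p (gLow S.L p) t (deriv (coordCurve p η) t)))) :=
    (congrArg (fun A => A (deriv (coordCurve p η) t)) h1).symm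
  have h3 : star (frameIn η X (η t₀) t₀) (chartOp η (η t₀) (gLow S.L (η t₀)) t₀
        (deriv (coordCurve (η t₀) η) t₀)) = c • minkOp n (coordBasis 0) := by
    rw [hBv, hfr₀, ← hBg, map_smul, map_smul]
    rfl
  rw [h2, hvel, h3, map_smul, map_smul, ← mul_apply_eq_comp (minkOp n), minkOp_mul_self]
  rfl

end FinslerSpacetime.IsTimelikeGeodesic

end LorentzFinsler

/-! ### Curvature in a parallel frame -/

namespace LorentzFinsler

open Set

variable {n : ℕ} {M : Type*} [TopologicalSpace M] [ChartedSpace (CoordSpace n) M]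
  [IsManifold (𝓡 (n + 1)) ∞ M]

/-- The map `u ↦ (u^1, …, u^n)` that forgets the coordinate `u^0`. -/
noncomputable def spatialProj (n : ℕ) : CoordSpace n →L[ℝ] EuclideanSpace ℝ (Fin n) :=
  LinearMap.toContinuousLinearMap
    { toFun := fun u => WithLp.toLp 2 fun i => u i.succ
      map_add' := fun _ _ => rfl
      map_smul' := fun _ _ => rfl }

/-- The map `y ↦ (0, y^1, …, y^n)`. -/
noncomputable def spatialIncl (n : ℕ) : EuclideanSpace ℝ (Fin n) →L[ℝ] CoordSpace n :=
  LinearMap.toContinuousLinearMap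
    { toFun := fun y => WithLp.toLp 2 (Fin.cons 0 fun i => y i)
      map_add' := fun x y => by
        ext i
        refine Fin.cases ?_ (fun i => ?_) i <;> simp
      map_smul' := fun c y => by
        ext i
        refine Fin.cases ?_ (fun i => ?_) i <;> simp }

@[simp] theorem spatialProj_apply (u : CoordSpace n) (i : Fin n) :
    spatialProj n u i = u i.succ := rfl

@[simp] theorem spatialIncl_zero (y : EuclideanSpace ℝ (Fin n)) : spatialIncl n y 0 = 0 := rfl

@[simp] theorem spatialIncl_succ (y : EuclideanSpace ℝ (Fin n)) (i : Fin n) :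
    spatialIncl n y i.succ = y i := rfl

theorem spatialIncl_eq_zero {y : EuclideanSpace ℝ (Fin n)} : spatialIncl n y = 0 ↔ y = 0 := by
  refine ⟨fun h => ?_, fun h => by rw [h, map_zero]⟩
  ext i
  rw [← spatialIncl_succ, h]
  rfl

theorem spatialIncl_spatialProj {u : CoordSpace n} (hu : u 0 = 0) :
    spatialIncl n (spatialProj n u) = u := by
  ext i
  refine Fin.cases ?_ (fun i => ?_) i
  · rw [spatialIncl_zero, hu]
  · rw [spatialIncl_succ, spatialProj_apply]

theorem smul_add_spatialIncl (u : CoordSpace n) :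
    u = u 0 • coordBasis 0 + spatialIncl n (spatialProj n u) := by
  ext i
  refine Fin.cases ?_ (fun i => ?_) i <;> simp [coordBasis, Fin.succ_ne_zero]

theorem inner_spatialProj (u : CoordSpace n) (y : EuclideanSpace ℝ (Fin n)) :
    inner ℝ (spatialProj n u) y = inner ℝ u (spatialIncl n y) := by
  rw [PiLp.inner_apply, PiLp.inner_apply, Fin.sum_univ_succ]
  simp

theorem minkOp_spatialIncl (y : EuclideanSpace ℝ (Fin n)) :
    minkOp n (spatialIncl n y) = spatialIncl n y := by
  ext i
  rw [minkOp_apply]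
  refine Fin.cases ?_ (fun i => ?_) i <;> simp [Fin.succ_ne_zero]

theorem traceL_eq_sum_coord {m : ℕ} (A : EuclideanSpace ℝ (Fin m) →L[ℝ] EuclideanSpace ℝ (Fin m)) :
    traceL _ A = ∑ i, A (EuclideanSpace.single i 1) i := by
  rw [traceL_eq_sum (EuclideanSpace.basisFun (Fin m) ℝ)]
  refine Finset.sum_congr rfl fun i _ => ?_
  rw [EuclideanSpace.basisFun_apply, EuclideanSpace.inner_single_left]
  simp

theorem traceL_mul_comm {m : ℕ} (A B : EuclideanSpace ℝ (Fin m) →L[ℝ] EuclideanSpace ℝ (Fin m)) :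
    traceL _ (A * B) = traceL _ (B * A) := by
  rw [traceL_apply, traceL_apply]
  exact LinearMap.trace_mul_comm ℝ (A : EuclideanSpace ℝ (Fin m) →ₗ[ℝ] EuclideanSpace ℝ (Fin m)) B

/-- `R_v(v) = 0`, by differentiation of `N v = 2 G` along the geodesic. -/
theorem IsSprayCurve.curv_apply_vel {L : TangentBundle (𝓡 (n + 1)) M → ℝ} {p : M}
    {W : Set (CoordSpace n × CoordSpace n)} {ξ ζ : ℝ → CoordSpace n} {J : Set ℝ} {t : ℝ}
    (hc : IsSprayCurve L p W ξ ζ J) (h : IsFinslerOn L p W) (ht : t ∈ J) :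
    alongOp (curvCoeff L p) ξ ζ t (ζ t) = 0 := by
  have hz := hc.mem t ht
  set G : ℝ → CoordSpace n := fun s => WithLp.toLp 2 fun α => 2 * sprayCoeff L p α (ξ s) (ζ s)
  have hG : ∀ s ∈ J, alongOp (nonlinConn L p) ξ ζ s (ζ s) = G s := fun s hs => by
    ext α
    rw [alongOp, matOp_apply, h.sum_nonlinConn_mul_coord (hc.mem s hs)]
  have h1 : HasDerivAt G (WithLp.toLp 2 fun α => 2 * sprayDeriv L p (sprayCoeff L p α) (ξ t) (ζ t))
      t := hasDerivAt_toLp fun α => (hc.hasDerivAt_comp h (h.smooth_sprayCoeff α) ht).const_mul 2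
  have h2 := ((hc.hasDerivAt_alongOp h h.smooth_nonlinConn ht).clm_apply
    (hc.deriv_vel t ht)).unique (h1.congr_of_eventuallyEq (by
      filter_upwards [hc.isOpen.mem_nhds ht] with s hs using hG s hs))
  ext α
  have h3 := congrArg (fun u : CoordSpace n => u α) h2
  simp only [PiLp.add_apply, alongOp, matOp_apply] at h3
  rw [alongOp, matOp_apply, PiLp.zero_apply]
  have h4 : ∀ γ, ∑ β, nonlinConn L p γ β (ξ t) (ζ t) * ζ t β = 2 * sprayCoeff L p γ (ξ t) (ζ t) :=
    h.sum_nonlinConn_mul_coord hz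
  have h5 : ∑ β, (∑ γ, nonlinConn L p α γ (ξ t) (ζ t) * nonlinConn L p γ β (ξ t) (ζ t)) * ζ t β =
      ∑ γ, nonlinConn L p α γ (ξ t) (ζ t) * (2 * sprayCoeff L p γ (ξ t) (ζ t)) := by
    simp_rw [← h4, Finset.sum_mul, Finset.mul_sum]
    rw [Finset.sum_comm]
    simp only [mul_assoc]
  have h6 : ∑ β, curvCoeff L p α β (ξ t) (ζ t) * ζ t β =
      2 * ∑ β, dX β (sprayCoeff L p α) (ξ t) (ζ t) * ζ t β
      - ∑ β, sprayDeriv L p (nonlinConn L p α β) (ξ t) (ζ t) * ζ t β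
      - ∑ β, (∑ γ, nonlinConn L p α γ (ξ t) (ζ t) * nonlinConn L p γ β (ξ t) (ζ t)) * ζ t β := by
    rw [Finset.mul_sum, ← Finset.sum_sub_distrib, ← Finset.sum_sub_distrib]
    refine Finset.sum_congr rfl fun β _ => ?_
    rw [curvCoeff, sprayDeriv, Finset.sum_sub_distrib, Finset.mul_sum]
    simp only [mul_assoc]
    ring
  have h7 : ∑ γ, nonlinConn L p α γ (ξ t) (ζ t) * -(2 * sprayCoeff L p γ (ξ t) (ζ t)) =
      -∑ γ, nonlinConn L p α γ (ξ t) (ζ t) * (2 * sprayCoeff L p γ (ξ t) (ζ t)) := by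
    simp only [mul_neg, Finset.sum_neg_distrib]
  have h8 : 2 * sprayDeriv L p (sprayCoeff L p α) (ξ t) (ζ t) =
      2 * ∑ β, dX β (sprayCoeff L p α) (ξ t) (ζ t) * ζ t β -
      2 * ∑ γ, nonlinConn L p α γ (ξ t) (ζ t) * (2 * sprayCoeff L p γ (ξ t) (ζ t)) := by
    have h9 : ∑ γ, nonlinConn L p α γ (ξ t) (ζ t) * (2 * sprayCoeff L p γ (ξ t) (ζ t)) =
        2 * ∑ γ, dV γ (sprayCoeff L p α) (ξ t) (ζ t) * sprayCoeff L p γ (ξ t) (ζ t) := by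
      rw [Finset.mul_sum]
      exact Finset.sum_congr rfl fun γ _ => by rw [nonlinConn]; ring
    rw [h9, sprayDeriv]; ring
  rw [h6, h5]
  rw [h7, h8] at h3
  linarith

theorem smooth_curvCoeff {L : TangentBundle (𝓡 (n + 1)) M → ℝ} {p : M}
    {W : Set (CoordSpace n × CoordSpace n)} (h : IsFinslerOn L p W) (α β : Fin (n + 1)) :
    SmoothPV W (curvCoeff L p α β) := by
  have hN := h.smooth_nonlinConn
  have hG := h.smooth_sprayCoeff
  have h1 : SmoothPV W (fun x v => 2 * dX β (sprayCoeff L p α) x v) :=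
    ((hG α).dX h.isOpen β).const_mul 2
  have h2 : SmoothPV W (fun x v => ∑ γ, (dX γ (nonlinConn L p α β) x v * v γ
      - 2 * dV γ (nonlinConn L p α β) x v * sprayCoeff L p γ x v)) :=
    SmoothPV.sum _ fun γ _ => (((hN α β).dX h.isOpen γ).mul (smoothPV_coord γ)).sub
      ((((hN α β).dV h.isOpen γ).const_mul 2).mul (hG γ))
  have h3 : SmoothPV W (fun x v => ∑ γ, nonlinConn L p α γ x v * nonlinConn L p γ β x v) :=
    SmoothPV.sum _ fun γ _ => (hN α γ).mul (hN γ β)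
  exact (h1.sub h2).sub h3

/-- The bilinear form `g_{η̇}(·, R_{η̇}(·))` in a frame along `η`. -/
noncomputable def frameCurv (S : FinslerSpacetime n M) (η : ℝ → M)
    (X : ℝ → CoordSpace n →L[ℝ] CoordSpace n) (p : M) (t : ℝ) : CoordSpace n →L[ℝ] CoordSpace n :=
  star (frameIn η X p t) * (chartOp η p (gLow S.L p) t * chartOp η p (curvCoeff S.L p) t) *
    frameIn η X p t

/-- The curvature endomorphism on the orthogonal complement of `η̇` in a Lorentz frame along `η`. On
the spatial vectors of the frame the metric is Euclidean, so that the bilinear form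
`g_{η̇}(·, R_{η̇}(·))` and the endomorphism have the same matrix. -/
noncomputable def spatialCurv (S : FinslerSpacetime n M) (η : ℝ → M)
    (X : ℝ → CoordSpace n →L[ℝ] CoordSpace n) (t : ℝ) :
    EuclideanSpace ℝ (Fin n) →L[ℝ] EuclideanSpace ℝ (Fin n) :=
  (spatialProj n).comp ((frameCurv S η X (η t) t).comp (spatialIncl n))

variable {S : FinslerSpacetime n M} {η : ℝ → M} {a b : EReal} {t : ℝ}
  {X : ℝ → CoordSpace n →L[ℝ] CoordSpace n} {c : ℝ}

theorem star_frameCurv (hη : S.IsTimelikeGeodesic η a b) {p : M} (ht : t ∈ chartTimes n η a b p) :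
    star (frameCurv S η X p t) = frameCurv S η X p t := by
  rw [frameCurv, star_mul, star_mul, star_star, (hη.sprayCurve p).star_g_mul_curv
    (S.isFinslerOn p isOpen_univ) ht]
  exact (mul_assoc _ _ _).symm

/-- The curvature form in a frame does not depend on the chart. -/
theorem frameCurv_eq (hη : S.IsTimelikeGeodesic η a b) {p q : M} (hp : t ∈ chartTimes n η a b p)
    (hq : t ∈ chartTimes n η a b q) : frameCurv S η X p t = frameCurv S η X q t := by
  have h1 := hη.g_eq hp hq
  have h2 := hη.jac_mul_curv hp hq
  rw [frameCurv, frameCurv, ← jac_mul_frameIn X hp hq, star_mul, h1, mul_assoc _ _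
    (chartOp η p (curvCoeff S.L p) t), h2]
  simp only [mul_assoc]

theorem continuousOn_spatialCurv (hη : S.IsTimelikeGeodesic η a b)
    (hX : IsLorentzFrame S η a b c X) : ContinuousOn (spatialCurv S η X) (interval a b) := by
  intro t ht
  have ht' := mem_chartTimes_self (n := n) (η := η) ht
  have hF := S.isFinslerOn (η t) isOpen_univ
  have hsc := hη.sprayCurve (η t)
  have hmem := (hη.isOpen_chartTimes (η t)).mem_nhds ht'
  have hE := (hX.parallel (η t) t ht').continuousAt
  have hg := ((hsc.contDiffOn_alongOp hF.smooth_gLow).continuousOn).continuousAt hmem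
  have hR := ((hsc.contDiffOn_alongOp (smooth_curvCoeff hF)).continuousOn).continuousAt hmem
  have hEs := (hX.parallel (η t) t ht').star
  have h1 : ContinuousAt (frameCurv S η X (η t)) t := (hEs.continuousAt.mul (hg.mul hR)).mul hE
  have h2 : ContinuousAt (fun s => (spatialProj n).comp
      ((frameCurv S η X (η t) s).comp (spatialIncl n))) t :=
    continuousAt_const.clm_comp (h1.clm_comp continuousAt_const)
  refine (h2.congr ?_).continuousWithinAt
  filter_upwards [hmem] with s hs
  rw [spatialCurv, frameCurv_eq hη hs (mem_chartTimes_self hs.1)]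

theorem frameIn_mul_minkOp (hX : IsLorentzFrame S η a b c X) {p : M}
    (ht : t ∈ chartTimes n η a b p) :
    frameIn η X p t * (minkOp n * (star (frameIn η X p t) * chartOp η p (gLow S.L p) t)) = 1 :=
  mul_eq_one_of_conj (hX.isUnit p t ht) minkOp_mul_self (hX.metric p t ht)

section

variable (hη : S.IsTimelikeGeodesic η a b) (hX : IsLorentzFrame S η a b c X)
include hη hX

/-- The curvature endomorphism of `η̇` annihilates `η̇`. -/
theorem curv_frame_zero (hc : 0 < c) {p : M} (ht : t ∈ chartTimes n η a b p) :
    chartOp η p (curvCoeff S.L p) t (frameIn η X p t (coordBasis 0)) = 0 := by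
  have h1 := (hη.sprayCurve p).curv_apply_vel (S.isFinslerOn p isOpen_univ) ht
  rw [hX.vel p t ht, map_smul] at h1
  exact (smul_eq_zero.1 h1).resolve_left hc.ne'

/-- The image of the curvature endomorphism is orthogonal to `η̇`. -/
theorem frameCurv_apply_zero (hc : 0 < c) (ht : t ∈ interval a b) (u : CoordSpace n) :
    frameCurv S η X (η t) t u 0 = 0 := by
  have ht' := mem_chartTimes_self (n := n) (η := η) ht
  have h1 : frameCurv S η X (η t) t (coordBasis 0) = 0 := by
    change star (frameIn η X (η t) t) (chartOp η (η t) (gLow S.L (η t)) t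
      (chartOp η (η t) (curvCoeff S.L (η t)) t (frameIn η X (η t) t (coordBasis 0)))) = 0
    rw [curv_frame_zero hη hX hc ht', map_zero, map_zero]
  have h2 : frameCurv S η X (η t) t u 0 =
      inner ℝ (coordBasis 0) (frameCurv S η X (η t) t u) := by
    rw [coordBasis, EuclideanSpace.inner_single_left]; simp
  rw [h2, ← inner_star_apply, star_frameCurv hη ht', h1, inner_zero_left]

theorem spatialIncl_spatialCurv (hc : 0 < c) (ht : t ∈ interval a b)
    (y : EuclideanSpace ℝ (Fin n)) :
    spatialIncl n (spatialCurv S η X t y) = frameCurv S η X (η t) t (spatialIncl n y) :=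
  spatialIncl_spatialProj (frameCurv_apply_zero hη hX hc ht _)

theorem frameIn_spatialCurv (hc : 0 < c) (ht : t ∈ interval a b)
    (y : EuclideanSpace ℝ (Fin n)) :
    frameIn η X (η t) t (spatialIncl n (spatialCurv S η X t y)) =
      chartOp η (η t) (curvCoeff S.L (η t)) t (frameIn η X (η t) t (spatialIncl n y)) := by
  have h1 := frameIn_mul_minkOp hX (mem_chartTimes_self (n := n) (η := η) ht)
  rw [← minkOp_spatialIncl, spatialIncl_spatialCurv hη hX hc ht]
  exact congrArg (fun A => A (chartOp η (η t) (curvCoeff S.L (η t)) t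
    (frameIn η X (η t) t (spatialIncl n y)))) h1

omit hX in
/-- The Jacobi operator is symmetric for the Euclidean inner product. -/
theorem inner_spatialCurv (X : ℝ → CoordSpace n →L[ℝ] CoordSpace n) (ht : t ∈ interval a b)
    (x y : EuclideanSpace ℝ (Fin n)) :
    inner ℝ (spatialCurv S η X t x) y = inner ℝ x (spatialCurv S η X t y) := by
  have h1 : ∀ x y, inner ℝ (spatialCurv S η X t x) y =
      inner ℝ (frameCurv S η X (η t) t (spatialIncl n x)) (spatialIncl n y) :=
    fun x y => inner_spatialProj _ y
  rw [h1, real_inner_comm (spatialCurv S η X t y), h1, inner_apply_star,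
    star_frameCurv hη (mem_chartTimes_self ht), real_inner_comm]

/-- The Jacobi operator has the Ricci curvature as its trace, since `η̇` contributes nothing to the
trace of `R_{η̇}`. -/
theorem traceL_spatialCurv (hc : 0 < c) (ht : t ∈ interval a b) :
    traceL _ (spatialCurv S η X t) = S.Ric (lift η t) := by
  have h1 : S.Ric (lift η t) = traceL _ (chartOp η (η t) (curvCoeff S.L (η t)) t) := by
    rw [traceL_eq_sum_coord]
    refine Finset.sum_congr rfl fun α _ => ?_
    have h2 : chartOp η (η t) (curvCoeff S.L (η t)) t (EuclideanSpace.single α 1) α =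
        curvCoeff S.L (η t) α α (coordCurve (η t) η t) (deriv (coordCurve (η t) η) t) := by
      refine (matOp_apply _ _ _).trans ?_
      simp
    rw [h2, ← hη.toCoord_velocity ht (mem_extChartAt_source _)]
    rfl
  have h2 := frameIn_mul_minkOp hX (mem_chartTimes_self (n := n) (η := η) ht)
  have h3 : traceL _ (chartOp η (η t) (curvCoeff S.L (η t)) t) =
      traceL _ (minkOp n * frameCurv S η X (η t) t) := by
    conv_lhs => rw [← one_mul (chartOp η (η t) (curvCoeff S.L (η t)) t), ← h2, mul_assoc,
      traceL_mul_comm]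
    simp only [frameCurv, mul_assoc]
  rw [h1, h3, traceL_eq_sum_coord, traceL_eq_sum_coord, Fin.sum_univ_succ, mul_apply_eq_comp,
    minkOp_apply, frameCurv_apply_zero hη hX hc ht, mul_zero, zero_add]
  refine Finset.sum_congr rfl fun i _ => ?_
  rw [mul_apply_eq_comp, minkOp_apply, if_neg (Fin.succ_ne_zero i), one_mul]
  change frameCurv S η X (η t) t (spatialIncl n (EuclideanSpace.single i 1)) i.succ = _
  have h4 : spatialIncl n (EuclideanSpace.single i 1) = EuclideanSpace.single i.succ 1 := by
    ext j
    refine Fin.cases ?_ (fun j => ?_) j <;> simp [(Fin.succ_ne_zero _).symm]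
  rw [h4]

/-- The curvature endomorphism vanishes if it does so on the orthogonal complement of `η̇`. -/
theorem chartOp_curv_eq_zero (hc : 0 < c) (ht : t ∈ interval a b)
    (hK : spatialCurv S η X t = 0) : chartOp η (η t) (curvCoeff S.L (η t)) t = 0 := by
  have ht' := mem_chartTimes_self (n := n) (η := η) ht
  have h1 := frameIn_mul_minkOp hX ht'
  ext1 w
  set u := (minkOp n * (star (frameIn η X (η t) t) * chartOp η (η t) (gLow S.L (η t)) t)) w
  have h2 : w = frameIn η X (η t) t u := (congrArg (fun A => A w) h1).symm
  rw [h2, smul_add_spatialIncl u, map_add, map_add, map_smul, map_smul,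
    curv_frame_zero hη hX hc ht', ← frameIn_spatialCurv hη hX hc ht, hK]
  simp

end

end LorentzFinsler

/-! ### Jacobi fields in a parallel frame -/

namespace LorentzFinsler

open Set

variable {n : ℕ} {M : Type*} [TopologicalSpace M] [ChartedSpace (CoordSpace n) M]
  [IsManifold (𝓡 (n + 1)) ∞ M] {S : FinslerSpacetime n M} {η : ℝ → M} {a b : EReal} {t : ℝ}
  {X : ℝ → CoordSpace n →L[ℝ] CoordSpace n} {c : ℝ}

/-- The vector field along `η` with components `y` in the frame `X`. -/
def frameField (η : ℝ → M) (X : ℝ → CoordSpace n →L[ℝ] CoordSpace n) (y : ℝ → CoordSpace n)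
    (t : ℝ) : TangentSpace (𝓡 (n + 1)) (η t) := X t (y t)

theorem ofCoord_frameIn (y : CoordSpace n) :
    ofCoord (η t) (η t) (frameIn η X (η t) t y) = (X t y : TangentSpace (𝓡 (n + 1)) (η t)) :=
  ofCoord_toCoord (mem_extChartAt_source (I := 𝓡 (n + 1)) (η t)) _

/-- In a chart the covariant derivative is `Y' + N Y`, since the Chern connection contracted with
the reference vector is the nonlinear connection. -/
theorem covDeriv_eq (hη : S.IsTimelikeGeodesic η a b) (ht : t ∈ interval a b)
    {Y : (t : ℝ) → TangentSpace (𝓡 (n + 1)) (η t)} {Y' : CoordSpace n}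
    (hY : HasDerivAt (coordField (η t) η Y) Y' t) :
    S.covDeriv η Y t = ofCoord (η t) (η t)
      (Y' + chartOp η (η t) (nonlinConn S.L (η t)) t (coordField (η t) η Y t)) := by
  rw [FinslerSpacetime.covDeriv, hY.deriv]
  congr 1
  ext α
  rw [PiLp.add_apply]
  change _ + _ = _ + matOp _ _ α
  rw [matOp_apply, Finset.sum_comm]
  congr 1
  refine Finset.sum_congr rfl fun γ _ => ?_
  rw [← Finset.sum_mul, (S.isFinslerOn (η t) isOpen_univ).sum_christoffel_mul_coord
    ((hη.sprayCurve (η t)).mem t (mem_chartTimes_self ht))]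

/-- Covariant differentiation is componentwise in a parallel frame. -/
theorem covDeriv_frameField (hη : S.IsTimelikeGeodesic η a b) (hX : IsLorentzFrame S η a b c X)
    (ht : t ∈ interval a b) {Y : (t : ℝ) → TangentSpace (𝓡 (n + 1)) (η t)}
    {y : ℝ → CoordSpace n} {y' : CoordSpace n} (hy : HasDerivAt y y' t)
    (hY : ∀ s ∈ interval a b, Y s = frameField η X y s) :
    S.covDeriv η Y t = (X t y' : TangentSpace (𝓡 (n + 1)) (η t)) := by
  have ht' := mem_chartTimes_self (n := n) (η := η) ht
  have h1 : ∀ s ∈ interval a b, coordField (η t) η Y s = frameIn η X (η t) s (y s) :=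
    fun s hs => by rw [coordField, hY s hs]; rfl
  have h2 : HasDerivAt (coordField (η t) η Y)
      (-(chartOp η (η t) (nonlinConn S.L (η t)) t * frameIn η X (η t) t) (y t) +
        frameIn η X (η t) t y') t := by
    refine ((hX.parallel (η t) t ht').clm_apply hy).congr_of_eventuallyEq ?_
    filter_upwards [(isOpen_interval a b).mem_nhds ht] with s hs using h1 s hs
  rw [covDeriv_eq hη ht h2, h1 t ht, mul_apply_eq_comp]
  refine Eq.trans ?_ (ofCoord_frameIn y')
  congr 1
  abel

theorem R_frameField (hη : S.IsTimelikeGeodesic η a b) (ht : t ∈ interval a b)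
    (w : TangentSpace (𝓡 (n + 1)) (η t)) :
    S.R (η t) (velocity η t) w =
      ofCoord (η t) (η t) (chartOp η (η t) (curvCoeff S.L (η t)) t (toCoord (η t) (η t) w)) := by
  rw [FinslerSpacetime.R, hη.toCoord_velocity ht (mem_extChartAt_source _)]
  rfl

theorem contDiffOn_succ_of_hasDerivAt {F : Type*} [NormedAddCommGroup F] [NormedSpace ℝ F]
    {f f' : ℝ → F} {I : Set ℝ} (hI : IsOpen I) {m : ℕ} (hf : ∀ t ∈ I, HasDerivAt f (f' t) t)
    (hf' : ContDiffOn ℝ m f' I) : ContDiffOn ℝ (m + 1) f I := by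
  rw [contDiffOn_succ_iff_deriv_of_isOpen hI]
  refine ⟨fun t ht => (hf t ht).differentiableAt.differentiableWithinAt, fun h => ?_,
    hf'.congr fun t ht => (hf t ht).deriv⟩
  exact absurd h (by simp)

/-- A parallel frame is of class `C²`, by bootstrapping in its differential equation. -/
theorem contDiffOn_frameIn (hη : S.IsTimelikeGeodesic η a b) (hX : IsLorentzFrame S η a b c X)
    (p : M) : ContDiffOn ℝ 2 (frameIn η X p) (chartTimes n η a b p) := by
  have hN : ContDiffOn ℝ ∞ (chartOp η p (nonlinConn S.L p)) (chartTimes n η a b p) :=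
    (hη.sprayCurve p).contDiffOn_alongOp (S.isFinslerOn p isOpen_univ).smooth_nonlinConn
  have h0 : ContDiffOn ℝ ((0 : ℕ) : ℕ∞ω) (frameIn η X p) (chartTimes n η a b p) :=
    contDiffOn_zero.2 fun t ht => (hX.parallel p t ht).continuousAt.continuousWithinAt
  have h1 : ContDiffOn ℝ ((1 : ℕ) : ℕ∞ω) (frameIn η X p) (chartTimes n η a b p) :=
    contDiffOn_succ_of_hasDerivAt (hη.isOpen_chartTimes p) (hX.parallel p)
      (((hN.of_le (by exact_mod_cast le_top)).mul h0).neg)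
  exact contDiffOn_succ_of_hasDerivAt (hη.isOpen_chartTimes p) (hX.parallel p)
      (((hN.of_le (by exact_mod_cast le_top)).mul h1).neg)

theorem contMDiffOn_frameField (hη : S.IsTimelikeGeodesic η a b)
    (hX : IsLorentzFrame S η a b c X) {y : ℝ → CoordSpace n}
    (hy : ContDiffOn ℝ 2 y (interval a b)) :
    ContMDiffOn 𝓘(ℝ, ℝ) (𝓡 (n + 1)).tangent 2
      (fun t => (⟨η t, frameField η X y t⟩ : TangentBundle (𝓡 (n + 1)) M)) (interval a b) := by
  intro t ht
  have ht' := mem_chartTimes_self (n := n) (η := η) ht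
  rw [Bundle.contMDiffWithinAt_totalSpace]
  refine ⟨(hη.smooth t ht).of_le ENat.LEInfty.out, ?_⟩
  have h1 : ContDiffAt ℝ 2 (fun s => frameIn η X (η t) s (y s)) t :=
    ((contDiffOn_frameIn hη hX (η t)).contDiffAt ((hη.isOpen_chartTimes _).mem_nhds ht')).clm_apply
      (hy.contDiffAt ((isOpen_interval a b).mem_nhds ht))
  have h2 := h1.contMDiffAt.contMDiffWithinAt (s := interval a b)
  have h : ∀ s ∈ chartTimes n η a b (η t), η s ∈ (trivializationAt (CoordSpace n)
      (TangentSpace (𝓡 (n + 1)) : M → Type _) (η t)).baseSet := fun s hs => by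
    rw [TangentBundle.trivializationAt_baseSet, ← extChartAt_source (𝓡 (n + 1))]
    exact hs.2
  refine h2.congr_of_eventuallyEq ?_ ?_
  · filter_upwards [mem_nhdsWithin_of_mem_nhds ((hη.isOpen_chartTimes (η t)).mem_nhds ht')]
      with s hs
    exact (Bundle.Trivialization.continuousLinearMapAt_apply_of_mem _ _ (h s hs) _).symm
  · exact (Bundle.Trivialization.continuousLinearMapAt_apply_of_mem _ _ (h t ht') _).symm

/-- A solution of the Jacobi equation in a Lorentz frame yields a Jacobi field orthogonal to `η̇`.
-/
theorem isJacobiField_of_isJacobiVec (hη : S.IsTimelikeGeodesic η a b)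
    (hX : IsLorentzFrame S η a b c X) (hc : 0 < c) {y y' : ℝ → EuclideanSpace ℝ (Fin n)}
    (hy : IsJacobiVec (spatialCurv S η X) (interval a b) y y') :
    S.IsJacobiField η a b (frameField η X fun t => spatialIncl n (y t)) := by
  have hd : ∀ t ∈ interval a b, HasDerivAt (fun t => spatialIncl n (y t))
      (spatialIncl n (y' t)) t := fun t ht =>
    (spatialIncl n).hasFDerivAt.comp_hasDerivAt t (hy t ht).1
  have hd' : ∀ t ∈ interval a b, HasDerivAt (fun t => spatialIncl n (y' t))
      (spatialIncl n (-(spatialCurv S η X t (y t)))) t := fun t ht =>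
    (spatialIncl n).hasFDerivAt.comp_hasDerivAt t (hy t ht).2
  constructor
  · have h0 : ContDiffOn ℝ ((0 : ℕ) : ℕ∞ω)
        (fun t => spatialIncl n (-(spatialCurv S η X t (y t)))) (interval a b) := by
      refine contDiffOn_zero.2 ((spatialIncl n).continuous.comp_continuousOn ?_)
      exact ((continuousOn_spatialCurv hη hX).clm_apply fun t ht =>
        (hy t ht).1.continuousAt.continuousWithinAt).neg
    have h1 : ContDiffOn ℝ ((1 : ℕ) : ℕ∞ω) (fun t => spatialIncl n (y' t)) (interval a b) :=
      contDiffOn_succ_of_hasDerivAt (isOpen_interval a b) hd' h0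
    exact contMDiffOn_frameField hη hX
      (contDiffOn_succ_of_hasDerivAt (isOpen_interval a b) hd h1)
  · intro t ht
    rw [covDeriv_frameField hη hX ht (hd' t ht)
      (fun s hs => covDeriv_frameField hη hX hs (hd s hs) fun _ _ => rfl),
      R_frameField hη ht]
    have h1 := frameIn_spatialCurv hη hX hc ht (y t)
    have h2 : toCoord (η t) (η t) (frameField η X (fun t => spatialIncl n (y t)) t) =
      frameIn η X (η t) t (spatialIncl n (y t)) := rfl
    rw [h2, ← h1, ofCoord_frameIn, map_neg, map_neg]
    exact neg_add_cancel _

/-- A nontrivial solution of the Jacobi equation in a Lorentz frame that has two zeros yields a pair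
of conjugate points. -/
theorem hasConjugatePair_of_not_isDisconjugate (hη : S.IsTimelikeGeodesic η a b)
    (hX : IsLorentzFrame S η a b c X) (hc : 0 < c)
    (h : ¬ IsDisconjugate (spatialCurv S η X) (interval a b)) : S.HasConjugatePair η a b := by
  unfold IsDisconjugate at h
  push Not at h
  obtain ⟨y, y', hy, t₁, ht₁, t₂, ht₂, hlt, h1, h2, t, ht, hyt⟩ := h
  have h0 : ∀ s, y s = 0 → frameField η X (fun t => spatialIncl n (y t)) s = 0 := fun s hs => by
    rw [frameField, hs, map_zero, map_zero]; rfl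
  refine ⟨t₁, ht₁, t₂, ht₂, hlt, _, isJacobiField_of_isJacobiVec hη hX hc hy,
    ⟨t, ht, fun h3 => hyt ?_⟩, h0 t₁ h1, h0 t₂ h2⟩
  obtain ⟨u, hu⟩ := hX.isUnit (η t) t (mem_chartTimes_self ht)
  have h4 : frameIn η X (η t) t (spatialIncl n (y t)) = 0 := by
    have h5 := congrArg (toCoord (η t) (η t)) h3
    rw [toCoord_zero] at h5
    exact h5
  rw [← hu] at h4
  have h6 : spatialIncl n (y t) = (↑u⁻¹ * ↑u : CoordSpace n →L[ℝ] CoordSpace n)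
    (spatialIncl n (y t)) := by rw [Units.inv_mul]; rfl
  rw [mul_apply_eq_comp, h4, map_zero] at h6
  exact spatialIncl_eq_zero.1 h6

end LorentzFinsler

/-! ### The weight function along a timelike geodesic -/

namespace LorentzFinsler

open Set Filter

variable {n : ℕ} {M : Type*} [TopologicalSpace M] [ChartedSpace (CoordSpace n) M]
  [IsManifold (𝓡 (n + 1)) ∞ M] {S : FinslerSpacetime n M} {η : ℝ → M} {a b : EReal} {t : ℝ}
  {X : ℝ → CoordSpace n →L[ℝ] CoordSpace n} {c : ℝ} {ψ : TangentBundle (𝓡 (n + 1)) M → ℝ}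

theorem FinslerSpacetime.IsTimelikeGeodesic.contMDiffOn_lift (hη : S.IsTimelikeGeodesic η a b) :
    ContMDiffOn 𝓘(ℝ, ℝ) (𝓡 (n + 1)).tangent ∞ (lift (n := n) η) (interval a b) := by
  intro t ht
  have ht' := mem_chartTimes_self (n := n) (η := η) ht
  have hs := hη.sprayCurve (η t)
  have h1 : ContMDiffOn 𝓘(ℝ, ℝ) 𝓘(ℝ, CoordSpace n × CoordSpace n) ∞
      (fun s => (coordCurve (η t) η s, deriv (coordCurve (η t) η) s)) (chartTimes n η a b (η t)) :=
    (hs.smooth.prodMk hs.smooth_vel).contMDiffOn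
  have h2 := (contMDiffOn_ofChart (η t)).comp h1 fun s hs' => (hs.mem s hs').1
  have h3 := h2.contMDiffAt ((hη.isOpen_chartTimes (η t)).mem_nhds ht')
  refine (h3.congr_of_eventuallyEq ?_).contMDiffWithinAt
  filter_upwards [(hη.isOpen_chartTimes (η t)).mem_nhds ht'] with s hs'
  rw [Function.comp_apply, ← hη.toCoord_velocity hs'.1 hs'.2]
  exact (ofChart_extChartAt hs'.2 _).symm

theorem FinslerSpacetime.IsWeight.contDiffOn (hψ : S.IsWeight ψ)
    (hη : S.IsTimelikeGeodesic η a b) :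
    ContDiffOn ℝ ∞ (fun s => ψ (lift η s)) (interval a b) :=
  (hψ.smooth.comp hη.contMDiffOn_lift fun t ht =>
    FinslerSpacetime.future_subset_futureCausal (hη.timelike t ht)).contDiffOn

/-- A timelike geodesic has constant speed. -/
theorem F_lift (hη : S.IsTimelikeGeodesic η a b) (hX : IsLorentzFrame S η a b c X) (hc : 0 < c)
    (ht : t ∈ interval a b) : S.F (lift η t) = c := by
  have ht' := mem_chartTimes_self (n := n) (η := η) ht
  have h1 := hη.inner_g_vel ht'
  rw [hX.vel _ t ht', map_smul, real_inner_smul_left, real_inner_smul_right] at h1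
  have h2 : inner ℝ (chartOp η (η t) (gLow S.L (η t)) t (frameIn η X (η t) t (coordBasis 0)))
      (frameIn η X (η t) t (coordBasis 0)) = -1 := by
    rw [← inner_star_apply]
    change inner ℝ ((star (frameIn η X (η t) t) * chartOp η (η t) (gLow S.L (η t)) t *
      frameIn η X (η t) t) (coordBasis 0)) (coordBasis 0) = -1
    rw [hX.metric _ t ht', minkOp_coordBasis_zero, inner_neg_left]
    simp [coordBasis]
  rw [h2] at h1
  rw [FinslerSpacetime.F, ← Real.sqrt_sq hc.le]
  congr 1
  linarith

section Shift

omit [IsManifold (𝓡 (n + 1)) ∞ M] in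
theorem lift_comp_add {η : ℝ → M} {s t : ℝ}
    (h : MDifferentiableAt 𝓘(ℝ, ℝ) (𝓡 (n + 1)) η (s + t)) :
    lift (n := n) (fun r => η (r + t)) s = lift η (s + t) := by
  have h1 : HasDerivAt (fun r : ℝ => r + t) 1 s := (hasDerivAt_id s).add_const t
  have h2 : MDifferentiableAt 𝓘(ℝ, ℝ) 𝓘(ℝ, ℝ) (fun r : ℝ => r + t) s :=
    h1.differentiableAt.mdifferentiableAt
  have h3 := mfderiv_comp s (g := η) (f := fun r : ℝ => r + t) h h2
  have h4 : velocity (n := n) (fun r => η (r + t)) s = velocity (n := n) η (s + t) := by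
    change mfderiv 𝓘(ℝ, ℝ) (𝓡 (n + 1)) (η ∘ fun r : ℝ => r + t) s (1 : ℝ) = _
    rw [h3]
    change mfderiv 𝓘(ℝ, ℝ) (𝓡 (n + 1)) η (s + t)
      (mfderiv 𝓘(ℝ, ℝ) 𝓘(ℝ, ℝ) (fun r : ℝ => r + t) s (1 : ℝ)) = _
    rw [mfderiv_eq_fderiv]
    exact congrArg (mfderiv 𝓘(ℝ, ℝ) (𝓡 (n + 1)) η (s + t)) h1.deriv
  exact congrArg (Bundle.TotalSpace.mk (E := (TangentSpace (𝓡 (n + 1)) : M → Type _))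
    (F := CoordSpace n) (η (s + t))) h4

theorem exists_shift (ht : t ∈ interval a b) : ∃ δ : ℝ, 0 < δ ∧
    ∀ s ∈ interval ((-δ : ℝ) : EReal) (δ : EReal), s + t ∈ interval a b := by
  obtain ⟨δ, hδ, h⟩ := Metric.isOpen_iff.1 (isOpen_interval a b) t ht
  refine ⟨δ, hδ, fun s hs => h ?_⟩
  have h1 := EReal.coe_lt_coe_iff.1 hs.1
  have h2 := EReal.coe_lt_coe_iff.1 hs.2
  rw [Metric.mem_ball, Real.dist_eq, add_sub_cancel_right, abs_lt]
  exact ⟨h1, h2⟩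

/-- A translate of a geodesic in time is a geodesic. -/
theorem FinslerSpacetime.IsTimelikeGeodesic.shift (hη : S.IsTimelikeGeodesic η a b)
    {a' b' : EReal} (h : ∀ s ∈ interval a' b', s + t ∈ interval a b) :
    S.IsTimelikeGeodesic (fun s => η (s + t)) a' b' where
  smooth := by
    have h1 : ContMDiff 𝓘(ℝ, ℝ) 𝓘(ℝ, ℝ) ∞ (fun s : ℝ => s + t) :=
      (contDiff_id.add contDiff_const).contMDiff
    exact hη.smooth.comp h1.contMDiffOn h
  timelike s hs := by
    rw [lift_comp_add ((hη.contMDiffAt (h s hs)).mdifferentiableAt (by simp))]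
    exact hη.timelike _ (h s hs)
  geodesic s hs p hp α := by
    have h1 : deriv (coordCurve (n := n) p fun s => η (s + t)) =
        fun s => deriv (coordCurve p η) (s + t) := by
      ext1 s
      exact deriv_comp_add_const (coordCurve p η) t s
    have h2 := hη.geodesic (s + t) (h s hs) p hp α
    rw [h1, deriv_comp_add_const (deriv (coordCurve (n := n) p η)) t s]
    exact h2

/-- The convergence condition refers to the weighted Ricci curvature at time `0` of the geodesic
with a given initial velocity. A translation in time carries it over to any time of any timelike
geodesic. -/
theorem weightedRic_nonneg {N : EReal} (hconv : S.TimelikeConvergence ψ N)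
    (hη : S.IsTimelikeGeodesic η a b) (ht : t ∈ interval a b) : 0 ≤ S.weightedRic ψ N η t := by
  obtain ⟨δ, hδ, h⟩ := exists_shift ht
  have hη' := hη.shift h
  have hlift : ∀ s ∈ interval ((-δ : ℝ) : EReal) (δ : EReal),
      lift (n := n) (fun s => η (s + t)) s = lift η (s + t) := fun s hs =>
    lift_comp_add ((hη.contMDiffAt (h s hs)).mdifferentiableAt (by simp))
  have h0 : (0 : ℝ) ∈ interval ((-δ : ℝ) : EReal) (δ : EReal) :=
    ⟨EReal.coe_lt_coe_iff.2 (by linarith), EReal.coe_lt_coe_iff.2 hδ⟩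
  have h1 := hconv _ (hη'.timelike 0 h0) δ _ hδ hη' rfl
  have h2 : (fun s => ψ (lift (n := n) (fun s => η (s + t)) s)) =ᶠ[𝓝 0]
      fun s => ψ (lift η (s + t)) := by
    filter_upwards [(isOpen_interval _ _).mem_nhds h0] with s hs
    rw [hlift s hs]
  have h3 : (fun s => deriv (fun s => ψ (lift η s)) (s + t)) =
      deriv fun s => ψ (lift (n := n) η (s + t)) := by
    ext1 s
    exact (deriv_comp_add_const (fun s => ψ (lift η s)) t s).symm
  have h4 : deriv (fun s => ψ (lift (n := n) (fun s => η (s + t)) s)) 0 =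
      deriv (fun s => ψ (lift η s)) t := by
    rw [h2.deriv_eq, ← h3]
    beta_reduce
    rw [zero_add]
  have h5 : deriv (deriv fun s => ψ (lift (n := n) (fun s => η (s + t)) s)) 0 =
      deriv (deriv fun s => ψ (lift η s)) t := by
    rw [h2.deriv.deriv_eq, ← h3, deriv_comp_add_const (deriv fun s => ψ (lift η s)) t 0, zero_add]
  have h6 : lift (n := n) (fun s => η (s + t)) 0 = lift η t := by rw [hlift 0 h0, zero_add]
  have h7 : S.weightedRic ψ N (fun s => η (s + t)) 0 = S.weightedRic ψ N η t := by
    simp only [FinslerSpacetime.weightedRic]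
    rw [h4, h5, h6]
  rwa [h7] at h1

end Shift

/-! ### The ends of an interval -/

theorem neBot_toRightEnd (hab : a < b) : (toRightEnd b).NeBot := by
  refine comap_neBot_iff.2 fun s hs => ?_
  obtain ⟨l, hl, h⟩ := (mem_nhdsLT_iff_exists_Ioo_subset' hab).1 hs
  obtain ⟨t, h1, h2⟩ := EReal.lt_iff_exists_real_btwn.1 hl
  exact ⟨t, h ⟨h1, h2⟩⟩

theorem neBot_toLeftEnd (hab : a < b) : (toLeftEnd a).NeBot := by
  refine comap_neBot_iff.2 fun s hs => ?_
  obtain ⟨l, hl, h⟩ := (mem_nhdsGT_iff_exists_Ioo_subset' hab).1 hs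
  obtain ⟨t, h1, h2⟩ := EReal.lt_iff_exists_real_btwn.1 hl
  exact ⟨t, h ⟨h1, h2⟩⟩

theorem eventually_toRightEnd (ht : t ∈ interval a b) :
    ∀ᶠ s in toRightEnd b, s ∈ interval a b ∧ t < s := by
  have h1 : Ioo (t : EReal) b ∈ 𝓝[<] b := Ioo_mem_nhdsLT ht.2
  filter_upwards [preimage_mem_comap h1] with s hs
  exact ⟨⟨ht.1.trans hs.1, hs.2⟩, EReal.coe_lt_coe_iff.1 hs.1⟩

theorem eventually_toLeftEnd (ht : t ∈ interval a b) :
    ∀ᶠ s in toLeftEnd a, s ∈ interval a b ∧ s < t := by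
  have h1 : Ioo a (t : EReal) ∈ 𝓝[>] a := Ioo_mem_nhdsGT ht.1
  filter_upwards [preimage_mem_comap h1] with s hs
  exact ⟨⟨hs.1, hs.2.trans ht.2⟩, EReal.coe_lt_coe_iff.1 hs.2⟩

theorem exists_seq_toRightEnd (hab : a < b) : ∃ s : ℕ → ℝ, (∀ k, s k ∈ interval a b) ∧
    ∀ t ∈ interval a b, ∀ᶠ k in atTop, t < s k := by
  have := neBot_toRightEnd hab
  obtain ⟨t₀, ht₀⟩ := nonempty_interval hab
  have : (toRightEnd b).IsCountablyGenerated := by unfold toRightEnd; infer_instance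
  obtain ⟨s, hs⟩ := exists_seq_tendsto (toRightEnd b)
  obtain ⟨K, hK⟩ := eventually_atTop.1 (hs.eventually (eventually_toRightEnd ht₀))
  refine ⟨fun k => s (k + K), fun k => (hK _ (Nat.le_add_left K k)).1, fun t ht => ?_⟩
  exact (tendsto_add_atTop_nat K).eventually
    ((hs.eventually (eventually_toRightEnd ht)).mono fun k hk => hk.2)

/-! ### Weighted Ricci curvature and the `ε`-range -/

/-- If `N ∈ (-∞, 0) ∪ [n, ∞]` and `ε` is in the timelike `ε`-range, nonnegativity of the weighted
Ricci curvature yields that of `Ric + ψ'' - q ψ'²` and the positivity of the quadratic form that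
governs the Riccati comparison. Here `q = 1 / (N - n)`, and `c = 1 - ε² / κ` with `κ = 1 + n q = N /
(N - n)`. For `N = ∞` these are `q = 0` and `c = 1 - ε²`. For `N = n` the curvature bound forces `ψ'
= 0`, and `q = 0`, `c = 1` will do. -/
theorem exists_comparison_constants (hn : 1 ≤ n) {N : EReal}
    (hN : (N ≠ ⊥ ∧ N < 0) ∨ (n : EReal) ≤ N) {ε : ℝ} (hε : InTimelikeEpsRange n N ε)
    (S : FinslerSpacetime n M) (ψ : TangentBundle (𝓡 (n + 1)) M → ℝ) (η : ℝ → M) :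
    ∃ q c : ℝ, 0 < 1 + n * q ∧ 0 < c ∧ ∀ t, 0 ≤ S.weightedRic ψ N η t →
      0 ≤ S.Ric (lift η t) + deriv (deriv fun s => ψ (lift η s)) t
        - q * deriv (fun s => ψ (lift η s)) t ^ 2 ∧
      ∀ x, c * x ^ 2 ≤ x ^ 2 + 2 * ε * x * deriv (fun s => ψ (lift η s)) t +
        (1 + n * q) * deriv (fun s => ψ (lift η s)) t ^ 2 := by
  have hn0 : (0 : ℝ) < n := Nat.cast_pos.2 hn
  have hnE : (0 : EReal) < (n : EReal) := by exact_mod_cast hn0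
  have hN0 : N ≠ 0 := by
    rintro rfl
    rcases hN with h | h
    · exact lt_irrefl _ h.2
    · exact absurd hnE h.not_gt
  rw [InTimelikeEpsRange, if_neg hN0] at hε
  by_cases hT : N = ⊤
  · rw [if_pos hT] at hε
    refine ⟨0, 1 - ε ^ 2, by simp, by nlinarith [abs_lt.1 hε], fun t ht => ?_⟩
    rw [FinslerSpacetime.weightedRic, if_pos hT] at ht
    have h1 := EReal.coe_nonneg.1 ht
    refine ⟨by linarith, fun x => ?_⟩
    nlinarith [sq_nonneg (ε * x + deriv (fun s => ψ (lift η s)) t)]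
  rw [if_neg hT] at hε
  by_cases hNn : N = n
  · refine ⟨0, 1, by simp, one_pos, fun t ht => ?_⟩
    rw [FinslerSpacetime.weightedRic, if_neg hT, if_pos hNn] at ht
    by_cases hd : deriv (fun s => ψ (lift η s)) t = 0
    · rw [if_pos hd] at ht
      have h1 := EReal.coe_nonneg.1 ht
      rw [hd]
      exact ⟨by linarith, fun x => by linarith⟩
    · rw [if_neg hd] at ht
      exact absurd ht (not_le.2 EReal.bot_lt_zero)
  rw [if_neg hNn] at hε
  have hB : N ≠ ⊥ := by
    rcases hN with h | h
    · exact h.1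
    · exact (lt_of_lt_of_le (EReal.bot_lt_zero.trans hnE) h).ne'
  have hr : ((N.toReal : ℝ) : EReal) = N := EReal.coe_toReal hT hB
  set r := N.toReal
  have hrn : r < 0 ∨ (n : ℝ) < r := by
    rcases hN with h | h
    · left
      rw [← hr] at h
      exact_mod_cast h.2
    · right
      have h1 := lt_of_le_of_ne h (Ne.symm hNn)
      rw [← hr] at h1
      exact_mod_cast h1
  have hne : r - n ≠ 0 := by rcases hrn with h | h <;> intro h0 <;> linarith
  have hκ : 1 + n * (1 / (r - n)) = r / (r - n) := by field_simp; ring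
  have hκ0 : 0 < r / (r - n) := by
    rcases hrn with h | h
    · exact div_pos_of_neg_of_neg h (by linarith)
    · exact div_pos (by linarith) (by linarith)
  set κ := r / (r - n)
  have hεκ : ε ^ 2 < κ := by
    have h1 := Real.sq_sqrt hκ0.le
    have h2 := abs_nonneg ε
    rw [← sq_abs, ← h1]
    exact pow_lt_pow_left₀ hε h2 two_ne_zero
  refine ⟨1 / (r - n), 1 - ε ^ 2 / κ, by rw [hκ]; exact hκ0, ?_, fun t ht => ?_⟩
  · rw [sub_pos, div_lt_one hκ0]; exact hεκ
  rw [FinslerSpacetime.weightedRic, if_neg hT, if_neg hNn] at ht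
  have h1 := EReal.coe_nonneg.1 ht
  refine ⟨by rw [one_div_mul_eq_div]; exact h1, fun x => ?_⟩
  rw [hκ]
  set d := deriv (fun s => ψ (lift η s)) t
  have h2 : x ^ 2 + 2 * ε * x * d + κ * d ^ 2 - (1 - ε ^ 2 / κ) * x ^ 2 =
      (ε * x + κ * d) ^ 2 / κ := by field_simp; ring
  have h3 : 0 ≤ (ε * x + κ * d) ^ 2 / κ := by positivity
  linarith

/-- An `ε`-complete timelike geodesic contains a pair of conjugate points: otherwise the Jacobi
equation has a global Riccati solution, which forces the curvature to vanish along the geodesic. -/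
theorem hasConjugatePair_of_isEpsComplete (hn : 1 ≤ n) (hψ : S.IsWeight ψ) {N : EReal}
    (hN : (N ≠ ⊥ ∧ N < 0) ∨ (n : EReal) ≤ N) (hgen : S.TimelikeGeneric)
    (hconv : S.TimelikeConvergence ψ N) (hab : a < b) (hη : S.IsTimelikeGeodesic η a b) {ε : ℝ}
    (hε : InTimelikeEpsRange n N ε) (hcomplete : S.IsEpsComplete ψ ε η a b) :
    S.HasConjugatePair η a b := by
  obtain ⟨hinext, ⟨τ, hτ, hτtop⟩, ⟨τ', hτ', hτbot⟩⟩ := hcomplete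
  obtain ⟨c, hc, X, hX⟩ := hη.exists_isLorentzFrame hab
  obtain ⟨t₁, ht₁, w, -, hw⟩ := hgen a b η hab hη hinext
  obtain ⟨t₀, ht₀⟩ := nonempty_interval hab
  have hIo := isOpen_interval a b
  have hI := ordConnected_interval a b
  refine hasConjugatePair_of_not_isDisconjugate hη hX hc fun hdis => hw ?_
  obtain ⟨U, hU⟩ := hdis.exists_isRiccatiAt hIo hI ⟨t₀, ht₀⟩ (continuousOn_spatialCurv hη hX)
    (fun t ht => inner_spatialCurv hη X ht) (exists_seq_toRightEnd hab)
  obtain ⟨q, d, hq, hd, hcomp⟩ := exists_comparison_constants hn hN hε S ψ η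
  have hsm := hψ.contDiffOn hη
  have hsm' : ContDiffOn ℝ ∞ (deriv fun s => ψ (lift η s)) (interval a b) :=
    hsm.deriv_of_isOpen hIo (by simp)
  have hfin : Module.finrank ℝ (EuclideanSpace ℝ (Fin n)) = n := finrank_euclideanSpace_fin
  -- Completeness provides one `ε`-proper time for each end, and these differ by a constant.
  have hττ' : ∀ t ∈ interval a b, τ' t = τ t + (τ' t₀ - τ t₀) := fun t ht => by
    have h1 : ∀ s ∈ interval a b, HasDerivAt (fun s => τ' s - τ s) 0 s := fun s hs =>
      ((hτ' s hs).sub (hτ s hs)).congr_deriv (sub_self _)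
    have h2 := hIo.is_const_of_deriv_eq_zero hI.isPreconnected
      (fun s hs => (h1 s hs).differentiableAt.differentiableWithinAt)
      (fun s hs => (h1 s hs).deriv) ht ht₀
    linarith
  have hK := eq_zero_of_isRiccatiAt hIo hI (by rw [hfin]; exact hn) hU
    (fun t ht => ((hsm.contDiffAt (hIo.mem_nhds ht)).differentiableAt (by simp)).hasDerivAt)
    (fun t ht => ((hsm'.contDiffAt (hIo.mem_nhds ht)).differentiableAt (by simp)).hasDerivAt)
    (q := q) (ε := ε) (c := d) (C := c) (τ := τ) (by rw [hfin]; exact hq)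
    (fun t ht => by
      rw [traceL_spatialCurv hη hX hc ht]
      exact (hcomp t (weightedRic_nonneg hconv hη ht)).1)
    hd hc
    (fun t ht => by rw [hfin]; exact (hcomp t (weightedRic_nonneg hconv hη ht)).2)
    (fun t ht => by
      rw [hfin, ← F_lift hη hX hc ht]
      exact hτ t ht)
    (fun C t ht => by
      have := neBot_toRightEnd hab
      obtain ⟨s, hs, hC⟩ := ((eventually_toRightEnd ht).and (hτtop.eventually_ge_atTop C)).exists
      exact ⟨s, hs.1, hs.2.le, hC⟩)
    (fun C t ht => by
      have := neBot_toLeftEnd hab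
      obtain ⟨s, hs, hC⟩ := ((eventually_toLeftEnd ht).and
        (hτbot.eventually_le_atBot (C + (τ' t₀ - τ t₀)))).exists
      refine ⟨s, hs.1, hs.2.le, ?_⟩
      rw [hττ' s hs.1] at hC
      linarith)
  rw [R_frameField hη ht₁, chartOp_curv_eq_zero hη hX hc ht₁ (hK t₁ ht₁)]
  exact ofCoord_zero _ _

end LorentzFinsler

theorem mainTheorem6 {n : ℕ} (hn : 1 ≤ n) {M : Type*} [TopologicalSpace M]
    [ChartedSpace (LorentzFinsler.CoordSpace n) M] [IsManifold (𝓡 (n + 1)) ∞ M]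
    [T2Space M] [SecondCountableTopology M] [ConnectedSpace M]
    (S : LorentzFinsler.FinslerSpacetime n M)
    (ψ : TangentBundle (𝓡 (n + 1)) M → ℝ) (hψ : S.IsWeight ψ)
    (N : EReal) (hN : (N ≠ ⊥ ∧ N < 0) ∨ (n : EReal) ≤ N)
    (hgen : S.TimelikeGeneric) (hconv : S.TimelikeConvergence ψ N)
    (a b : EReal) (hab : a < b) (η : ℝ → M) (hη : S.IsTimelikeGeodesic η a b) :
    S.HasConjugatePair η a b ∨
      ∀ ε : ℝ, LorentzFinsler.InTimelikeEpsRange n N ε → ¬ S.IsEpsComplete ψ ε η a b := by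
  refine or_iff_not_imp_left.2 fun h ε hε hcomplete => h ?_
  exact LorentzFinsler.hasConjugatePair_of_isEpsComplete hn hψ hN hgen hconv hab hη hε hcomplete
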